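/- For a positive integer $m$ let $\psi(m)$ denote the pseudoachromatic index of the complete graph $K_m$, i.e. the largest integer $k$ for which the edges of $K_m$ can be coloured (not necessarily properly) with $k$ colours, all of them used, so that for every two distinct colours there are two adjacent edges (edges sharing a vertex) having these colours. Let $q\ge 4$ be an even natural number, let $n=q^2+q+1$, let $a\in\{-1,0,\dots,\frac q2+1\}$ and let $m_a=n+q-a$. If there exists a projective plane of order $q$, then $$\psi(m_a)\ \ge\ (m_a-a)\,q .$$ -/

import Mathlib

/-- A complete vertex-colouring of `G` with colour set `C` (not necessarily proper): every colour is
used, and every pair of distinct colours appears on the end-vertices of some edge of `G`. -/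
def IsCompleteColouring {V C : Type*} (G : SimpleGraph V) (c : V → C) : Prop :=
  Function.Surjective c ∧
    ∀ i j : C, i ≠ j → ∃ u v : V, G.Adj u v ∧ c u = i ∧ c v = j

/-- The pseudoachromatic number of a finite graph `G`: the largest number of colours in a complete
vertex-colouring of `G`. -/
noncomputable def pseudoachromaticNumber {V : Type*} [Finite V] (G : SimpleGraph V) : ℕ :=
  sSup {k : ℕ | ∃ c : V → Fin k, IsCompleteColouring G c}

/-- The supremum in the definition of the pseudoachromatic number is a maximum. -/
theorem isGreatest_pseudoachromaticNumber {V : Type*} [Finite V] (G : SimpleGraph V) :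
    IsGreatest {k : ℕ | ∃ c : V → Fin k, IsCompleteColouring G c} (pseudoachromaticNumber G) := by
  have hb : BddAbove {k : ℕ | ∃ c : V → Fin k, IsCompleteColouring G c} := by
    refine ⟨Nat.card V, ?_⟩
    rintro k ⟨c, hc, -⟩
    simpa using Nat.card_le_card_of_surjective c hc
  have hne : {k : ℕ | ∃ c : V → Fin k, IsCompleteColouring G c}.Nonempty := by
    cases isEmpty_or_nonempty V with
    | inl h => exact ⟨0, fun v => (IsEmpty.false v).elim, fun i => i.elim0, fun i => i.elim0⟩
    | inr h =>
      exact ⟨1, fun _ => 0, fun i => ⟨h.some, Subsingleton.elim _ _⟩,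
        fun i j hij => (hij (Subsingleton.elim _ _)).elim⟩
  exact ⟨Nat.sSup_mem hne hb, fun k hk => le_csSup hb hk⟩

/-- `psi m` is the pseudoachromatic index of the complete graph on `m` vertices, that is, the
pseudoachromatic number of its line graph. -/
noncomputable def psi (m : ℕ) : ℕ :=
  pseudoachromaticNumber (⊤ : SimpleGraph (Fin m)).lineGraph

/-! The vertices are the n points of the plane together with a set X of q - a further ones. A line
has q + 1 points, an odd number, so its pairs split into q + 1 near-1-factors, one missing each
point c of the line. A flag (l, c) gives a colour class: the near-1-factor of l missing c, plus one
completing edge at c. Such a class meets every point of l, and any two lines share a point, so any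
two of these classes meet. The difficulty is to find the completing edges: a point lies on q + 1
lines but has only q - a edges to X, so it is short of a + 1.

The shortage is met by giving up, or killing, some near-1-factors. Killing (l, u) spares u one
completion, and the released edges complete other flags. One near-1-factor releases q/2 edges; two
of them form a Hamiltonian path of l, along which each point but the last can take the edge to its
successor (`exists_linePattern_of_enum`). Every kill costs a colour, so the help has to be spread
almost evenly over the plane. Where this needs a choice of the points to be helped, it is made
fractionally, by explicit weights, and rounded with Hall's theorem (`exists_choice_of_weights`).

For a at most q/2 colours are also regained. For a ≥ 0 a set of a + 2 points is reserved, and the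
complete graph on these points and X, with q + 2 vertices, yields q + 1 additional classes, each
spanning; for a = -1 nothing is reserved and X alone, with q + 1 vertices, yields q - 1. A flag
class meets an additional class in a reserved point of its line, or, if there is none, in X, where
its completing edge is then made to end. In return the flags at a reserved point must be completed
by released edges alone. `le_psi_of_patterns` turns these local requirements into a colouring.

The colours number n(q + 1), minus the kills, plus the additional classes. There are no kills for a
= -1, at most (2a + 2)q + 2 for 0 ≤ a ≤ q/2, and n + 2q, without additional classes, for a = q/2 +
1. Each time this gives the required bound. -/

/-! ### Edge classes and the pseudoachromatic index -/

/-- Pairwise disjoint families of edges of a complete graph, any two of which have a vertex in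
common, bound the pseudoachromatic index from below. -/
theorem card_le_psi {V K : Type*} [Finite V] [Finite K] {m : ℕ} (hm : Nat.card V = m)
    (cls : K → Set (Sym2 V)) (hdiag : ∀ k, ∀ e ∈ cls k, ¬ e.IsDiag)
    (hdisj : ∀ k k' e, e ∈ cls k → e ∈ cls k' → k = k') (hne : ∀ k, (cls k).Nonempty)
    (hmeet : ∀ k k', k ≠ k' → ∃ v, (∃ e ∈ cls k, v ∈ e) ∧ ∃ e ∈ cls k', v ∈ e) :
    Nat.card K ≤ psi m := by
  classical
  cases isEmpty_or_nonempty K with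
  | inl h => simp
  | inr h =>
    have φ : Fin m ≃ V := (Finite.equivFinOfCardEq hm).symm
    let κ : K ≃ Fin (Nat.card K) := Finite.equivFin K
    -- Edges in no family get an arbitrary colour; enlarging a class only creates adjacencies.
    let c : (⊤ : SimpleGraph (Fin m)).edgeSet → Fin (Nat.card K) := fun e =>
      if hk : ∃ k, Sym2.map φ e.1 ∈ cls k then κ hk.choose else κ h.some
    have key : ∀ k, ∀ e ∈ cls k, ∃ e' : (⊤ : SimpleGraph (Fin m)).edgeSet,
        Sym2.map φ e'.1 = e ∧ c e' = κ k := by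
      intro k e he
      have hmap : Sym2.map φ (Sym2.map φ.symm e) = e := by
        rw [Sym2.map_map]; simp
      refine ⟨⟨Sym2.map φ.symm e, ?_⟩, hmap, ?_⟩
      · rw [SimpleGraph.edgeSet_top]
        have := hdiag k e he
        simpa [Sym2.isDiag_map φ.symm.injective] using this
      · have hk : ∃ k, Sym2.map φ (Sym2.map φ.symm e) ∈ cls k := ⟨k, by rwa [hmap]⟩
        simp only [c]
        rw [dif_pos hk]
        congr 1
        exact hdisj _ _ _ hk.choose_spec (by rw [hmap]; exact he)
    refine (isGreatest_pseudoachromaticNumber _).2 ⟨c, ?_, ?_⟩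
    · intro i
      obtain ⟨e, he⟩ := hne (κ.symm i)
      obtain ⟨e', -, h'⟩ := key _ e he
      exact ⟨e', by simpa using h'⟩
    · intro i j hij
      obtain ⟨v, ⟨e, he, hve⟩, ⟨f, hf, hvf⟩⟩ := hmeet (κ.symm i) (κ.symm j) (by simpa using hij)
      obtain ⟨e', h1, h2⟩ := key _ e he
      obtain ⟨f', h3, h4⟩ := key _ f hf
      simp only [Equiv.apply_symm_apply] at h2 h4
      refine ⟨e', f', ?_, h2, h4⟩
      rw [SimpleGraph.lineGraph_adj_iff_exists]
      refine ⟨fun h => hij (by rw [← h2, ← h4, h]), φ.symm v, ?_, ?_⟩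
      · rw [← h1, Sym2.mem_map] at hve
        obtain ⟨x, hx, rfl⟩ := hve
        simpa using hx
      · rw [← h3, Sym2.mem_map] at hvf
        obtain ⟨x, hx, rfl⟩ := hvf
        simpa using hx

/-! ### Rounding by Hall's theorem -/

/-- Rounding a fractional choice: if block `i` distributes total weight at most `t i * r` among
the points, at most `r` to each, and every point `u` gets weight at least `N u * r`, then one
can choose at most `t i` points from block `i` so that `u` is chosen at least `N u` times. -/
theorem exists_choice_of_weights {I U : Type*} [Fintype I] [Fintype U] [DecidableEq U]
    (r : ℕ) (hr : 0 < r) (W : I → U → ℕ) (t : I → ℕ) (N : U → ℕ)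
    (hW : ∀ i u, W i u ≤ r) (ht : ∀ i, ∑ u, W i u ≤ t i * r)
    (hN : ∀ u, N u * r ≤ ∑ i, W i u) :
    ∃ T : I → Finset U, (∀ i, ∀ u ∈ T i, 0 < W i u) ∧ (∀ i, (T i).card ≤ t i) ∧
      ∀ u, N u ≤ (Finset.univ.filter fun i => u ∈ T i).card := by
  classical
  -- Hall's theorem with the pairs (i, u) of positive weight as resources: the point u claims N u
  -- pairs to be chosen, the block i claims all but t i of its pairs to be rejected. A pair offers W
  -- to u and r - W to i, hence r altogether, while every claimant is offered at least r per claim;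
  -- this is Hall's condition.
  let supp : I → Finset U := fun i => Finset.univ.filter fun u => 0 < W i u
  let items : Finset (I × U) := Finset.univ.filter fun x => 0 < W x.1 x.2
  let D : I ⊕ U → ℕ := Sum.elim (fun i => (supp i).card - t i) N
  let nb : I ⊕ U → Finset (I × U) := Sum.elim (fun i => items.filter fun x => x.1 = i)
    (fun u => items.filter fun x => x.2 = u)
  let wt : I × U → I ⊕ U → ℕ := fun x => Sum.elim
    (fun i => if x.1 = i then r - W x.1 x.2 else 0) (fun u => if x.2 = u then W x.1 x.2 else 0)
  have hwt : ∀ x, ∑ v, wt x v = r := by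
    intro x
    rw [Fintype.sum_sum_type]
    simp only [wt, Sum.elim_inl, Sum.elim_inr, Finset.sum_ite_eq, Finset.mem_univ, if_true]
    have := hW x.1 x.2
    omega
  have hD : ∀ v, D v * r ≤ ∑ x ∈ items, wt x v := by
    rintro (i | u)
    · simp only [D, wt, Sum.elim_inl]
      have h1 : ∑ x ∈ items, (if x.1 = i then r - W x.1 x.2 else 0)
          = ∑ u ∈ supp i, (r - W i u) := by
        rw [← Finset.sum_filter]
        refine Finset.sum_bij' (fun x _ => x.2) (fun u _ => (i, u)) ?_ ?_ ?_ ?_ ?_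
        · rintro ⟨j, u⟩ h; simp [items, supp] at h ⊢; obtain ⟨h, rfl⟩ := h; exact h
        · intro u h; simpa [items, supp] using h
        · rintro ⟨j, u⟩ h; simp [items] at h ⊢; exact h.2.symm
        · intro u h; rfl
        · rintro ⟨j, u⟩ h; simp [items] at h ⊢; rw [h.2]
      rw [h1]
      have h2 : ∑ u ∈ supp i, (r - W i u) + ∑ u ∈ supp i, W i u = (supp i).card * r := by
        rw [← Finset.sum_add_distrib, Finset.sum_congr rfl (g := fun _ => r)
          (fun u _ => Nat.sub_add_cancel (hW i u))]
        simp
      have h3 : ∑ u ∈ supp i, W i u ≤ t i * r :=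
        (Finset.sum_le_sum_of_subset (Finset.subset_univ _)).trans (ht i)
      rw [Nat.sub_mul]
      omega
    · simp only [D, wt, Sum.elim_inr]
      have h1 : ∑ x ∈ items, (if x.2 = u then W x.1 x.2 else 0) = ∑ i, W i u := by
        rw [← Finset.sum_filter]
        rw [← Finset.sum_filter_add_sum_filter_not Finset.univ (fun i => 0 < W i u)]
        have h0 : ∑ i with ¬ 0 < W i u, W i u = 0 :=
          Finset.sum_eq_zero fun i hi => by simpa using hi
        rw [h0, add_zero]
        refine Finset.sum_bij' (fun x _ => x.1) (fun i _ => (i, u)) ?_ ?_ ?_ ?_ ?_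
        · rintro ⟨j, u⟩ h; simp [items] at h ⊢; obtain ⟨h, rfl⟩ := h; exact h
        · intro i h; simpa [items] using h
        · rintro ⟨j, u⟩ h; simp [items] at h ⊢; exact h.2.symm
        · intro u h; rfl
        · rintro ⟨j, u⟩ h; simp [items] at h ⊢; rw [h.2]
      rw [h1]
      exact hN u
  have hall : ∀ s : Finset (Σ v, Fin (D v)), s.card ≤ (s.biUnion fun x => nb x.1).card := by
    intro s
    set A : Finset (I ⊕ U) := s.image Sigma.fst with hA
    have h1 : s.card ≤ ∑ v ∈ A, D v := by
      have : s ⊆ A.sigma fun v => Finset.univ := by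
        intro x hx
        simp only [Finset.mem_sigma, Finset.mem_univ, and_true, hA]
        exact Finset.mem_image_of_mem _ hx
      refine (Finset.card_le_card this).trans ?_
      simp [Finset.card_sigma]
    have h2 : (s.biUnion fun x => nb x.1) = A.biUnion nb := by
      ext x; simp [hA]
    have h3 : (∑ v ∈ A, D v) * r ≤ (A.biUnion nb).card * r := by
      calc (∑ v ∈ A, D v) * r = ∑ v ∈ A, D v * r := Finset.sum_mul _ _ _
        _ ≤ ∑ v ∈ A, ∑ x ∈ items, wt x v := Finset.sum_le_sum fun v _ => hD v
        _ = ∑ v ∈ A, ∑ x ∈ A.biUnion nb, wt x v := by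
            refine Finset.sum_congr rfl fun v hv => ?_
            symm
            refine Finset.sum_subset ?_ ?_
            · intro x hx
              simp only [Finset.mem_biUnion] at hx
              obtain ⟨w, -, hw⟩ := hx
              rcases w with i | u <;> simp only [nb, Sum.elim_inl, Sum.elim_inr] at hw <;>
                exact (Finset.mem_filter.1 hw).1
            · intro x hx hx'
              have hxv : x ∉ nb v := fun h => hx' (Finset.mem_biUnion.2 ⟨v, hv, h⟩)
              rcases v with i | u
              · have : x.1 ≠ i := fun h => hxv (by simp [nb, hx, h])
                simp [wt, this]
              · have : x.2 ≠ u := fun h => hxv (by simp [nb, hx, h])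
                simp [wt, this]
        _ = ∑ x ∈ A.biUnion nb, ∑ v ∈ A, wt x v := Finset.sum_comm
        _ ≤ ∑ x ∈ A.biUnion nb, r := by
            refine Finset.sum_le_sum fun x _ => ?_
            exact (Finset.sum_le_sum_of_subset (Finset.subset_univ _)).trans (hwt x).le
        _ = (A.biUnion nb).card * r := by simp
    rw [h2]
    exact h1.trans (Nat.le_of_mul_le_mul_right h3 hr)
  obtain ⟨f, hf, hfn⟩ :=
    (Finset.all_card_le_biUnion_card_iff_exists_injective fun x : Σ v, Fin (D v) => nb x.1).1 hall
  let T : I → Finset U := fun i =>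
    Finset.univ.filter fun u => ∃ j, f ⟨Sum.inr u, j⟩ = (i, u)
  have hTs : ∀ i, T i ⊆ supp i := by
    intro i u hu
    obtain ⟨j, hj⟩ := (Finset.mem_filter.1 hu).2
    have := hfn ⟨Sum.inr u, j⟩
    rw [hj] at this
    simp [nb, items] at this
    simpa [supp] using this
  refine ⟨T, fun i u hu => by simpa [supp] using hTs i hu, ?_, ?_⟩
  · intro i
    let B : Finset U := Finset.univ.image fun j : Fin (D (Sum.inl i)) => (f ⟨Sum.inl i, j⟩).2
    have hB1 : ∀ j, (f ⟨Sum.inl i, j⟩).1 = i := by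
      intro j
      have := hfn ⟨Sum.inl i, j⟩
      simp only [nb, Sum.elim_inl] at this
      exact (Finset.mem_filter.1 this).2
    have hBs : B ⊆ supp i := by
      intro u hu
      obtain ⟨j, -, rfl⟩ := Finset.mem_image.1 hu
      have := hfn ⟨Sum.inl i, j⟩
      simp only [nb, Sum.elim_inl] at this
      have h := (Finset.mem_filter.1 this).1
      have h' := (Finset.mem_filter.1 h).2
      rw [hB1] at h'
      simpa [supp] using h'
    have hBc : B.card = (supp i).card - t i := by
      rw [Finset.card_image_of_injective]
      · exact Finset.card_univ.trans (Fintype.card_fin _)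
      · intro j j' h
        have h' : f ⟨Sum.inl i, j⟩ = f ⟨Sum.inl i, j'⟩ := Prod.ext (by rw [hB1, hB1]) h
        simpa using hf h'
    have hdis : Disjoint (T i) B := by
      rw [Finset.disjoint_left]
      intro u hu hu'
      obtain ⟨j, hj⟩ := (Finset.mem_filter.1 hu).2
      obtain ⟨j', -, hj'⟩ := Finset.mem_image.1 hu'
      have : f ⟨Sum.inr u, j⟩ = f ⟨Sum.inl i, j'⟩ := by
        rw [hj]; exact Prod.ext (hB1 j').symm hj'.symm
      have := hf this
      simp at this
    have := Finset.card_le_card (Finset.union_subset (hTs i) hBs)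
    rw [Finset.card_union_of_disjoint hdis] at this
    omega
  · intro u
    have hu2 : ∀ j, (f ⟨Sum.inr u, j⟩).2 = u := by
      intro j
      have := hfn ⟨Sum.inr u, j⟩
      simp only [nb, Sum.elim_inr] at this
      exact (Finset.mem_filter.1 this).2
    have hc : (Finset.univ.image fun j : Fin (D (Sum.inr u)) => (f ⟨Sum.inr u, j⟩).1).card
        = N u := by
      rw [Finset.card_image_of_injective]
      · exact Finset.card_univ.trans (Fintype.card_fin _)
      · intro j j' h
        have h' : f ⟨Sum.inr u, j⟩ = f ⟨Sum.inr u, j'⟩ := Prod.ext h (by rw [hu2, hu2])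
        simpa using hf h'
    rw [← hc]
    refine Finset.card_le_card ?_
    intro i hi
    obtain ⟨j, -, rfl⟩ := Finset.mem_image.1 hi
    simp only [Finset.mem_filter, Finset.mem_univ, true_and, T]
    exact ⟨j, Prod.ext rfl (hu2 j)⟩

/-! ### Near-1-factors of a line and their released edges -/

/-- An assignment of midpoints to the pairs of points of `s`. The pairs with midpoint `c` cover all
points of `s` other than `c`. -/
structure MidpointOn {P : Type*} (s : Finset P) where
  mid : P → P → P
  mid_mem : ∀ {x y}, x ∈ s → y ∈ s → mid x y ∈ s
  mid_comm : ∀ {x y}, x ∈ s → y ∈ s → mid x y = mid y x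
  mid_self : ∀ {x}, x ∈ s → mid x x = x
  exists_mid : ∀ {x c}, x ∈ s → c ∈ s → ∃ y ∈ s, mid x y = c

/-- A set of an odd number of points, enumerated as `w 0, …, w (2 * h)`, has midpoints such that
those of consecutive points are alternately `w (2 * h)` and `w 0`. -/
theorem exists_midpointOn_of_enum {P : Type*} {s : Finset P} {h : ℕ} (hh : 0 < h)
    (w : Fin (2 * h + 1) ≃ s) :
    ∃ M : MidpointOn s, ∀ i : ℕ, ∀ hi : i < 2 * h,
      M.mid (w ⟨i, by omega⟩) (w ⟨i + 1, by omega⟩) =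
        if i % 2 = 0 then (w ⟨2 * h, by omega⟩ : P) else w ⟨0, by omega⟩ := by
  classical
  -- The zigzag 0, 1, -1, 2, -2, … modulo 2h + 1, ending in h + 1. The midpoint of x and y is (x +
  -- y)/2, with h + 1 the inverse of 2; consecutive terms have sums 1 and 0 alternately, hence
  -- midpoints h + 1 and 0, the two ends. Position 0 is separate so that the values stay below the
  -- modulus.
  let zn : ℕ → ℕ := fun i => if i = 0 then 0 else if i % 2 = 0 then 2 * h + 1 - i / 2
    else (i + 1) / 2
  let z : Fin (2 * h + 1) → ZMod (2 * h + 1) := fun i => (zn i : ZMod (2 * h + 1))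
  have hz : Function.Injective z := by
    intro i j hij
    have hlt : ∀ i : Fin (2 * h + 1), zn i < 2 * h + 1 := by
      intro i
      have := i.2
      simp only [zn]
      split_ifs <;> omega
    have h1 := (ZMod.natCast_eq_natCast_iff' _ _ _).1 hij
    rw [Nat.mod_eq_of_lt (hlt i), Nat.mod_eq_of_lt (hlt j)] at h1
    have hi := i.2
    have hj := j.2
    apply Fin.ext
    simp only [zn] at h1
    split_ifs at h1 <;> omega
  have hcard : Fintype.card (Fin (2 * h + 1)) = Fintype.card (ZMod (2 * h + 1)) := by
    rw [ZMod.card, Fintype.card_fin]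
  let Z : Fin (2 * h + 1) ≃ ZMod (2 * h + 1) :=
    Equiv.ofBijective z ((Fintype.bijective_iff_injective_and_card z).2 ⟨hz, hcard⟩)
  let e : s ≃ ZMod (2 * h + 1) := w.symm.trans Z
  have h0 : (2 * h + 1 : ZMod (2 * h + 1)) = 0 := by
    have := ZMod.natCast_self (2 * h + 1)
    push_cast at this
    exact this
  let mid : P → P → P := fun x y =>
    if hxy : x ∈ s ∧ y ∈ s then e.symm ((h + 1) * (e ⟨x, hxy.1⟩ + e ⟨y, hxy.2⟩)) else x
  have hmid : ∀ x y : s, mid x y = e.symm ((h + 1) * (e x + e y)) := by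
    intro x y
    simp only [mid]
    rw [dif_pos ⟨x.2, y.2⟩]
  refine ⟨⟨mid, ?_, ?_, ?_, ?_⟩, ?_⟩
  · intro x y hx hy
    have := hmid ⟨x, hx⟩ ⟨y, hy⟩
    simp only at this
    rw [this]
    exact Subtype.coe_prop _
  · intro x y hx hy
    have h1 := hmid ⟨x, hx⟩ ⟨y, hy⟩
    have h2 := hmid ⟨y, hy⟩ ⟨x, hx⟩
    simp only at h1 h2
    rw [h1, h2, add_comm (e ⟨x, hx⟩)]
  · intro x hx
    have h1 := hmid ⟨x, hx⟩ ⟨x, hx⟩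
    simp only at h1
    rw [h1]
    have : ((h : ZMod (2 * h + 1)) + 1) * (e ⟨x, hx⟩ + e ⟨x, hx⟩) = e ⟨x, hx⟩ := by
      linear_combination (e ⟨x, hx⟩) * h0
    rw [this, Equiv.symm_apply_apply]
  · intro x c hx hc
    refine ⟨e.symm (2 * e ⟨c, hc⟩ - e ⟨x, hx⟩), Subtype.coe_prop _, ?_⟩
    have h1 := hmid ⟨x, hx⟩ (e.symm (2 * e ⟨c, hc⟩ - e ⟨x, hx⟩))
    simp only at h1
    rw [h1, Equiv.apply_symm_apply]
    have : ((h : ZMod (2 * h + 1)) + 1) * (e ⟨x, hx⟩ + (2 * e ⟨c, hc⟩ - e ⟨x, hx⟩))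
        = e ⟨c, hc⟩ := by
      linear_combination (e ⟨c, hc⟩) * h0
    rw [this, Equiv.symm_apply_apply]
  · intro i hi
    simp only
    rw [hmid]
    have he : ∀ j, e (w j) = z j := by
      intro j
      simp [e, Z]
    have hes : ∀ j, e.symm (z j) = w j := by
      intro j
      rw [← he, Equiv.symm_apply_apply]
    rw [he, he]
    split_ifs with hpar
    · rw [← hes]
      congr 2
      simp only [z, zn]
      rcases Nat.eq_zero_or_pos i with rfl | hpos
      · rw [if_pos rfl, if_neg (by omega), if_neg (by omega), if_neg (by omega), if_pos (by omega)]
        have : 2 * h + 1 - 2 * h / 2 = h + 1 := by omega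
        rw [this]
        push_cast
        simp
      · obtain ⟨k, rfl⟩ : ∃ k, i = 2 * k := ⟨i / 2, by omega⟩
        rw [if_neg (by omega), if_pos (by omega), if_neg (by omega), if_neg (by omega),
          if_neg (by omega), if_pos (by omega)]
        have h1 : 2 * h + 1 - 2 * h / 2 = h + 1 := by omega
        have h2 : 2 * k / 2 = k := by omega
        have h3 : (2 * k + 1 + 1) / 2 = k + 1 := by omega
        rw [h1, h2, h3, Nat.cast_sub (by omega)]
        push_cast
        linear_combination (h + 1) * h0
    · rw [← hes]
      congr 2
      simp only [z, zn]
      obtain ⟨k, rfl⟩ : ∃ k, i = 2 * k + 1 := ⟨i / 2, by omega⟩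
      rw [if_neg (by omega), if_neg (by omega), if_neg (by omega), if_pos (by omega)]
      have h2 : (2 * k + 1 + 1) / 2 = k + 1 := by omega
      rw [h2, Nat.cast_sub (by omega)]
      push_cast
      linear_combination (h + 1) * h0

/-- A colouring scheme for the pairs inside a line `s`: the pairs with a common midpoint outside
`kill` form one colour class, and each point `u` of `served` is allotted the pair `{u, next u}`,
whose midpoint lies in `kill`; distinct points are allotted distinct pairs. -/
structure LinePattern {P : Type*} (s : Finset P) extends MidpointOn s where
  kill : Finset P
  served : Finset P
  next : P → P
  kill_subset : kill ⊆ s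
  served_subset : served ⊆ s
  next_mem : ∀ {u}, u ∈ served → next u ∈ s
  next_ne : ∀ {u}, u ∈ served → next u ≠ u
  mid_next : ∀ {u}, u ∈ served → mid u (next u) ∈ kill
  next_next : ∀ {u}, u ∈ served → next u ∈ served → next (next u) ≠ u

/-- Pairing the points of an enumeration with their successors. -/
theorem exists_linePattern_of_enum {P : Type*} [DecidableEq P] {s : Finset P} {h : ℕ} (hh : 0 < h)
    (w : Fin (2 * h + 1) ≃ s) (J : Finset ℕ) (hJ : ∀ i ∈ J, i < 2 * h) (K : Finset P) (hK : K ⊆ s)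
    (hodd : ∀ i ∈ J, i % 2 = 1 → (w ⟨0, by omega⟩ : P) ∈ K)
    (heven : ∀ i ∈ J, i % 2 = 0 → (w ⟨2 * h, by omega⟩ : P) ∈ K) :
    ∃ p : LinePattern s, p.kill = K ∧ (∀ x, x ∈ p.served ↔ ∃ i, i.1 ∈ J ∧ (w i : P) = x) ∧
      (∀ i : ℕ, ∀ hi : i < 2 * h, p.next (w ⟨i, by omega⟩) = w ⟨i + 1, by omega⟩) ∧
      ∀ i : ℕ, ∀ hi : i < 2 * h, p.mid (w ⟨i, by omega⟩) (w ⟨i + 1, by omega⟩) =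
        if i % 2 = 0 then (w ⟨2 * h, by omega⟩ : P) else w ⟨0, by omega⟩ := by
  obtain ⟨M, hM⟩ := exists_midpointOn_of_enum hh w
  let nx : P → P := fun x => if hx : x ∈ s then
    (if hi : (w.symm ⟨x, hx⟩ : ℕ) + 1 < 2 * h + 1 then (w ⟨w.symm ⟨x, hx⟩ + 1, hi⟩ : P) else x)
    else x
  have hnx : ∀ i : ℕ, ∀ hi : i < 2 * h, nx (w ⟨i, by omega⟩) = w ⟨i + 1, by omega⟩ := by
    intro i hi
    simp only [nx]
    rw [dif_pos (Finset.coe_mem _)]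
    simp only [Subtype.coe_eta, Equiv.symm_apply_apply]
    rw [dif_pos (by omega)]
  let sv : Finset P := s.filter fun x => ∃ i, i.1 ∈ J ∧ (w i : P) = x
  have hsv : ∀ x, x ∈ sv ↔ ∃ i, i.1 ∈ J ∧ (w i : P) = x := by
    intro x
    simp only [sv, Finset.mem_filter, and_iff_right_iff_imp]
    rintro ⟨i, -, rfl⟩
    exact Subtype.coe_prop _
  have hinj : ∀ i j : Fin (2 * h + 1), (w i : P) = w j → i.1 = j.1 := fun i j hij => by
    rw [w.injective (Subtype.ext hij)]
  refine ⟨{ toMidpointOn := M, kill := K, served := sv, next := nx, kill_subset := hK,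
            served_subset := Finset.filter_subset _ _, next_mem := ?_, next_ne := ?_,
            mid_next := ?_, next_next := ?_ }, rfl, hsv, hnx, hM⟩
  · intro u hu
    obtain ⟨⟨i, hi⟩, hiJ, rfl⟩ := (hsv u).1 hu
    rw [hnx i (hJ i hiJ)]
    exact Subtype.coe_prop _
  · intro u hu
    obtain ⟨⟨i, hi⟩, hiJ, rfl⟩ := (hsv u).1 hu
    rw [hnx i (hJ i hiJ)]
    intro h'
    have := hinj _ _ h'
    simp at this
  · intro u hu
    obtain ⟨⟨i, hi⟩, hiJ, rfl⟩ := (hsv u).1 hu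
    rw [hnx i (hJ i hiJ), hM i (hJ i hiJ)]
    split_ifs with hpar
    · exact heven i hiJ hpar
    · exact hodd i hiJ (by omega)
  · intro u hu hu'
    obtain ⟨⟨i, hi⟩, hiJ, rfl⟩ := (hsv u).1 hu
    rw [hnx i (hJ i hiJ)] at hu' ⊢
    obtain ⟨⟨j, hj⟩, hjJ, hij⟩ := (hsv _).1 hu'
    have := hinj _ _ hij
    simp only at this
    subst this
    rw [hnx _ (hJ _ hjJ)]
    intro h'
    have := hinj _ _ h'
    simp only at this
    omega

theorem exists_enum_extending {P : Type*} [DecidableEq P] {s : Finset P} {h : ℕ}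
    (hs : s.card = 2 * h + 1) (D : Finset (Fin (2 * h + 1))) (f : Fin (2 * h + 1) → P)
    (hf : ∀ i ∈ D, f i ∈ s) (hinj : Set.InjOn f D) :
    ∃ w : Fin (2 * h + 1) ≃ s, ∀ i ∈ D, (w i : P) = f i := by
  refine Finset.exists_equiv_extend_of_card_eq (by simp [hs]) ?_ hinj
  intro x hx
  obtain ⟨i, hi, rfl⟩ := Finset.mem_image.1 hx
  exact hf i hi

section patterns

variable {P : Type*} [DecidableEq P] {s : Finset P} {h : ℕ}

theorem exists_pattern_trivial (hh : 0 < h) (hs : s.card = 2 * h + 1) :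
    ∃ p : LinePattern s, p.kill = ∅ ∧ p.served = ∅ := by
  obtain ⟨w⟩ : Nonempty (Fin (2 * h + 1) ≃ s) := ⟨(Finset.equivFinOfCardEq hs).symm⟩
  obtain ⟨p, h1, h2, -⟩ := exists_linePattern_of_enum hh w ∅ (by simp) ∅ (by simp) (by simp)
    (by simp)
  refine ⟨p, h1, ?_⟩
  ext x
  simp [h2]

/-- The near-1-factor missing c has h edges, and each can help one of its ends. With c at position 0
and T enlarged to fill the odd positions, different points of T lie on different edges. -/
theorem exists_pattern_single (hh : 0 < h) (hs : s.card = 2 * h + 1) {c : P} (hc : c ∈ s)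
    {T : Finset P} (hT : T ⊆ s) (hcT : c ∉ T) (hTh : T.card ≤ h) :
    ∃ p : LinePattern s, p.kill = {c} ∧ T ⊆ p.served := by
  obtain ⟨T', hTT', hT's, hT'c⟩ := Finset.exists_subsuperset_card_eq
    (s := T) (t := s.erase c) (n := h) (fun x hx => Finset.mem_erase.2
      ⟨fun hxc => hcT (hxc ▸ hx), hT hx⟩) hTh (by rw [Finset.card_erase_of_mem hc, hs]; omega)
  let τ := (Finset.equivFinOfCardEq hT'c).symm
  have hτ : ∀ k, (τ k : P) ≠ c ∧ (τ k : P) ∈ s := fun k => Finset.mem_erase.1 (hT's (τ k).2)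
  let f : Fin (2 * h + 1) → P := fun i =>
    if hi : i.1 % 2 = 1 then τ ⟨i.1 / 2, by omega⟩ else c
  obtain ⟨w, hw⟩ := exists_enum_extending hs (Finset.univ.filter fun i => i.1 = 0 ∨ i.1 % 2 = 1) f
    (by
      intro i _
      simp only [f]
      split_ifs
      · exact (hτ _).2
      · exact hc)
    (by
      intro i hi j hj hij
      simp only [Finset.coe_filter, Finset.mem_univ, true_and, Set.mem_ofPred_eq] at hi hj
      simp only [f] at hij
      split_ifs at hij with h1 h2 h2
      · have := τ.injective (Subtype.ext hij)
        simp only [Fin.mk.injEq] at this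
        exact Fin.ext (by omega)
      · exact absurd hij (hτ _).1
      · exact absurd hij.symm (hτ _).1
      · exact Fin.ext (by omega))
  have hw0 : (w ⟨0, by omega⟩ : P) = c := by
    rw [hw _ (by simp)]
    simp [f]
  obtain ⟨p, h1, h2, -⟩ := exists_linePattern_of_enum hh w
    ((Finset.range (2 * h)).filter fun i => i % 2 = 1) (by simp +contextual) {c} (by simpa using hc)
    (fun i _ _ => by rw [hw0]; simp) (by simp +contextual)
  refine ⟨p, h1, fun x hx => ?_⟩
  rw [h2]
  obtain ⟨⟨k, hk⟩, hk'⟩ := τ.surjective ⟨x, hTT' hx⟩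
  refine ⟨⟨2 * k + 1, by omega⟩, by simp; omega, ?_⟩
  have h3 : (2 * k + 1) / 2 = k := by omega
  rw [hw _ (by simp)]
  have : f ⟨2 * k + 1, by omega⟩ = τ ⟨k, hk⟩ := by
    simp only [f]
    rw [dif_pos (by omega)]
    simp only [h3]
  rw [this, hk']

/-- The two killed near-1-factors form a Hamiltonian path from c to d; directed towards d it serves
every point but d. So c is helped twice, and d once, by being killed. -/
theorem exists_pattern_double (hh : 0 < h) (hs : s.card = 2 * h + 1) {c d : P} (hc : c ∈ s)
    (hd : d ∈ s) (hcd : c ≠ d) :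
    ∃ p : LinePattern s, p.kill = {c, d} ∧ p.served = s.erase d := by
  obtain ⟨w, hw⟩ := exists_enum_extending hs
    {(⟨0, by omega⟩ : Fin (2 * h + 1)), (⟨2 * h, by omega⟩ : Fin (2 * h + 1))}
    (fun i => if i.1 = 0 then c else d)
    (by intro i _; split_ifs <;> assumption)
    (by
      intro i hi j hj hij
      simp only [Finset.coe_insert, Finset.coe_singleton, Set.mem_insert_iff,
        Set.mem_singleton_iff, Fin.ext_iff] at hi hj
      apply Fin.ext
      beta_reduce at hij
      split_ifs at hij
      · omega
      · exact absurd hij hcd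
      · exact absurd hij.symm hcd
      · omega)
  have hw0 : (w ⟨0, by omega⟩ : P) = c := by
    rw [hw _ (by simp)]
    simp
  have hw1 : (w ⟨2 * h, by omega⟩ : P) = d := by
    rw [hw _ (by simp)]
    simp; omega
  obtain ⟨p, h1, h2, -⟩ := exists_linePattern_of_enum hh w (Finset.range (2 * h)) (by simp) {c, d}
    (by intro x; simp; rintro (rfl | rfl) <;> assumption) (fun i _ _ => by rw [hw0]; simp)
    (fun i _ _ => by rw [hw1]; simp)
  refine ⟨p, h1, ?_⟩
  ext x
  rw [h2, Finset.mem_erase]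
  constructor
  · rintro ⟨i, hi, rfl⟩
    refine ⟨fun h' => ?_, Subtype.coe_prop _⟩
    rw [← hw1] at h'
    have := w.injective (Subtype.ext h')
    rw [this] at hi
    simp at hi
  · rintro ⟨hxd, hxs⟩
    refine ⟨w.symm ⟨x, hxs⟩, ?_, by simp⟩
    rw [Finset.mem_range]
    by_contra hlt
    have h3 : w.symm ⟨x, hxs⟩ = ⟨2 * h, by omega⟩ := Fin.ext (by
      have := (w.symm ⟨x, hxs⟩).2
      simp only
      omega)
    rw [← h3, Equiv.apply_symm_apply] at hw1
    exact hxd hw1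

/-- The path from c to d again, starting with the step from c to c', which is left unallotted: when
c and c' are both reserved, this edge is to go to an additional class. Since c is killed, it needs
no service. -/
theorem exists_pattern_reserved (hh : 0 < h) (hs : s.card = 2 * h + 1) {c c' d : P} (hc : c ∈ s)
    (hc' : c' ∈ s) (hd : d ∈ s) (hcc' : c ≠ c') (hcd : c ≠ d) (hc'd : c' ≠ d) :
    ∃ p : LinePattern s, p.kill = {c, d} ∧ p.served = (s.erase c).erase d ∧ p.mid c c' ∈ p.kill ∧
      ∀ u ∈ p.served, ¬ (u = c' ∧ p.next u = c) := by
  obtain ⟨w, hw⟩ := exists_enum_extending hs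
    {(⟨0, by omega⟩ : Fin (2 * h + 1)), (⟨1, by omega⟩ : Fin (2 * h + 1)),
      (⟨2 * h, by omega⟩ : Fin (2 * h + 1))}
    (fun i => if i.1 = 0 then c else if i.1 = 1 then c' else d)
    (by intro i _; split_ifs <;> assumption)
    (by
      intro i hi j hj hij
      simp only [Finset.coe_insert, Finset.coe_singleton, Set.mem_insert_iff,
        Set.mem_singleton_iff, Fin.ext_iff] at hi hj
      apply Fin.ext
      beta_reduce at hij
      split_ifs at hij <;> first | omega | (exfalso; tauto))
  have hw0 : (w ⟨0, by omega⟩ : P) = c := by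
    rw [hw _ (by simp)]
    simp
  have hw1 : (w ⟨1, by omega⟩ : P) = c' := by
    rw [hw _ (by simp)]
    simp
  have hw2 : (w ⟨2 * h, by omega⟩ : P) = d := by
    rw [hw _ (by simp)]
    rw [if_neg (show ¬ 2 * h = 0 by omega), if_neg (show ¬ 2 * h = 1 by omega)]
  have hinj : ∀ i j : Fin (2 * h + 1), (w i : P) = w j → i.1 = j.1 := fun i j hij => by
    rw [w.injective (Subtype.ext hij)]
  obtain ⟨p, h1, h2, h3, h4⟩ := exists_linePattern_of_enum hh w (Finset.Ico 1 (2 * h)) (by simp)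
    {c, d} (by intro x; simp; rintro (rfl | rfl) <;> assumption) (fun i _ _ => by rw [hw0]; simp)
    (fun i _ _ => by rw [hw2]; simp)
  refine ⟨p, h1, ?_, ?_, ?_⟩
  · ext x
    rw [h2, Finset.mem_erase, Finset.mem_erase]
    constructor
    · rintro ⟨i, hi, rfl⟩
      rw [Finset.mem_Ico] at hi
      refine ⟨fun h' => ?_, fun h' => ?_, Subtype.coe_prop _⟩
      · rw [← hw2] at h'
        have := hinj _ _ h'
        simp at this
        omega
      · rw [← hw0] at h'
        have := hinj _ _ h'
        simp only at this
        omega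
    · rintro ⟨hxd, hxc, hxs⟩
      refine ⟨w.symm ⟨x, hxs⟩, ?_, by simp⟩
      rw [Finset.mem_Ico]
      have hlt := (w.symm ⟨x, hxs⟩).2
      constructor
      · by_contra h'
        have h3 : w.symm ⟨x, hxs⟩ = ⟨0, by omega⟩ := Fin.ext (by simp only; omega)
        rw [← h3, Equiv.apply_symm_apply] at hw0
        exact hxc hw0
      · by_contra h'
        have h3 : w.symm ⟨x, hxs⟩ = ⟨2 * h, by omega⟩ := Fin.ext (by simp only; omega)
        rw [← h3, Equiv.apply_symm_apply] at hw2
        exact hxd hw2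
  · have := h4 0 (by omega)
    simp only [Nat.zero_mod, if_true, hw0, hw2, zero_add, hw1] at this
    rw [this, h1]
    simp
  · rintro u hu ⟨rfl, hnext⟩
    have h5 : (1 : ℕ) < 2 * h := by omega
    have := h3 1 h5
    rw [hw1, hnext, ← hw0] at this
    have := hinj _ _ this
    simp at this

/-- The set S occupies positions 0 to a of the path, and only the steps from position a on are
allotted, so no allotted pair lies inside S. An inner point of this stretch has two path neighbours
in S, hence a - 2 pairs in S taken from surviving classes, and its own flag makes a - 1. Position 0
has one such neighbour but is killed; position a has one but is served. -/
theorem exists_pattern_base (hh : 0 < h) (hs : s.card = 2 * h + 1) {S : Finset P} (hS : S ⊆ s)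
    {a : ℕ} (ha : 1 ≤ a) (hSa : S.card = a + 1) (hah : a < 2 * h) :
    ∃ p : LinePattern s, p.kill.card = 2 ∧
      (∀ u ∈ S, (S.filter fun y => y ≠ u ∧ p.mid u y ∉ p.kill).card +
        (if u ∈ p.kill then 0 else 1) ≤ a - 1 + if u ∈ p.served then 1 else 0) ∧
      (∀ v ∈ s, v ∉ S → v ∈ p.kill ∨ v ∈ p.served) ∧
      ∀ u ∈ p.served, ¬ (u ∈ S ∧ p.next u ∈ S) := by
  let τ := (Finset.equivFinOfCardEq hSa).symm
  obtain ⟨w, hw⟩ := exists_enum_extending hs (Finset.univ.filter fun i => i.1 < a + 1)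
    (fun i => if hi : i.1 < a + 1 then (τ ⟨i.1, hi⟩ : P) else τ ⟨0, by omega⟩)
    (by intro i _; split_ifs <;> exact hS (Subtype.coe_prop _))
    (by
      intro i hi j hj hij
      simp only [Finset.coe_filter, Finset.mem_univ, true_and, Set.mem_ofPred_eq] at hi hj
      beta_reduce at hij
      rw [dif_pos hi, dif_pos hj] at hij
      have := τ.injective (Subtype.ext hij)
      simpa [Fin.ext_iff] using this)
  have hinj : ∀ i j : Fin (2 * h + 1), (w i : P) = w j → i.1 = j.1 := fun i j hij => by
    rw [w.injective (Subtype.ext hij)]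
  have hwS : ∀ i : Fin (2 * h + 1), (w i : P) ∈ S ↔ i.1 < a + 1 := by
    intro i
    constructor
    · intro hi
      obtain ⟨k, hk⟩ := τ.surjective ⟨_, hi⟩
      have := hw ⟨k.1, by omega⟩ (by simp; omega)
      simp only at this
      rw [dif_pos k.2, hk] at this
      have := hinj _ _ this
      simp only at this
      omega
    · intro hi
      rw [hw i (by simpa using hi)]
      rw [dif_pos hi]
      exact Subtype.coe_prop _
  have hne : (w ⟨0, by omega⟩ : P) ≠ w ⟨2 * h, by omega⟩ := fun h' => by
    have := hinj _ _ h'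
    simp at this
    omega
  obtain ⟨p, h1, h2, h3, h4⟩ := exists_linePattern_of_enum hh w (Finset.Ico a (2 * h)) (by simp)
    {(w ⟨0, by omega⟩ : P), (w ⟨2 * h, by omega⟩ : P)}
    (by intro x; simp only [Finset.mem_insert, Finset.mem_singleton]
        rintro (rfl | rfl) <;> exact Subtype.coe_prop _) (by simp) (by simp)
  have hk0 : (w ⟨0, by omega⟩ : P) ∈ p.kill := by rw [h1]; simp
  have hk1 : (w ⟨2 * h, by omega⟩ : P) ∈ p.kill := by rw [h1]; simp
  have hstep : ∀ i : ℕ, ∀ hi : i < 2 * h,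
      p.mid (w ⟨i, by omega⟩) (w ⟨i + 1, by omega⟩) ∈ p.kill := by
    intro i hi
    rw [h4 i hi]
    split_ifs
    · exact hk1
    · exact hk0
  have hcount : ∀ (u : P) (B : Finset P), B ⊆ S → (∀ y ∈ B, y = u ∨ p.mid u y ∈ p.kill) →
      (S.filter fun y => y ≠ u ∧ p.mid u y ∉ p.kill).card + B.card ≤ a + 1 := by
    intro u B hB hBu
    rw [← hSa, ← Finset.card_union_of_disjoint]
    · exact Finset.card_le_card (Finset.union_subset (Finset.filter_subset _ _) hB)
    · rw [Finset.disjoint_right]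
      intro y hy hy'
      obtain ⟨-, h5, h6⟩ := Finset.mem_filter.1 hy'
      exact (hBu y hy).elim h5 h6
  refine ⟨p, ?_, ?_, ?_, ?_⟩
  · rw [h1, Finset.card_pair hne]
  · intro u hu
    obtain ⟨⟨i, hi⟩, hiw⟩ := w.surjective ⟨u, hS hu⟩
    obtain rfl : (w ⟨i, hi⟩ : P) = u := by rw [hiw]
    have hia := (hwS ⟨i, hi⟩).1 hu
    simp only at hia
    have hback : ∀ hi0 : 0 < i, p.mid (w ⟨i, hi⟩) (w ⟨i - 1, by omega⟩) ∈ p.kill := by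
      intro hi0
      rw [p.mid_comm (Subtype.coe_prop _) (Subtype.coe_prop _)]
      have := hstep (i - 1) (by omega)
      have h7 : (⟨i - 1 + 1, by omega⟩ : Fin (2 * h + 1)) = ⟨i, hi⟩ := Fin.ext (by simp; omega)
      rwa [h7] at this
    have hfar : ∀ j k : Fin (2 * h + 1), j.1 ≠ k.1 → (w j : P) ≠ w k := fun j k hjk h' =>
      hjk (hinj _ _ h')
    rcases Nat.eq_zero_or_pos i with rfl | hpos
    · rw [if_pos hk0]
      have := hcount (w ⟨0, hi⟩) {(w ⟨0, hi⟩ : P), (w ⟨1, by omega⟩ : P)}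
        (by
          intro x hx
          simp only [Finset.mem_insert, Finset.mem_singleton] at hx
          rcases hx with rfl | rfl
          · exact hu
          · rw [hwS]; simp; omega)
        (by
          intro y hy
          simp only [Finset.mem_insert, Finset.mem_singleton] at hy
          rcases hy with rfl | rfl
          · exact Or.inl rfl
          · exact Or.inr (hstep 0 (by omega)))
      rw [Finset.card_pair (hfar _ _ (by simp))] at this
      omega
    · rcases Nat.lt_or_ge i a with hlt | hge
      · have := hcount (w ⟨i, hi⟩)
          {(w ⟨i, hi⟩ : P), (w ⟨i + 1, by omega⟩ : P), (w ⟨i - 1, by omega⟩ : P)}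
          (by
            intro x hx
            simp only [Finset.mem_insert, Finset.mem_singleton] at hx
            rcases hx with rfl | rfl | rfl
            · exact hu
            · rw [hwS]; simp; omega
            · rw [hwS]; simp; omega)
          (by
            intro y hy
            simp only [Finset.mem_insert, Finset.mem_singleton] at hy
            rcases hy with rfl | rfl | rfl
            · exact Or.inl rfl
            · exact Or.inr (hstep i (by omega))
            · exact Or.inr (hback hpos))
        have hc3 : ({(w ⟨i, hi⟩ : P), (w ⟨i + 1, by omega⟩ : P), (w ⟨i - 1, by omega⟩ : P)} :
            Finset P).card = 3 := by
          rw [Finset.card_eq_three]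
          exact ⟨_, _, _, hfar _ _ (by simp), hfar _ _ (by simp; omega), hfar _ _ (by simp; omega),
            rfl⟩
        rw [hc3] at this
        split_ifs <;> omega
      · have hsv : (w ⟨i, hi⟩ : P) ∈ p.served := by
          rw [h2]
          exact ⟨_, by simp; omega, rfl⟩
        rw [if_pos hsv]
        have := hcount (w ⟨i, hi⟩) {(w ⟨i, hi⟩ : P), (w ⟨i - 1, by omega⟩ : P)}
          (by
            intro x hx
            simp only [Finset.mem_insert, Finset.mem_singleton] at hx
            rcases hx with rfl | rfl
            · exact hu
            · rw [hwS]; simp; omega)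
          (by
            intro y hy
            simp only [Finset.mem_insert, Finset.mem_singleton] at hy
            rcases hy with rfl | rfl
            · exact Or.inl rfl
            · exact Or.inr (hback hpos))
        rw [Finset.card_pair (hfar _ _ (by simp; omega))] at this
        split_ifs <;> omega
  · intro v hv hvS
    obtain ⟨⟨i, hi⟩, hiw⟩ := w.surjective ⟨v, hv⟩
    obtain rfl : (w ⟨i, hi⟩ : P) = v := by rw [hiw]
    rw [hwS] at hvS
    simp only at hvS
    rcases Nat.lt_or_ge i (2 * h) with hlt | hge
    · right
      rw [h2]
      exact ⟨_, by simp; omega, rfl⟩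
    · left
      obtain rfl : i = 2 * h := by omega
      exact hk1
  · rintro u hu ⟨-, hu'⟩
    obtain ⟨⟨i, hi⟩, hiJ, rfl⟩ := (h2 u).1 hu
    simp only [Finset.mem_Ico] at hiJ
    rw [h3 i (by omega), hwS] at hu'
    simp at hu'
    omega

end patterns

/-! ### Incidence, and assembling the colouring -/

/-- A set of demands `A` can be served injectively from `E ∪ I` so that the demands in `A₀` are
served from `E`. -/
theorem exists_injOn_union {α β : Type*} [DecidableEq α] [DecidableEq β] [Nonempty β]
    {A A₀ : Finset α} {E I : Finset β} (hA : A₀ ⊆ A) (hEI : Disjoint E I)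
    (h0 : A₀.card ≤ E.card) (h1 : A.card ≤ E.card + I.card) :
    ∃ f : α → β, Set.InjOn f A ∧ (∀ a ∈ A, f a ∈ E ∪ I) ∧ ∀ a ∈ A₀, f a ∈ E := by
  -- `A₁`, the part to be served from E, contains `A₀` and uses as much of E as possible, so that
  -- the rest fits into I.
  obtain ⟨A₁, h01, h1A, hc⟩ := Finset.exists_subsuperset_card_eq hA
    (n := min A.card E.card) (le_min (Finset.card_le_card hA) h0) (min_le_left _ _)
  have key : ∀ (B : Finset α) (C : Finset β), B.card ≤ C.card →
      ∃ f : α → β, (∀ b ∈ B, f b ∈ C) ∧ Set.InjOn f B := by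
    intro B C hBC
    obtain ⟨f, hf, hf'⟩ := B.finite_toSet.exists_injOn_of_encard_le (t := (C : Set β))
      (by rw [Set.encard_coe_eq_coe_finsetCard, Set.encard_coe_eq_coe_finsetCard]
          exact_mod_cast hBC)
    exact ⟨f, fun b hb => by simpa using hf (Finset.mem_coe.2 hb), hf'⟩
  obtain ⟨f, hf, hfi⟩ := key A₁ E (by omega)
  obtain ⟨g, hg, hgi⟩ := key (A \ A₁) I (by
    rw [Finset.card_sdiff_of_subset h1A]
    omega)
  have hmem : ∀ a ∈ A, (if a ∈ A₁ then f a else g a) ∈ E ∪ I := by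
    intro a ha
    split_ifs with h
    · exact Finset.mem_union_left _ (hf a h)
    · exact Finset.mem_union_right _ (hg a (Finset.mem_sdiff.2 ⟨ha, h⟩))
  refine ⟨fun a => if a ∈ A₁ then f a else g a, ?_, hmem, ?_⟩
  · intro a ha b hb hab
    simp only [Finset.mem_coe] at ha hb
    beta_reduce at hab
    split_ifs at hab with h h' h'
    · exact hfi h h' hab
    · exact absurd hab (Finset.disjoint_left.1 hEI (hf a h) |> fun hn he =>
        hn (he ▸ hg b (Finset.mem_sdiff.2 ⟨hb, h'⟩)))
    · exact absurd hab (Finset.disjoint_left.1 hEI (hf b h') |> fun hn he =>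
        hn (he ▸ hg a (Finset.mem_sdiff.2 ⟨ha, h⟩)))
    · exact hgi (Finset.mem_coe.2 (Finset.mem_sdiff.2 ⟨ha, h⟩))
        (Finset.mem_coe.2 (Finset.mem_sdiff.2 ⟨hb, h'⟩)) hab
  · intro a ha
    beta_reduce
    rw [if_pos (h01 ha)]
    exact hf a (h01 ha)

open scoped Classical in
/-- The points on a line. -/
noncomputable def linePts {P L : Type*} [Membership P L] [Fintype P] (l : L) : Finset P :=
  Finset.univ.filter (· ∈ l)

open scoped Classical in
/-- The lines through a point. -/
noncomputable def pencil {P : Type*} (L : Type*) [Membership P L] [Fintype L] (p : P) : Finset L :=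
  Finset.univ.filter (p ∈ ·)

@[simp] theorem mem_linePts {P L : Type*} [Membership P L] [Fintype P] {p : P} {l : L} :
    p ∈ linePts l ↔ p ∈ l := by simp [linePts]

@[simp] theorem mem_pencil {P L : Type*} [Membership P L] [Fintype L] {p : P} {l : L} :
    l ∈ pencil L p ↔ p ∈ l := by simp [pencil]

section incidence

open Configuration

variable {P L : Type*} [Membership P L] [ProjectivePlane P L]

theorem line_unique {x y : P} {l l' : L} (hxy : x ≠ y) (hx : x ∈ l) (hy : y ∈ l) (hx' : x ∈ l')
    (hy' : y ∈ l') : l = l' :=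
  (Nondegenerate.eq_or_eq hx hy hx' hy').resolve_left hxy

theorem point_unique {x y : P} {l l' : L} (hll : l ≠ l') (hx : x ∈ l) (hy : y ∈ l) (hx' : x ∈ l')
    (hy' : y ∈ l') : x = y :=
  (Nondegenerate.eq_or_eq hx hy hx' hy').resolve_right hll

theorem exists_common_point (l l' : L) : ∃ p : P, p ∈ l ∧ p ∈ l' := by
  by_cases h : l = l'
  · subst h
    obtain ⟨-, p₂, -, -, l₂, -, -, -, -, h22, -⟩ := ProjectivePlane.exists_config (P := P) (L := L)
    by_cases h : l = l₂
    · exact ⟨p₂, h ▸ h22, h ▸ h22⟩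
    · exact ⟨_, (HasPoints.mkPoint_ax (P := P) h).1, (HasPoints.mkPoint_ax (P := P) h).1⟩
  · exact ⟨_, HasPoints.mkPoint_ax (P := P) h⟩

theorem exists_joining_line (x y : P) : ∃ l : L, x ∈ l ∧ y ∈ l :=
  exists_common_point (P := Dual L) (L := Dual P) x y

variable [Fintype P] [Fintype L]

theorem card_linePts (l : L) : (linePts l : Finset P).card = ProjectivePlane.order P L + 1 := by
  classical
  rw [← ProjectivePlane.pointCount_eq P l, pointCount, Nat.card_eq_fintype_card,
    Fintype.card_subtype]
  simp [linePts]

theorem card_pencil (p : P) : (pencil L p).card = ProjectivePlane.order P L + 1 := by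
  classical
  rw [← ProjectivePlane.lineCount_eq L p, lineCount, Nat.card_eq_fintype_card,
    Fintype.card_subtype]
  simp [pencil]

end incidence

section assembly

open Configuration

/-- A family of line patterns whose unmatched points can all be served, together with classes of
edges inside `S ∪ X`, gives a complete colouring of the edges of the complete graph on the points
of the plane and `X`. -/
theorem le_psi_of_patterns {P L X N : Type*} [Membership P L] [ProjectivePlane P L] [Fintype P]
    [Fintype L] [DecidableEq P] [DecidableEq L] [Fintype X] [DecidableEq X] [Nonempty X] [Fintype N]
    (pat : ∀ l : L, LinePattern (linePts l : Finset P)) (S : Finset P) (weak : Finset L)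
    (hSweak : ∀ s ∈ S, ∀ l : L, s ∈ l → l ∈ weak)
    (hweak : Nonempty N → ∀ l ∈ weak, ∃ s ∈ S, s ∈ l)
    (hnext : ∀ l, ∀ u ∈ (pat l).served, ¬ (u ∈ S ∧ (pat l).next u ∈ S))
    (hstrong : ∀ u ∉ S, ((pencil L u).filter fun l => l ∉ weak ∧ u ∉ (pat l).kill).card
      ≤ Fintype.card X)
    (hfree : ∀ u ∉ S, ProjectivePlane.order P L + 1 ≤ Fintype.card X + ∑ l ∈ pencil L u,
      ((if u ∈ (pat l).kill then 1 else 0) + if u ∈ (pat l).served then 1 else 0))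
    (hres : ∀ u ∈ S, ((pencil L u).filter fun l => u ∉ (pat l).kill).card +
      (S.filter fun y => y ≠ u ∧ ∃ l ∈ pencil L u, y ∈ (linePts l : Finset P) ∧
        (pat l).mid u y ∉ (pat l).kill).card ≤ ((pencil L u).filter fun l => u ∈ (pat l).served).card)
    (ncls : N → Set (Sym2 (P ⊕ X))) (hdiag : ∀ i, ∀ e ∈ ncls i, ¬ e.IsDiag)
    (hinside : ∀ i, ∀ e ∈ ncls i, ∀ p, Sum.inl p ∈ e → p ∈ S)
    (hdisj : ∀ i j e, e ∈ ncls i → e ∈ ncls j → i = j)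
    (hcoverS : ∀ i, ∀ s ∈ S, ∃ e ∈ ncls i, Sum.inl s ∈ e)
    (hcoverX : ∀ i, ∀ x, ∃ e ∈ ncls i, Sum.inr x ∈ e)
    {m : ℕ} (hm : Fintype.card P + Fintype.card X = m) :
    ∑ l, (ProjectivePlane.order P L + 1 - (pat l).kill.card) + Fintype.card N ≤ psi m := by
  classical
  -- the flags `(l, c)` whose class has to be completed at the point `u`
  let Δ : P → Finset (L × P) := fun u => Finset.univ.filter fun d =>
    u ∈ d.1 ∧ d.2 ∈ d.1 ∧ d.2 ∉ (pat d.1).kill ∧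
      (d.2 = u ∨ u ∈ S ∧ ∃ y ∈ S, y ∈ d.1 ∧ y ≠ u ∧ (pat d.1).mid u y = d.2)
  have hΔ : ∀ u (d : L × P), d ∈ Δ u ↔ u ∈ d.1 ∧ d.2 ∈ d.1 ∧ d.2 ∉ (pat d.1).kill ∧
      (d.2 = u ∨ u ∈ S ∧ ∃ y ∈ S, y ∈ d.1 ∧ y ≠ u ∧ (pat d.1).mid u y = d.2) := by
    intro u d; simp [Δ]
  -- Distinct flags to be completed at u receive distinct edges: a released pair, recorded by the
  -- line serving u, or, for u outside S, an edge to X. Flags on lines outside `weak` must get an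
  -- edge to X.
  have hasg : ∀ u, ∃ f : L × P → L ⊕ X, Set.InjOn f (Δ u) ∧
      (∀ d ∈ Δ u, (∃ l, f d = Sum.inl l ∧ u ∈ l ∧ u ∈ (pat l).served) ∨
        ∃ x, f d = Sum.inr x ∧ u ∉ S) ∧
      ∀ d ∈ Δ u, d.1 ∉ weak → ∃ x, f d = Sum.inr x := by
    intro u
    let I : Finset (L ⊕ X) := ((pencil L u).filter fun l => u ∈ (pat l).served).image Sum.inl
    have hIc : I.card = ((pencil L u).filter fun l => u ∈ (pat l).served).card :=
      Finset.card_image_of_injective _ Sum.inl_injective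
    have hImem : ∀ z ∈ I, ∃ l, z = Sum.inl l ∧ u ∈ l ∧ u ∈ (pat l).served := by
      intro z hz
      obtain ⟨l, hl, rfl⟩ := Finset.mem_image.1 hz
      rw [Finset.mem_filter, mem_pencil] at hl
      exact ⟨l, rfl, hl⟩
    have : Nonempty (L ⊕ X) := ⟨Sum.inr (Classical.arbitrary X)⟩
    by_cases hu : u ∈ S
    · obtain ⟨f, hf1, hf2, -⟩ := exists_injOn_union (A := Δ u) (A₀ := ∅) (E := ∅) (I := I)
        (by simp) (by simp) (by simp) (by
          rw [Finset.card_empty, zero_add, hIc]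
          refine le_trans ?_ (hres u hu)
          -- At a reserved point the demands are its own surviving flags and one flag for each
          -- reserved y whose pair with u is withheld; y determines the line and the midpoint.
          have hsub : Δ u ⊆ (((pencil L u).filter fun l => u ∉ (pat l).kill).image
              fun l => (l, u)) ∪ ((S.filter fun y => y ≠ u ∧ ∃ l ∈ pencil L u,
                y ∈ (linePts l : Finset P) ∧ (pat l).mid u y ∉ (pat l).kill).image fun y =>
              ((exists_joining_line (L := L) u y).choose,
                (pat (exists_joining_line (L := L) u y).choose).mid u y)) := by
            rintro ⟨l, c⟩ hd
            obtain ⟨h1, h2, h3, h4 | ⟨-, y, hyS, hyl, hyu, hyc⟩⟩ := (hΔ _ _).1 hd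
            · simp only at h1 h2 h3 h4
              subst h4
              refine Finset.mem_union_left _ (Finset.mem_image.2 ⟨l, ?_, rfl⟩)
              simp [h1, h3]
            · simp only at h1 h2 h3 hyl hyc
              have hj := (exists_joining_line (L := L) u y).choose_spec
              have hl : (exists_joining_line (L := L) u y).choose = l :=
                line_unique hyu.symm hj.1 hj.2 h1 hyl
              refine Finset.mem_union_right _ (Finset.mem_image.2 ⟨y, ?_, ?_⟩)
              · rw [Finset.mem_filter]
                exact ⟨hyS, hyu, l, mem_pencil.2 h1, mem_linePts.2 hyl, by rwa [hyc]⟩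
              · rw [hl, hyc]
          exact (Finset.card_le_card hsub).trans ((Finset.card_union_le _ _).trans
            (add_le_add Finset.card_image_le Finset.card_image_le)))
      refine ⟨f, hf1, fun d hd => Or.inl (hImem _ (by simpa using hf2 d hd)), fun d hd hdw => ?_⟩
      exact absurd (hSweak u hu d.1 ((hΔ _ _).1 hd).1) hdw
    · have hΔu : ∀ d ∈ Δ u, d.2 = u := fun d hd =>
        ((hΔ _ _).1 hd).2.2.2.resolve_right fun h => hu h.1
      obtain ⟨f, hf1, hf2, hf3⟩ := exists_injOn_union (A := Δ u)
        (A₀ := (Δ u).filter fun d => d.1 ∉ weak) (E := Finset.univ.image Sum.inr) (I := I)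
        (Finset.filter_subset _ _)
        (by
          rw [Finset.disjoint_left]
          intro z hz hz'
          obtain ⟨x, -, rfl⟩ := Finset.mem_image.1 hz
          obtain ⟨l, hl, -⟩ := hImem _ hz'
          exact absurd hl (by simp))
        (by
          rw [Finset.card_image_of_injective _ Sum.inr_injective, Finset.card_univ]
          refine le_trans ?_ (hstrong u hu)
          refine Finset.card_le_card_of_injOn Prod.fst ?_ ?_
          · rintro d hd
            rw [Finset.mem_coe, Finset.mem_filter] at hd
            have h1 := (hΔ _ _).1 hd.1
            rw [Finset.mem_coe, Finset.mem_filter, mem_pencil]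
            exact ⟨h1.1, hd.2, hΔu d hd.1 ▸ h1.2.2.1⟩
          · intro d hd d' hd' hdd
            rw [Finset.mem_coe, Finset.mem_filter] at hd hd'
            exact Prod.ext hdd ((hΔu d hd.1).trans (hΔu d' hd'.1).symm))
        (by
          rw [Finset.card_image_of_injective _ Sum.inr_injective, Finset.card_univ, hIc]
          have h1 := hfree u hu
          rw [Finset.sum_add_distrib, Finset.sum_boole, Finset.sum_boole] at h1
          have h2 : (Δ u).card ≤ ((pencil L u).filter fun l => u ∉ (pat l).kill).card := by
            refine Finset.card_le_card_of_injOn Prod.fst ?_ ?_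
            · rintro d hd
              rw [Finset.mem_coe] at hd
              have h1 := (hΔ _ _).1 hd
              rw [Finset.mem_coe, Finset.mem_filter, mem_pencil]
              exact ⟨h1.1, hΔu d hd ▸ h1.2.2.1⟩
            · intro d hd d' hd' hdd
              rw [Finset.mem_coe] at hd hd'
              exact Prod.ext hdd ((hΔu d hd).trans (hΔu d' hd').symm)
          have h3 := Finset.card_filter_add_card_filter_not (s := pencil L u)
            (fun l => u ∈ (pat l).kill)
          rw [card_pencil] at h3
          simp only [Nat.cast_id] at h1
          omega)
      refine ⟨f, hf1, fun d hd => ?_, fun d hd hdw => ?_⟩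
      · rcases Finset.mem_union.1 (hf2 d hd) with h | h
        · obtain ⟨x, -, hx⟩ := Finset.mem_image.1 h
          exact Or.inr ⟨x, hx.symm, hu⟩
        · exact Or.inl (hImem _ h)
      · obtain ⟨x, -, hx⟩ := Finset.mem_image.1 (hf3 d (Finset.mem_filter.2 ⟨hd, hdw⟩))
        exact ⟨x, hx.symm⟩
  choose f hfinj hfval hfweak using hasg
  -- the edge allotted to the class `d` at `u`
  let g : P → L × P → Sym2 (P ⊕ X) := fun u d =>
    Sum.elim (fun l => s(Sum.inl u, Sum.inl ((pat l).next u))) (fun x => s(Sum.inl u, Sum.inr x))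
      (f u d)
  have hg : ∀ u, ∀ d ∈ Δ u,
      (∃ l, f u d = Sum.inl l ∧ u ∈ l ∧ u ∈ (pat l).served ∧
        g u d = s(Sum.inl u, Sum.inl ((pat l).next u))) ∨
      ∃ x, f u d = Sum.inr x ∧ u ∉ S ∧ g u d = s(Sum.inl u, Sum.inr x) := by
    intro u d hd
    rcases hfval u d hd with ⟨l, h1, h2, h3⟩ | ⟨x, h1, h2⟩
    · exact Or.inl ⟨l, h1, h2, h3, by simp [g, h1]⟩
    · exact Or.inr ⟨x, h1, h2, by simp [g, h1]⟩
  let F := Σ l : L, {c // c ∈ linePts l \ (pat l).kill}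
  -- Pairs inside S are withheld from the near-1-factors, being reserved for the additional classes.
  let base : L → P → Set (Sym2 (P ⊕ X)) := fun l c => {e | ∃ x y, x ∈ l ∧ y ∈ l ∧ x ≠ y ∧
    (pat l).mid x y = c ∧ ¬ (x ∈ S ∧ y ∈ S) ∧ e = s(Sum.inl x, Sum.inl y)}
  let cls : F ⊕ N → Set (Sym2 (P ⊕ X)) := Sum.elim
    (fun k => base k.1 k.2 ∪ {e | ∃ u, (k.1, k.2.1) ∈ Δ u ∧ e = g u (k.1, k.2.1)}) ncls
  have hk : ∀ k : F, k.2.1 ∈ k.1 ∧ k.2.1 ∉ (pat k.1).kill := fun k => by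
    have := k.2.2
    rw [Finset.mem_sdiff, mem_linePts] at this
    exact this
  -- A flag class meets every point x of its line: by an allotted edge if x is the missed point, by
  -- the pair with the right midpoint otherwise, or by an edge replacing that pair when it lies
  -- inside S.
  have hpts : ∀ k : F, ∀ x : P, x ∈ k.1 → ∃ e ∈ cls (Sum.inl k), Sum.inl x ∈ e := by
    intro k x hx
    have hgmem : ∀ d, d ∈ Δ x → Sum.inl x ∈ g x d := by
      intro d hd
      rcases hg x d hd with ⟨l, -, -, -, h⟩ | ⟨y, -, -, h⟩ <;> simp [h]
    by_cases hxc : k.2.1 = x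
    · have hd : (k.1, k.2.1) ∈ Δ x := (hΔ _ _).2 ⟨hx, (hk k).1, (hk k).2, Or.inl hxc⟩
      exact ⟨g x (k.1, k.2.1), Or.inr ⟨x, hd, rfl⟩, hgmem _ hd⟩
    · obtain ⟨y, hy, hxy⟩ := (pat k.1).exists_mid (mem_linePts.2 hx) (mem_linePts.2 (hk k).1)
      rw [mem_linePts] at hy
      have hne : y ≠ x := by
        rintro rfl
        exact hxc (by rw [← hxy, (pat k.1).mid_self (mem_linePts.2 hx)])
      by_cases hS : x ∈ S ∧ y ∈ S
      · have hd : (k.1, k.2.1) ∈ Δ x :=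
          (hΔ _ _).2 ⟨hx, (hk k).1, (hk k).2, Or.inr ⟨hS.1, y, hS.2, hy, hne, hxy⟩⟩
        exact ⟨g x (k.1, k.2.1), Or.inr ⟨x, hd, rfl⟩, hgmem _ hd⟩
      · exact ⟨s(Sum.inl x, Sum.inl y), Or.inl ⟨x, y, hx, hy, hne.symm, hxy, hS, rfl⟩, by simp⟩
  have hbase_g : ∀ l c u d, c ∉ (pat l).kill → d ∈ Δ u → g u d ∉ base l c := by
    rintro l c u d hc hd ⟨x, y, hx, hy, hxy, hmid, hS, he⟩
    rcases hg u d hd with ⟨l', -, h1, h2, h⟩ | ⟨z, -, -, h⟩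
    · rw [h] at he
      have hn := mem_linePts.1 ((pat l').next_mem h2)
      have hm := (pat l').mid_next h2
      have hne := (pat l').next_ne h2
      rw [Sym2.eq_iff] at he
      simp only [Sum.inl.injEq] at he
      rcases he with ⟨rfl, rfl⟩ | ⟨rfl, rfl⟩
      · obtain rfl := line_unique hxy hx hy h1 hn
        exact hc (hmid ▸ hm)
      · obtain rfl := line_unique hxy hx hy hn h1
        rw [(pat l).mid_comm (mem_linePts.2 hy) (mem_linePts.2 hx)] at hm
        exact hc (hmid ▸ hm)
    · rw [h, Sym2.eq_iff] at he
      simp at he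
  have hg_g : ∀ u u' d d', d ∈ Δ u → d' ∈ Δ u' → g u d = g u' d' → d = d' := by
    intro u u' d d' hd hd' he
    rcases hg u d hd with ⟨l, h0, h1, h2, h⟩ | ⟨z, h0, -, h⟩ <;>
      rcases hg u' d' hd' with ⟨l', h0', h1', h2', h'⟩ | ⟨z', h0', -, h'⟩
    · rw [h, h', Sym2.eq_iff] at he
      simp only [Sum.inl.injEq] at he
      have hn := mem_linePts.1 ((pat l).next_mem h2)
      have hne := (pat l).next_ne h2
      have hn' := mem_linePts.1 ((pat l').next_mem h2')
      rcases he with ⟨rfl, he2⟩ | ⟨he1, he2⟩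
      · obtain rfl := line_unique hne.symm h1 hn h1' (he2 ▸ hn')
        exact hfinj u hd hd' (h0.trans h0'.symm)
      · obtain rfl := line_unique hne.symm h1 hn (he1.symm ▸ hn') (he2.symm ▸ h1')
        -- A pair allotted from both of its ends would make `next` swap two served points.
        exact absurd (he1 ▸ he2) ((pat l).next_next h2' (he1 ▸ h2))
    · rw [h, h', Sym2.eq_iff] at he
      simp at he
    · rw [h, h', Sym2.eq_iff] at he
      simp at he
    · rw [h, h', Sym2.eq_iff] at he
      simp only [Sum.inl.injEq, Sum.inr.injEq, reduceCtorEq, and_self, or_false] at he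
      obtain ⟨rfl, rfl⟩ := he
      exact hfinj u hd hd' (h0.trans h0'.symm)
  have hbase_base : ∀ l c l' c' e, e ∈ base l c → e ∈ base l' c' → l = l' ∧ c = c' := by
    rintro l c l' c' e ⟨x, y, hx, hy, hxy, hmid, -, rfl⟩ ⟨x', y', hx', hy', -, hmid', -, he⟩
    rw [Sym2.eq_iff] at he
    simp only [Sum.inl.injEq] at he
    rcases he with ⟨rfl, rfl⟩ | ⟨rfl, rfl⟩
    · obtain rfl := line_unique hxy hx hy hx' hy'
      exact ⟨rfl, hmid.symm.trans hmid'⟩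
    · obtain rfl := line_unique hxy hx hy hy' hx'
      rw [(pat l).mid_comm (mem_linePts.2 hx') (mem_linePts.2 hy')] at hmid'
      exact ⟨rfl, hmid.symm.trans hmid'⟩
  have hbase_n : ∀ l c i e, e ∈ base l c → e ∉ ncls i := by
    rintro l c i e ⟨x, y, -, -, -, -, hS, rfl⟩ he
    exact hS ⟨hinside i _ he x (by simp), hinside i _ he y (by simp)⟩
  have hg_n : ∀ u d i, d ∈ Δ u → g u d ∉ ncls i := by
    intro u d i hd he
    rcases hg u d hd with ⟨l, -, h1, h2, h⟩ | ⟨z, -, h1, h⟩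
    · rw [h] at he
      exact hnext l u h2 ⟨hinside i _ he u (by simp), hinside i _ he _ (by simp)⟩
    · rw [h] at he
      exact h1 (hinside i _ he u (by simp))
  -- On a weak line the two classes meet in a reserved point; otherwise the edge completing the flag
  -- ends in X.
  have hfn : ∀ (k : F) (i : N), ∃ v, (∃ e ∈ cls (Sum.inl k), v ∈ e) ∧ ∃ e ∈ ncls i, v ∈ e := by
    intro k i
    by_cases hw : k.1 ∈ weak
    · obtain ⟨s, hsS, hsl⟩ := hweak ⟨i⟩ k.1 hw
      exact ⟨Sum.inl s, hpts k s hsl, hcoverS i s hsS⟩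
    · have hd : (k.1, k.2.1) ∈ Δ k.2.1 := (hΔ _ _).2 ⟨(hk k).1, (hk k).1, (hk k).2, Or.inl rfl⟩
      obtain ⟨x, hx⟩ := hfweak _ _ hd hw
      refine ⟨Sum.inr x, ⟨g k.2.1 (k.1, k.2.1), Or.inr ⟨_, hd, rfl⟩, ?_⟩, hcoverX i x⟩
      rcases hg _ _ hd with ⟨l', h0, -⟩ | ⟨y, h0, -, h⟩
      · rw [h0] at hx
        exact absurd hx (by simp)
      · rw [h0] at hx
        obtain rfl := Sum.inr_injective hx
        simp [h]
  have hcard : Nat.card (F ⊕ N) =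
      ∑ l, (ProjectivePlane.order P L + 1 - (pat l).kill.card) + Fintype.card N := by
    rw [Nat.card_eq_fintype_card, Fintype.card_sum, Fintype.card_sigma]
    congr 1
    refine Finset.sum_congr rfl fun l _ => ?_
    rw [Fintype.card_coe, Finset.card_sdiff_of_subset (pat l).kill_subset, card_linePts]
  rw [← hcard]
  refine card_le_psi (V := P ⊕ X) (by rw [Nat.card_eq_fintype_card, Fintype.card_sum, hm]) cls
    ?_ ?_ ?_ ?_
  · rintro (k | i) e he
    · rcases he with ⟨x, y, -, -, hxy, -, -, rfl⟩ | ⟨u, hd, rfl⟩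
      · simpa using hxy
      · rcases hg _ _ hd with ⟨l', -, -, h2, h⟩ | ⟨y, -, -, h⟩
        · rw [h]
          simpa using ((pat l').next_ne h2).symm
        · rw [h]; simp
    · exact hdiag i e he
  · rintro (k | i) (k' | j) e he he'
    · have hkey : k.1 = k'.1 ∧ k.2.1 = k'.2.1 := by
        rcases he with he | ⟨u, hd, rfl⟩ <;> rcases he' with he' | ⟨u', hd', he'⟩
        · exact hbase_base _ _ _ _ e he he'
        · exact absurd (he' ▸ he) (hbase_g _ _ _ _ (hk k).2 hd')
        · exact absurd he' (hbase_g _ _ _ _ (hk k').2 hd)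
        · exact Prod.ext_iff.1 (hg_g _ _ _ _ hd hd' he')
      obtain ⟨l, c⟩ := k
      obtain ⟨l', c'⟩ := k'
      obtain ⟨h1, h2⟩ := hkey
      simp only at h1 h2
      subst h1
      rw [Subtype.ext h2]
    · rcases he with he | ⟨u, hd, rfl⟩
      · exact absurd he' (hbase_n _ _ _ _ he)
      · exact absurd he' (hg_n _ _ _ hd)
    · rcases he' with he' | ⟨u, hd, rfl⟩
      · exact absurd he (hbase_n _ _ _ _ he')
      · exact absurd he (hg_n _ _ _ hd)
    · rw [hdisj i j e he he']
  · rintro (k | i)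
    · obtain ⟨e, he, -⟩ := hpts k k.2.1 (hk k).1
      exact ⟨e, he⟩
    · obtain ⟨e, he, -⟩ := hcoverX i (Classical.arbitrary X)
      exact ⟨e, he⟩
  · rintro (k | i) (k' | j) -
    · obtain ⟨p, hp, hp'⟩ := exists_common_point (P := P) k.1 k'.1
      exact ⟨Sum.inl p, hpts k p hp, hpts k' p hp'⟩
    · exact hfn k j
    · obtain ⟨v, h1, h2⟩ := hfn k' i
      exact ⟨v, h2, h1⟩
    · exact ⟨Sum.inr (Classical.arbitrary X), hcoverX i _, hcoverX j _⟩

end assembly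

/-! ### Additional classes on the reserved points and X -/

/-- `col` colours the pairs of elements of `Y` such that each element of `Y` meets every colour
in `K`. -/
structure SpanningColouring {V : Type*} (Y : Finset V) (K : Finset V) where
  col : V → V → V
  col_comm : ∀ {x y}, x ∈ Y → y ∈ Y → col x y = col y x
  exists_col : ∀ {x i}, x ∈ Y → i ∈ K → ∃ y ∈ Y, y ≠ x ∧ col x y = i

/-- The classical 1-factorization: one vertex v is set aside, and the near-1-factor missing i is
completed by the edge from i to v. The colours are the vertices other than v. -/
theorem exists_spanningColouring_even {V : Type*} [DecidableEq V] {Y : Finset V} {h : ℕ}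
    (hh : 0 < h) (hY : Y.card = 2 * h + 2) :
    ∃ K : Finset V, K.card = 2 * h + 1 ∧ Nonempty (SpanningColouring Y K) := by
  obtain ⟨v, hv⟩ : Y.Nonempty := Finset.card_pos.1 (by omega)
  have hc : (Y.erase v).card = 2 * h + 1 := by
    rw [Finset.card_erase_of_mem hv]
    omega
  obtain ⟨p, -⟩ := exists_pattern_trivial hh hc
  refine ⟨Y.erase v, hc, ⟨⟨fun x y => if x = v then y else if y = v then x else p.mid x y, ?_, ?_⟩⟩⟩
  · intro x y hx hy
    split_ifs with h1 h2 h2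
    · rw [h1, h2]
    · rfl
    · rfl
    · exact p.mid_comm (Finset.mem_erase.2 ⟨h1, hx⟩) (Finset.mem_erase.2 ⟨h2, hy⟩)
  · intro x i hx hi
    have hi' := Finset.mem_erase.1 hi
    by_cases hxv : x = v
    · exact ⟨i, hi'.2, hxv ▸ hi'.1, by simp [hxv]⟩
    · by_cases hxi : x = i
      · exact ⟨v, hv, Ne.symm hxv, by rw [if_neg hxv, if_pos rfl, hxi]⟩
      · have hx' := Finset.mem_erase.2 ⟨hxv, hx⟩
        obtain ⟨y, hy, hxy⟩ := p.exists_mid hx' hi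
        have hy' := Finset.mem_erase.1 hy
        refine ⟨y, hy'.2, ?_, by simp [hxv, hy'.1, hxy]⟩
        rintro rfl
        exact hxi (by rw [← hxy, p.mid_self hy])

/-- Two of the 2h + 1 near-1-factors are given up, and the path they form completes the others: each
of the other missed vertices takes the edge to its successor. -/
theorem exists_spanningColouring_odd {V : Type*} [DecidableEq V] {Y : Finset V} {h : ℕ}
    (hh : 0 < h) (hY : Y.card = 2 * h + 1) :
    ∃ K : Finset V, K.card = 2 * h - 1 ∧ Nonempty (SpanningColouring Y K) := by
  obtain ⟨c, hc, d, hd, hcd⟩ := Finset.one_lt_card.1 (show 1 < Y.card by omega)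
  obtain ⟨p, hk, hs⟩ := exists_pattern_double hh hY hc hd hcd
  have hserv : ∀ x ∈ Y, x ∉ p.kill → x ∈ p.served := by
    intro x hx hxk
    rw [hk] at hxk
    rw [hs]
    exact Finset.mem_erase.2 ⟨fun h => hxk (by simp [h]), hx⟩
  -- The fallback value c is killed, hence not a colour in question; it absorbs the leftover pairs.
  refine ⟨Y \ p.kill, ?_, ⟨⟨fun x y => if p.mid x y ∉ p.kill then p.mid x y else
    if x ∈ Y \ p.kill ∧ y = p.next x then x else if y ∈ Y \ p.kill ∧ x = p.next y then y else c,
    ?_, ?_⟩⟩⟩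
  · rw [Finset.card_sdiff_of_subset p.kill_subset, hk, Finset.card_pair hcd, hY]
    omega
  · intro x y hx hy
    rw [p.mid_comm hx hy]
    split_ifs with h1 h2 h3 h3
    · have h2' := Finset.mem_sdiff.1 h2.1
      have h3' := Finset.mem_sdiff.1 h3.1
      have hx' := hserv _ h2'.1 h2'.2
      have hy' := hserv _ h3'.1 h3'.2
      exact absurd (h2.2 ▸ h3.2).symm (p.next_next hx' (h2.2 ▸ hy'))
    all_goals rfl
  · intro x i hx hi
    have hi' := Finset.mem_sdiff.1 hi
    by_cases hxi : x = i
    · subst hxi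
      have hx' := hserv _ hi'.1 hi'.2
      refine ⟨p.next x, p.next_mem hx', p.next_ne hx', ?_⟩
      rw [if_neg (not_not.2 (p.mid_next hx')), if_pos ⟨hi, rfl⟩]
    · obtain ⟨y, hy, hxy⟩ := p.exists_mid hx hi'.1
      refine ⟨y, hy, ?_, ?_⟩
      · rintro rfl
        exact hxi (by rw [← hxy, p.mid_self hy])
      · rw [hxy, if_pos hi'.2]

section

open Configuration

variable {P L X : Type*} [Membership P L] [ProjectivePlane P L] [Fintype P] [Fintype L]
  [DecidableEq P] [DecidableEq L] [Fintype X] [DecidableEq X] [Nonempty X]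

/-- Line patterns together with a colouring of the pairs in `S ∪ X`. -/
theorem le_psi_of_patterns_of_spanningColouring
    (pat : ∀ l : L, LinePattern (linePts l : Finset P)) (S : Finset P) (weak : Finset L)
    (K : Finset (P ⊕ X)) (N : SpanningColouring (S.disjSum (Finset.univ : Finset X)) K)
    (hSweak : ∀ s ∈ S, ∀ l : L, s ∈ l → l ∈ weak)
    (hweak : K.Nonempty → ∀ l ∈ weak, ∃ s ∈ S, s ∈ l)
    (hnext : ∀ l, ∀ u ∈ (pat l).served, ¬ (u ∈ S ∧ (pat l).next u ∈ S))
    (hstrong : ∀ u ∉ S, ((pencil L u).filter fun l => l ∉ weak ∧ u ∉ (pat l).kill).card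
      ≤ Fintype.card X)
    (hfree : ∀ u ∉ S, ProjectivePlane.order P L + 1 ≤ Fintype.card X + ∑ l ∈ pencil L u,
      ((if u ∈ (pat l).kill then 1 else 0) + if u ∈ (pat l).served then 1 else 0))
    (hres : ∀ u ∈ S, ((pencil L u).filter fun l => u ∉ (pat l).kill).card +
      (S.filter fun y => y ≠ u ∧ ∃ l ∈ pencil L u, y ∈ (linePts l : Finset P) ∧
        (pat l).mid u y ∉ (pat l).kill).card ≤
          ((pencil L u).filter fun l => u ∈ (pat l).served).card)
    {m : ℕ} (hm : Fintype.card P + Fintype.card X = m) :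
    ∑ l, (ProjectivePlane.order P L + 1 - (pat l).kill.card) + K.card ≤ psi m := by
  rw [← Fintype.card_coe K]
  have hin : ∀ s : P, Sum.inl s ∈ S.disjSum (Finset.univ : Finset X) ↔ s ∈ S := by simp
  have hex : ∀ i : K, ∀ x ∈ S.disjSum (Finset.univ : Finset X), ∃ e ∈ {e : Sym2 (P ⊕ X) | ∃ x y,
      x ∈ S.disjSum Finset.univ ∧ y ∈ S.disjSum Finset.univ ∧ x ≠ y ∧ N.col x y = i ∧ e = s(x, y)},
      x ∈ e := by
    intro i x hx
    obtain ⟨y, hy, hyx, hc⟩ := N.exists_col hx i.2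
    exact ⟨s(x, y), ⟨x, y, hx, hy, hyx.symm, hc, rfl⟩, by simp⟩
  refine le_psi_of_patterns pat S weak hSweak (fun h => hweak ?_) hnext hstrong hfree hres
    (fun i : K => {e : Sym2 (P ⊕ X) | ∃ x y, x ∈ S.disjSum Finset.univ ∧ y ∈ S.disjSum Finset.univ ∧
      x ≠ y ∧ N.col x y = i ∧ e = s(x, y)}) ?_ ?_ ?_
    (fun i s hs => hex i _ ((hin s).2 hs)) (fun i x => hex i _ (by simp)) hm
  · obtain ⟨i⟩ := h
    exact ⟨i, i.2⟩
  · rintro i e ⟨x, y, -, -, hxy, -, rfl⟩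
    simpa using hxy
  · rintro i e ⟨x, y, hx, hy, -, -, rfl⟩ p hp
    rcases Sym2.mem_iff.1 hp with rfl | rfl
    · exact (hin _).1 hx
    · exact (hin _).1 hy
  · rintro i j e ⟨x, y, hx, hy, -, hi, rfl⟩ ⟨x', y', hx', hy', -, hj, he⟩
    rw [Sym2.eq_iff] at he
    apply Subtype.ext
    rcases he with ⟨rfl, rfl⟩ | ⟨rfl, rfl⟩
    · exact hi.symm.trans hj
    · rw [← hi, ← hj, N.col_comm hx' hy']

end

/-! ### Sums over pencils and lines -/

section counting

open Configuration

variable {P L : Type*} [Membership P L] [ProjectivePlane P L] [Fintype L]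

theorem pencil_inter_pencil [DecidableEq L] {x y : P} (hxy : x ≠ y) {l : L} (hx : x ∈ l)
    (hy : y ∈ l) : pencil L x ∩ pencil L y = {l} := by
  ext l'
  simp only [Finset.mem_inter, mem_pencil, Finset.mem_singleton]
  exact ⟨fun h => line_unique hxy h.1 h.2 hx hy, fun h => h ▸ ⟨hx, hy⟩⟩

/-- Projection from u, which is not on k, matches the lines through u with the points of k. -/
theorem sum_pencil_eq [Fintype P] {u : P} {f : L → ℕ} {g : P → ℕ} {k : L} (hu : u ∉ k)
    (hfg : ∀ (l : L) (p : P), u ∈ l → p ∈ l → p ∈ k → f l = g p) :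
    ∑ l ∈ pencil L u, f l = ∑ p ∈ linePts k, g p := by
  have hj := fun p : P => (exists_joining_line (L := L) u p).choose_spec
  refine (Finset.sum_bij (fun p _ => (exists_joining_line (L := L) u p).choose) ?_ ?_ ?_ ?_).symm
  · intro p _
    exact mem_pencil.2 (hj p).1
  · intro p hp p' hp' he
    rw [mem_linePts] at hp hp'
    have hp2 := (hj p).2
    rw [he] at hp2
    refine point_unique (fun h => hu ?_) hp2 (hj p').2 hp hp'
    rw [← h]
    exact (hj p').1
  · intro l hl
    rw [mem_pencil] at hl
    obtain ⟨p, hp, hpk⟩ := exists_common_point (P := P) l k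
    have hup : u ≠ p := fun h => hu (h ▸ hpk)
    exact ⟨p, mem_linePts.2 hpk, line_unique hup (hj p).1 (hj p).2 hl hp⟩
  · intro p hp
    exact (hfg _ p (hj p).1 (hj p).2 (mem_linePts.1 hp)).symm

theorem sum_pencil_ite [Fintype P] [DecidableEq P] {u : P} {f : L → ℕ} {k : L} (hu : u ∉ k)
    {B : Finset P} (hB : B ⊆ linePts k) {α β : ℕ}
    (hfg : ∀ (l : L) (p : P), u ∈ l → p ∈ l → p ∈ k → f l = if p ∈ B then α else β) :
    ∑ l ∈ pencil L u, f l =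
      B.card * α + (ProjectivePlane.order P L + 1 - B.card) * β := by
  rw [sum_pencil_eq hu hfg, Finset.sum_ite, Finset.sum_const, Finset.sum_const,
    Finset.filter_mem_eq_inter, Finset.inter_eq_right.2 hB, Finset.filter_notMem_eq_sdiff,
    Finset.card_sdiff_of_subset hB, card_linePts, smul_eq_mul, smul_eq_mul]

/-- A line other than k has one point on k and q points off it. -/
theorem sum_linePts_le [Fintype P] {f : P → ℕ} {l k : L} (hlk : l ≠ k) {α β : ℕ}
    (hf : ∀ u, u ∉ l → f u = 0) (hα : ∀ u, u ∈ l → u ∈ k → f u ≤ α)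
    (hβ : ∀ u, u ∈ l → u ∉ k → f u ≤ β) :
    ∑ u, f u ≤ α + ProjectivePlane.order P L * β := by
  classical
  obtain ⟨x, hxl, hxk⟩ := exists_common_point (P := P) l k
  have h1 : ∑ u ∈ linePts l, f u = ∑ u, f u :=
    Finset.sum_subset (Finset.subset_univ _) fun u _ hu => hf u (by simpa using hu)
  rw [← h1, ← Finset.add_sum_erase _ _ (mem_linePts.2 hxl)]
  refine add_le_add (hα x hxl hxk) ?_
  refine (Finset.sum_le_card_nsmul _ _ β fun u hu => ?_).trans_eq ?_
  · have hu' := Finset.mem_erase.1 hu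
    exact hβ u (mem_linePts.1 hu'.2) fun huk =>
      hu'.1 (point_unique hlk (mem_linePts.1 hu'.2) hxl huk hxk)
  · rw [Finset.card_erase_of_mem (mem_linePts.2 hxl), card_linePts, smul_eq_mul,
      Nat.add_sub_cancel]

end counting

/-! ### The extreme cases a = -1 and a = q/2 + 1 -/

section

open Configuration

variable {P L : Type*} [Membership P L] [ProjectivePlane P L] [Fintype P] [Fintype L]

/-- Here X has as many elements as there are lines through a point, so nothing has to be killed, and
the pairs inside X give q - 1 additional classes. -/
theorem le_psi_of_excess_one {h : ℕ} (hh : 0 < h) (hord : ProjectivePlane.order P L = 2 * h) :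
    (Fintype.card P + 2 * h + 2) * (2 * h) ≤ psi (Fintype.card P + (2 * h + 1)) := by
  classical
  have hl : ∀ l : L, (linePts l : Finset P).card = 2 * h + 1 := fun l => by rw [card_linePts, hord]
  choose pat hk hs using fun l : L => exists_pattern_trivial hh (hl l)
  obtain ⟨K, hK, ⟨N⟩⟩ := exists_spanningColouring_odd (V := P ⊕ Fin (2 * h + 1))
    (Y := (∅ : Finset P).disjSum Finset.univ) hh (by simp)
  have key := le_psi_of_patterns_of_spanningColouring pat ∅ ∅ K N (by simp) (by simp) (by simp)
    (fun u _ => by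
      refine (Finset.card_filter_le _ _).trans ?_
      rw [card_pencil, hord, Fintype.card_fin])
    (fun u _ => by
      rw [hord, Fintype.card_fin]
      exact Nat.le_add_right _ _)
    (by simp) (m := Fintype.card P + (2 * h + 1)) (by simp)
  refine le_trans ?_ key
  have hP := ProjectivePlane.card_points P L
  have hL := ProjectivePlane.card_lines P L
  simp only [hk, Finset.card_empty, Nat.sub_zero, Finset.sum_const, Finset.card_univ, hord, hK, hL,
    hP, smul_eq_mul]
  obtain ⟨k, rfl⟩ : ∃ k, h = k + 1 := ⟨h - 1, by omega⟩
  rw [show 2 * (k + 1) - 1 = 2 * k + 1 by omega]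
  apply le_of_eq
  ring

/-- A pattern killing one point and catching a given set of points. -/
theorem exists_pattern_catch {P : Type*} [DecidableEq P] {s : Finset P} {h : ℕ} (hh : 0 < h)
    (hs : s.card = 2 * h + 1) {T : Finset P} (hT : T ⊆ s) (hTh : T.card ≤ h + 1) :
    ∃ p : LinePattern s, p.kill.card = 1 ∧ ∀ u ∈ T, u ∈ p.kill ∨ u ∈ p.served := by
  obtain ⟨c, hc, hcT⟩ : ∃ c ∈ s, (T.erase c).card ≤ h := by
    rcases T.eq_empty_or_nonempty with rfl | ⟨c, hc⟩
    · obtain ⟨c, hc⟩ : s.Nonempty := Finset.card_pos.1 (by omega)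
      exact ⟨c, hc, by simp⟩
    · exact ⟨c, hT hc, by rw [Finset.card_erase_of_mem hc]; omega⟩
  obtain ⟨p, hk, hserv⟩ := exists_pattern_single hh hs hc ((Finset.erase_subset c T).trans hT)
    (by simp) hcT
  refine ⟨p, by simp [hk], fun u hu => ?_⟩
  by_cases huc : u = c
  · exact Or.inl (by simp [hk, huc])
  · exact Or.inr (hserv (Finset.mem_erase.2 ⟨huc, hu⟩))

/-- A pattern killing `d` and another point, serving all points but `d`, and catching a given
point twice. -/
theorem exists_pattern_double_catch {P : Type*} [DecidableEq P] {s : Finset P} {h : ℕ} (hh : 0 < h)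
    (hs : s.card = 2 * h + 1) {d : P} (hd : d ∈ s) {T : Finset P} (hT : T ⊆ s) (hdT : d ∉ T)
    (hTh : T.card ≤ 1) :
    ∃ p : LinePattern s, p.kill.card = 2 ∧ d ∈ p.kill ∧ T ⊆ p.kill ∧ p.served = s.erase d := by
  obtain ⟨c, hc, hcT⟩ : ∃ c ∈ s.erase d, T ⊆ {c} := by
    rcases T.eq_empty_or_nonempty with rfl | ⟨c, hc⟩
    · obtain ⟨c, hc⟩ : (s.erase d).Nonempty :=
        Finset.card_pos.1 (by rw [Finset.card_erase_of_mem hd]; omega)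
      exact ⟨c, hc, by simp⟩
    · exact ⟨c, Finset.mem_erase.2 ⟨fun h => hdT (h ▸ hc), hT hc⟩,
        fun x hx => by simpa using Finset.card_le_one.1 hTh x hx c hc⟩
  have hc' := Finset.mem_erase.1 hc
  obtain ⟨p, hk, hserv⟩ := exists_pattern_double hh hs hc'.2 hd hc'.1
  exact ⟨p, by rw [hk, Finset.card_pair hc'.1], by simp [hk], hcT.trans (by simp [hk]), hserv⟩

theorem exists_two_points (P L : Type*) [Membership P L] [ProjectivePlane P L] [Fintype P]
    [Fintype L] : ∃ (A B : P) (k : L), A ≠ B ∧ A ∈ k ∧ B ∈ k := by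
  have hP := ProjectivePlane.card_points P L
  obtain ⟨A, B, hAB⟩ := Fintype.one_lt_card_iff.1 (show 1 < Fintype.card P by
    have := ProjectivePlane.one_lt_order P L
    omega)
  obtain ⟨k, hA, hB⟩ := exists_joining_line (L := L) A B
  exact ⟨A, B, k, hAB, hA, hB⟩

theorem card_pencil_union_erase [DecidableEq L] {A B : P} (hAB : A ≠ B) {k : L} (hA : A ∈ k)
    (hB : B ∈ k) :
    ((pencil L A ∪ pencil L B).erase k).card = 2 * ProjectivePlane.order P L := by
  have h1 := Finset.card_union_add_card_inter (pencil L A) (pencil L B)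
  rw [pencil_inter_pencil hAB hA hB, card_pencil, card_pencil, Finset.card_singleton] at h1
  rw [Finset.card_erase_of_mem (by simp [hA])]
  omega

/-- A point has only h - 1 edges to X, so it must be helped h + 2 times. Each of the 2q lines other
than k through A or B kills two near-1-factors, which helps all its points once and one chosen point
once more; every other line kills one and helps h + 1 chosen points. Without any choice A and B are
helped 2h ≥ h + 2 times and a point off k twice. The choices must supply h more to a point off k,
and h + 2 to a point of k other than A and B. -/
theorem le_psi_of_deficiency_max {h : ℕ} (hh : 2 ≤ h)
    (hord : ProjectivePlane.order P L = 2 * h) :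
    (Fintype.card P - 2) * (2 * h) ≤ psi (Fintype.card P + (h - 1)) := by
  classical
  have hl : ∀ l : L, (linePts l : Finset P).card = 2 * h + 1 := fun l => by rw [card_linePts, hord]
  obtain ⟨A, B, k, hAB, hA, hB⟩ := exists_two_points P L
  obtain ⟨g, rfl⟩ : ∃ g, h = g + 2 := ⟨h - 2, by omega⟩
  let q := 2 * g + 4
  let sp : L → Prop := fun l => l ≠ k ∧ (A ∈ l ∨ B ∈ l)
  have hspAB : ∀ l, sp l → ∃ d : P, d ∈ l ∧ d ∈ k := by
    rintro l ⟨-, h | h⟩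
    exacts [⟨A, h, hA⟩, ⟨B, h, hB⟩]
  -- In units of r = 2q(q - 1), where q - 1 = 2g + 3: a special line gives 1/q to each of its q
  -- points off k, in total 1. The other lines give (q + 2)/(2(q - 1)) to their points on k other
  -- than A and B, and (q² - 4)/(2q(q - 1)) to each point off k, in total q/2 + 1. A point off k, on
  -- two special and q - 1 other lines, receives exactly q/2. No weight exceeds 1 because q ≥ 4.
  let W : L → P → ℕ := fun l u => if u ∉ l then 0 else if sp l then
      (if u ∈ k then 0 else 2 * (2 * g + 3)) else if u = A ∨ u = B then 0 else
        if u ∈ k then q * (q + 2) else (2 * g + 2) * (2 * g + 6)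
  let t : L → ℕ := fun l => if sp l then 1 else g + 3
  let N : P → ℕ := fun u => if u = A ∨ u = B then 0 else if u ∈ k then g + 4 else g + 2
  have hpair : ∀ u, u ∈ ({A, B} : Finset P) ↔ u = A ∨ u = B := by simp
  obtain ⟨T, hT0, hTt, hTN⟩ := exists_choice_of_weights (2 * q * (2 * g + 3)) (by positivity) W t N
    (by
      intro l u
      simp only [W, q]
      split_ifs <;> nlinarith)
    (by
      intro l
      by_cases hlk : l = k
      · have hz : ∀ u, W l u = if u ∈ linePts k \ {A, B} then q * (q + 2) else 0 := by
          intro u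
          simp only [W, sp, hlk, Finset.mem_sdiff, hpair, mem_linePts, ne_eq, not_true_eq_false,
            false_and, if_false]
          split_ifs <;> tauto
        simp only [hz]
        rw [Finset.sum_ite_mem, Finset.univ_inter, Finset.sum_const, Finset.card_sdiff_of_subset (by
          intro x
          simp only [hpair, mem_linePts]
          rintro (rfl | rfl) <;> assumption), Finset.card_pair hAB, hl]
        simp only [t, sp, hlk, ne_eq, not_true_eq_false, false_and, if_false, q, smul_eq_mul]
        rw [show 2 * (g + 2) + 1 - 2 = 2 * g + 3 by omega]
        apply le_of_eq
        ring
      · by_cases hs : sp l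
        · refine (sum_linePts_le hlk (f := W l) (α := 0) (β := 2 * (2 * g + 3))
            (fun u hu => by simp [W, hu]) (fun u hu huk => by simp [W, hu, hs, huk])
            (fun u hu huk => by simp [W, hu, hs, huk])).trans_eq ?_
          simp only [t, hs, hord, if_true, q]
          ring
        · have hlAB : ∀ u, u ∈ l → ¬ (u = A ∨ u = B) := by
            rintro u hu (rfl | rfl)
            exacts [hs ⟨hlk, Or.inl hu⟩, hs ⟨hlk, Or.inr hu⟩]
          refine (sum_linePts_le hlk (f := W l) (α := q * (q + 2))
            (β := (2 * g + 2) * (2 * g + 6))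
            (fun u hu => by simp [W, hu]) (fun u hu huk => by simp [W, hu, hs, huk, hlAB])
            (fun u hu huk => by simp [W, hu, hs, huk, hlAB])).trans_eq ?_
          simp only [t, hs, hord, if_false, q]
          ring)
    (by
      intro u
      by_cases huAB : u = A ∨ u = B
      · simp [N, huAB]
      have hsum : ∑ l, W l u = ∑ l ∈ pencil L u, W l u :=
        (Finset.sum_subset (Finset.subset_univ _) fun l _ hl => by
          simp [W, show u ∉ l by simpa using hl]).symm
      rw [hsum]
      by_cases huk : u ∈ k
      · rw [Finset.sum_congr rfl (g := fun _ => q * (q + 2)) (fun l hl => by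
          rw [mem_pencil] at hl
          have hs : ¬ sp l := by
            rintro ⟨h1, h2⟩
            obtain rfl | rfl : A = u ∨ B = u := h2.imp
              (fun h2 => point_unique h1 h2 hl hA huk) (fun h2 => point_unique h1 h2 hl hB huk)
            · exact huAB (Or.inl rfl)
            · exact huAB (Or.inr rfl)
          simp [W, hl, hs, huAB, huk]), Finset.sum_const, card_pencil, hord]
        simp only [N, huAB, huk, if_true, if_false, q, smul_eq_mul]
        nlinarith
      · rw [sum_pencil_ite huk (B := {A, B}) (α := 2 * (2 * g + 3))
          (β := (2 * g + 2) * (2 * g + 6)) (by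
            intro x
            simp only [hpair, mem_linePts]
            rintro (rfl | rfl) <;> assumption) (by
            intro l p hul hpl hpk
            have hlk : l ≠ k := fun h => huk (h ▸ hul)
            have hs : sp l ↔ p ∈ ({A, B} : Finset P) := by
              rw [hpair]
              constructor
              · rintro ⟨-, h | h⟩
                · exact Or.inl (point_unique hlk hpl h hpk hA)
                · exact Or.inr (point_unique hlk hpl h hpk hB)
              · rintro (rfl | rfl)
                exacts [⟨hlk, Or.inl hpl⟩, ⟨hlk, Or.inr hpl⟩]
            simp only [W, hul, not_true_eq_false, if_false, huk, huAB, hs]), Finset.card_pair hAB,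
            hord]
        simp only [N, huAB, huk, if_false, q]
        rw [show 2 * (g + 2) + 1 - 2 = 2 * g + 3 by omega]
        apply le_of_eq
        ring)
  have hTl : ∀ l, T l ⊆ linePts l := by
    intro l u hu
    rw [mem_linePts]
    by_contra hul
    exact absurd (hT0 l u hu) (by simp [W, hul])
  have hpat : ∀ l : L, ∃ p : LinePattern (linePts l : Finset P),
      p.kill.card = 1 + (if sp l then 1 else 0) ∧ ∀ u ∈ l,
        (if u ∈ T l then 1 else 0) + (if sp l then 1 else 0) ≤
          (if u ∈ p.kill then 1 else 0) + if u ∈ p.served then 1 else 0 := by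
    intro l
    by_cases hs : sp l
    · obtain ⟨d, hd, hdk⟩ := hspAB l hs
      have hdT : d ∉ T l := fun hdT => absurd (hT0 l d hdT) (by simp [W, hs, hdk, hd])
      obtain ⟨p, h1, h2, h3, h4⟩ := exists_pattern_double_catch (by omega) (hl l)
        (mem_linePts.2 hd) (hTl l) hdT (by simpa [t, hs] using hTt l)
      refine ⟨p, by simp [h1, hs], fun u hu => ?_⟩
      rw [h4, if_pos hs]
      by_cases hud : u = d
      · subst hud
        simp [hdT, h2]
      · rw [if_pos (Finset.mem_erase.2 ⟨hud, mem_linePts.2 hu⟩)]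
        by_cases huT : u ∈ T l
        · rw [if_pos huT, if_pos (h3 huT)]
        · simp [huT]
    · obtain ⟨p, h1, h2⟩ := exists_pattern_catch (by omega) (hl l) (hTl l)
        (by simpa [t, hs] using hTt l)
      refine ⟨p, by simp [h1, hs], fun u hu => ?_⟩
      rw [if_neg hs]
      by_cases huT : u ∈ T l
      · rcases h2 u huT with h | h <;> simp [huT, h]
      · simp [huT]
  choose pat hk hval using hpat
  have hne : Nonempty (Fin (g + 2 - 1)) := ⟨⟨0, by omega⟩⟩
  -- There are no reserved points and no additional classes; with every line declared weak, no
  -- completing edge is forced into X.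
  have key := le_psi_of_patterns_of_spanningColouring (X := Fin (g + 2 - 1)) pat ∅ Finset.univ ∅
    ⟨fun _ _ => Sum.inl A, by simp, by simp⟩ (by simp) (by simp) (by simp) (by simp)
    (fun u _ => by
      have h1 : ∑ l ∈ pencil L u, ((if u ∈ T l then 1 else 0) + if sp l then 1 else 0) ≤ _ :=
        Finset.sum_le_sum fun l hl => hval l u (mem_pencil.1 hl)
      refine le_trans ?_ (add_le_add_right h1 _)
      have hsub : (Finset.univ.filter fun l => u ∈ T l) ⊆ (pencil L u).filter fun l => u ∈ T l := by
        intro l hl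
        rw [Finset.mem_filter] at hl ⊢
        exact ⟨mem_pencil.2 (mem_linePts.1 (hTl l hl.2)), hl.2⟩
      have h2 := (hTN u).trans (Finset.card_le_card hsub)
      rw [Finset.sum_add_distrib, ← Finset.card_filter, hord, Fintype.card_fin]
      by_cases huAB : u = A ∨ u = B
      · have h3 : (pencil L u).erase k ⊆ (pencil L u).filter sp := by
          intro l hl
          rw [Finset.mem_erase, mem_pencil] at hl
          rw [Finset.mem_filter, mem_pencil]
          exact ⟨hl.2, hl.1, huAB.imp (fun h => by rw [← h]; exact hl.2)
            (fun h => by rw [← h]; exact hl.2)⟩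
        have h4 : _ ≤ ∑ l ∈ pencil L u, if sp l then 1 else 0 :=
          (Finset.card_le_card h3).trans_eq (Finset.card_filter _ _)
        rw [Finset.card_erase_of_mem (mem_pencil.2 (by rcases huAB with rfl | rfl <;> assumption)),
          card_pencil, hord] at h4
        omega
      · by_cases huk : u ∈ k
        · simp only [N, huAB, huk, if_false, if_true] at h2
          omega
        · simp only [N, huAB, huk, if_false] at h2
          rw [sum_pencil_ite huk (B := {A, B}) (α := 1) (β := 0) (by
            intro x
            simp only [hpair, mem_linePts]
            rintro (rfl | rfl) <;> assumption) (by
            intro l p hul hpl hpk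
            have hlk : l ≠ k := fun h => huk (h ▸ hul)
            have hs : sp l ↔ p ∈ ({A, B} : Finset P) := by
              rw [hpair]
              constructor
              · rintro ⟨-, h | h⟩
                · exact Or.inl (point_unique hlk hpl h hpk hA)
                · exact Or.inr (point_unique hlk hpl h hpk hB)
              · rintro (rfl | rfl)
                exacts [⟨hlk, Or.inl hpl⟩, ⟨hlk, Or.inr hpl⟩]
            simp only [hs]), Finset.card_pair hAB]
          omega)
    (by simp) (m := Fintype.card P + (g + 2 - 1)) (by simp)
  refine le_trans ?_ key
  have hP := ProjectivePlane.card_points P L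
  have hL := ProjectivePlane.card_lines P L
  have hspc : (Finset.univ.filter sp).card = 2 * (2 * (g + 2)) := by
    rw [← hord, ← card_pencil_union_erase hAB hA hB]
    congr 1
    ext l
    simp [sp]
  have hkle : ∀ l, (pat l).kill.card ≤ 2 := fun l => by
    rw [hk]
    split_ifs <;> omega
  have htot : ∑ l, (2 * (g + 2) + 1 - (pat l).kill.card) + ∑ l, (pat l).kill.card =
      Fintype.card L * (2 * (g + 2) + 1) := by
    rw [← Finset.sum_add_distrib, Finset.sum_congr rfl (g := fun _ => 2 * (g + 2) + 1)
      (fun l _ => by have := hkle l; omega)]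
    simp
  have hkt : ∑ l, (pat l).kill.card = Fintype.card L + 2 * (2 * (g + 2)) := by
    simp only [hk]
    rw [Finset.sum_add_distrib, ← Finset.card_filter, hspc]
    simp
  rw [hord, Finset.card_empty, add_zero]
  rw [hkt, hL, ← hP] at htot
  obtain ⟨c, hc⟩ : ∃ c, Fintype.card P = c + 2 := ⟨Fintype.card P - 2, by omega⟩
  rw [hc] at htot ⊢
  rw [Nat.add_sub_cancel]
  nlinarith

end

/-! ### The case a = 0 -/

section

open Configuration

variable {P L : Type*} [Membership P L] [ProjectivePlane P L] [Fintype P] [Fintype L]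

/-- Each point outside {A, B} must be helped once. A line other than k through A or B kills the
near-1-factor missing that point and can serve h of its 2h points off k; every point off k is on two
such lines, so weights 1/2 can be rounded to serve all. On k, killing A and a third point d helps
all remaining points and releases the pair AB. Then A is killed on all its lines, and B on all but
k, where it is served. -/
theorem le_psi_of_excess_zero {h : ℕ} (hh : 2 ≤ h) (hord : ProjectivePlane.order P L = 2 * h) :
    (Fintype.card P + 2 * h) * (2 * h) ≤ psi (Fintype.card P + 2 * h) := by
  classical
  have hl : ∀ l : L, (linePts l : Finset P).card = 2 * h + 1 := fun l => by rw [card_linePts, hord]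
  obtain ⟨A, B, k, hAB, hA, hB⟩ := exists_two_points P L
  let sp : L → Prop := fun l => l ≠ k ∧ (A ∈ l ∨ B ∈ l)
  have hsp : ∀ l, sp l → ∃ d : P, d ∈ l ∧ d ∈ k ∧ (d = A ∨ d = B) := by
    rintro l ⟨-, h | h⟩
    exacts [⟨A, h, hA, Or.inl rfl⟩, ⟨B, h, hB, Or.inr rfl⟩]
  have hpair : ∀ u, u ∈ ({A, B} : Finset P) ↔ u = A ∨ u = B := by simp
  have hsub : ({A, B} : Finset P) ⊆ linePts k := by
    intro x
    simp only [hpair, mem_linePts]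
    rintro (rfl | rfl) <;> assumption
  have hspiff : ∀ {l : L} {u p : P}, u ∉ k → u ∈ l → p ∈ l → p ∈ k →
      (sp l ↔ p ∈ ({A, B} : Finset P)) := by
    intro l u p huk hul hpl hpk
    have hlk : l ≠ k := fun h => huk (h ▸ hul)
    rw [hpair]
    constructor
    · rintro ⟨-, h | h⟩
      · exact Or.inl (point_unique hlk hpl h hpk hA)
      · exact Or.inr (point_unique hlk hpl h hpk hB)
    · rintro (rfl | rfl)
      exacts [⟨hlk, Or.inl hpl⟩, ⟨hlk, Or.inr hpl⟩]
  let W : L → P → ℕ := fun l u => if u ∈ l ∧ u ∉ k ∧ sp l then 1 else 0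
  obtain ⟨T, hT0, hTt, hTN⟩ := exists_choice_of_weights 2 two_pos W (fun _ => h)
    (fun u => if u ∈ k then 0 else 1)
    (by
      intro l u
      simp only [W]
      split_ifs <;> omega)
    (by
      intro l
      by_cases hlk : l = k
      · refine (Finset.sum_eq_zero fun u _ => ?_).trans_le (Nat.zero_le _)
        simp [W, sp, hlk]
      · refine (sum_linePts_le hlk (f := W l) (α := 0) (β := 1)
          (fun u hu => by simp [W, hu]) (fun u hu huk => by simp [W, huk])
          (fun u hu huk => by simp only [W]; split_ifs <;> omega)).trans_eq ?_
        rw [hord]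
        ring)
    (by
      intro u
      by_cases huk : u ∈ k
      · simp [huk]
      · have hsum : ∑ l ∈ pencil L u, W l u ≤ ∑ l, W l u :=
          Finset.sum_le_sum_of_subset (Finset.subset_univ _)
        refine le_trans ?_ hsum
        rw [sum_pencil_ite huk hsub (α := 1) (β := 0) (fun l p hul hpl hpk => by
          simp only [W, hul, huk, hspiff huk hul hpl hpk, not_false_eq_true, true_and]),
          Finset.card_pair hAB]
        simp [huk])
  have hT : ∀ l, ∀ u ∈ T l, u ∈ l ∧ u ∉ k ∧ sp l := by
    intro l u hu
    by_contra hul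
    exact absurd (hT0 l u hu) (by simp [W, hul])
  obtain ⟨d, hd, hdAB⟩ : ∃ d ∈ linePts k, d ∉ ({A, B} : Finset P) :=
    Finset.exists_mem_notMem_of_card_lt_card (by rw [hl, Finset.card_pair hAB]; omega)
  rw [hpair, not_or] at hdAB
  have hpat : ∀ l : L, ∃ p : LinePattern (linePts l : Finset P),
      (l = k → p.kill = {A, d} ∧ p.served = ((linePts k).erase A).erase d ∧ p.mid A B ∈ p.kill ∧
        p.mid B A ∈ p.kill ∧ ∀ u ∈ p.served, ¬ (u = B ∧ p.next u = A)) ∧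
      (sp l → p.kill = {A, B} ∩ linePts l ∧ p.kill.card = 1 ∧ ∀ u ∈ T l, u ∈ p.served) ∧
      (l ≠ k → ¬ sp l → p.kill = ∅ ∧ p.served = ∅) := by
    intro l
    by_cases hlk : l = k
    · subst hlk
      obtain ⟨p, h1, h2, h3, h4⟩ := exists_pattern_reserved (by omega) (hl l) (mem_linePts.2 hA)
        (mem_linePts.2 hB) hd hAB (Ne.symm hdAB.1) (Ne.symm hdAB.2)
      exact ⟨p, fun _ => ⟨h1, h2, h3, p.mid_comm (mem_linePts.2 hA) (mem_linePts.2 hB) ▸ h3, h4⟩,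
        fun h => absurd rfl h.1, fun h => absurd rfl h⟩
    · by_cases hs : sp l
      · obtain ⟨c, hcl, hck, hc⟩ := hsp l hs
        obtain ⟨p, h1, h2⟩ := exists_pattern_single (by omega) (hl l) (mem_linePts.2 hcl)
          (T := T l) (fun u hu => mem_linePts.2 (hT l u hu).1) (fun h => (hT l c h).2.1 hck) (hTt l)
        refine ⟨p, fun h => absurd h hlk, fun _ => ⟨?_, by simp [h1], fun u hu => h2 hu⟩,
          fun _ h => absurd hs h⟩
        rw [h1]
        ext x
        simp only [Finset.mem_singleton, Finset.mem_inter, hpair, mem_linePts]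
        constructor
        · rintro rfl
          exact ⟨hc, hcl⟩
        · rintro ⟨hx, hxl⟩
          exact point_unique hlk hxl hcl (by rcases hx with rfl | rfl <;> assumption) hck
      · obtain ⟨p, h1, h2⟩ := exists_pattern_trivial (by omega) (hl l)
        exact ⟨p, fun h => absurd h hlk, fun h => absurd h hs, fun _ _ => ⟨h1, h2⟩⟩
  choose pat hpk hps hpt using hpat
  obtain ⟨hk1, hk2, hk3, hk3', hk4⟩ := hpk k rfl
  have hnotsp : ∀ l u, u ∉ ({A, B} : Finset P) → u ∈ k → l ≠ k → u ∈ l → ¬ sp l := by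
    rintro l u hu huk hlk hul ⟨-, h⟩
    rw [hpair] at hu
    exact hu (h.imp (fun h => point_unique hlk hul h huk hA)
      (fun h => point_unique hlk hul h huk hB))
  obtain ⟨K, hK, ⟨N⟩⟩ := exists_spanningColouring_even (V := P ⊕ Fin (2 * h))
    (Y := ({A, B} : Finset P).disjSum Finset.univ) (show 0 < h by omega) (by
      rw [Finset.card_disjSum, Finset.card_pair hAB, Finset.card_univ, Fintype.card_fin]
      omega)
  have hne : Nonempty (Fin (2 * h)) := ⟨⟨0, by omega⟩⟩
  have hweak : ∀ l, l ∈ pencil L A ∪ pencil L B ↔ l = k ∨ sp l := by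
    intro l
    simp only [Finset.mem_union, mem_pencil, sp]
    by_cases hlk : l = k
    · simp [hlk, hA]
    · simp [hlk]
  have key := le_psi_of_patterns_of_spanningColouring (X := Fin (2 * h)) pat {A, B}
    (pencil L A ∪ pencil L B) K N
    (by
      intro s hs l hsl
      rcases (hpair s).1 hs with rfl | rfl <;> simp [hsl])
    (by
      intro _ l hlw
      rcases Finset.mem_union.1 hlw with h | h <;> rw [mem_pencil] at h
      exacts [⟨A, by simp, h⟩, ⟨B, by simp, h⟩])
    (by
      intro l u hu ⟨h1, h2⟩
      have hne := (pat l).next_ne hu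
      by_cases hlk : l = k
      · subst hlk
        rcases (hpair u).1 h1 with rfl | rfl
        · rw [hk2] at hu
          simp at hu
        · rcases (hpair _).1 h2 with h | h
          · exact hk4 _ hu ⟨rfl, h⟩
          · exact hne h
      · have hin : ({A, B} : Finset P) ⊆ linePts k := hsub
        exact hne (point_unique hlk (mem_linePts.1 ((pat l).next_mem hu))
          (mem_linePts.1 ((pat l).served_subset hu)) (mem_linePts.1 (hin h2))
          (mem_linePts.1 (hin h1))))
    (by
      intro u hu
      rw [Fintype.card_fin]
      have h1 : (pencil L u).card = 2 * h + 1 := by rw [card_pencil, hord]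
      obtain ⟨l, hlu, hlA⟩ := exists_joining_line (L := L) u A
      have h2 : ((pencil L u).filter fun l => l ∉ pencil L A ∪ pencil L B ∧ u ∉ (pat l).kill) ⊆
          (pencil L u).erase l := by
        intro l' hl'
        rw [Finset.mem_filter] at hl'
        refine Finset.mem_erase.2 ⟨?_, hl'.1⟩
        rintro rfl
        exact hl'.2.1 (by simp [hlA])
      refine (Finset.card_le_card h2).trans ?_
      rw [Finset.card_erase_of_mem (by simpa using hlu), h1]
      omega)
    (by
      intro u hu
      rw [hord, Fintype.card_fin]
      suffices hsuff : ∃ l ∈ pencil L u, u ∈ (pat l).kill ∨ u ∈ (pat l).served by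
        obtain ⟨l, hl, hlu⟩ := hsuff
        refine add_le_add_right (le_trans ?_ (Finset.single_le_sum (fun _ _ => Nat.zero_le _) hl)) _
        rcases hlu with h | h <;> simp [h]
      by_cases huk : u ∈ k
      · refine ⟨k, mem_pencil.2 huk, ?_⟩
        rw [hk1, hk2]
        by_cases hud : u = d
        · simp [hud]
        · rw [hpair, not_or] at hu
          simp [hud, hu.1, huk]
      · have h1 := hTN u
        rw [if_neg huk] at h1
        obtain ⟨l, hl⟩ := Finset.card_pos.1 h1
        have hl' := (Finset.mem_filter.1 hl).2
        have h2 := hT l u hl'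
        exact ⟨l, mem_pencil.2 h2.1, Or.inr ((hps l h2.2.2).2.2 u hl')⟩)
    (by
      intro u hu
      have hcase : ∀ l ∈ (pencil L u).filter (fun l => u ∉ (pat l).kill), l = k ∧ u = B := by
        intro l hl
        rw [Finset.mem_filter, mem_pencil] at hl
        have hlk : l = k := by
          by_contra hlk
          have hs : sp l := ⟨hlk, ((hpair u).1 hu).imp (fun h => by rw [← h]; exact hl.1)
            (fun h => by rw [← h]; exact hl.1)⟩
          refine hl.2 ?_
          rw [(hps l hs).1]
          exact Finset.mem_inter.2 ⟨hu, mem_linePts.2 hl.1⟩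
        subst hlk
        refine ⟨rfl, ((hpair u).1 hu).resolve_left fun h => hl.2 ?_⟩
        rw [hk1, h]
        simp
      have hz : (({A, B} : Finset P).filter fun y => y ≠ u ∧ ∃ l ∈ pencil L u,
          y ∈ (linePts l : Finset P) ∧ (pat l).mid u y ∉ (pat l).kill) = ∅ := by
        rw [Finset.filter_eq_empty_iff]
        rintro y hy ⟨hyu, l, hl, hyl, hm⟩
        have hlk : l = k := line_unique hyu (mem_linePts.1 hyl) (mem_pencil.1 hl)
          (mem_linePts.1 (hsub hy)) (mem_linePts.1 (hsub hu))
        subst hlk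
        rcases (hpair u).1 hu with rfl | rfl <;> rcases (hpair y).1 hy with rfl | rfl
        exacts [hyu rfl, hm hk3, hm hk3', hyu rfl]
      rw [hz, Finset.card_empty, add_zero]
      by_cases huB : u = B
      · refine Finset.card_le_card fun l hl => ?_
        have hlk := (hcase l hl).1
        subst hlk
        rw [Finset.mem_filter] at hl ⊢
        refine ⟨hl.1, ?_⟩
        rw [hk2, huB]
        simp [hB, Ne.symm hAB, Ne.symm hdAB.2]
      · rw [Finset.card_eq_zero.2]
        · exact Nat.zero_le _
        · rw [Finset.eq_empty_iff_forall_notMem]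
          exact fun l hl => huB (hcase l hl).2)
    (m := Fintype.card P + 2 * h) (by simp)
  refine le_trans ?_ key
  have hL := ProjectivePlane.card_lines P L
  have hP := ProjectivePlane.card_points P L
  have hkc : ∀ l, (pat l).kill.card = (if l = k then 2 else 0) + if sp l then 1 else 0 := by
    intro l
    by_cases hlk : l = k
    · subst hlk
      rw [hk1, Finset.card_pair (Ne.symm hdAB.1)]
      simp [sp]
    · by_cases hs : sp l
      · rw [(hps l hs).2.1]
        simp [hlk, hs]
      · rw [(hpt l hlk hs).1]
        simp [hlk, hs]
  have hkle : ∀ l, (pat l).kill.card ≤ 2 * h + 1 := fun l => by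
    rw [hkc]
    split_ifs <;> omega
  have hspc : (Finset.univ.filter sp).card = 2 * (2 * h) := by
    rw [← hord, ← card_pencil_union_erase hAB hA hB]
    congr 1
    ext l
    simp [sp]
  have htot : ∑ l, (2 * h + 1 - (pat l).kill.card) + ∑ l, (pat l).kill.card =
      Fintype.card L * (2 * h + 1) := by
    rw [← Finset.sum_add_distrib, Finset.sum_congr rfl (g := fun _ => 2 * h + 1)
      (fun l _ => by have := hkle l; omega)]
    simp
  have hkt : ∑ l, (pat l).kill.card = 2 + 2 * (2 * h) := by
    simp only [hkc]
    rw [Finset.sum_add_distrib, ← Finset.card_filter, hspc]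
    simp
  rw [hord, hK]
  rw [hkt, hL, hord] at htot
  rw [hP, hord]
  nlinarith

end

/-! ### The case 1 ≤ a ≤ q/2: the reserved frame -/

section

open Configuration

variable {P L : Type*} [Membership P L] [ProjectivePlane P L] [Fintype P] [Fintype L]

open scoped Classical in
theorem card_filter_pencil_meets {u : P} {k : L} (hu : u ∉ k) {B : Finset P}
    (hB : ∀ b ∈ B, b ∈ k) :
    ((pencil L u).filter fun l => ∃ b ∈ B, b ∈ l).card = B.card := by
  rw [Finset.card_filter, sum_pencil_ite hu (B := B) (α := 1) (β := 0)
    (fun b hb => mem_linePts.2 (hB b hb))]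
  · simp
  · intro l p hul hpl hpk
    refine if_congr ⟨?_, fun h => ⟨p, h, hpl⟩⟩ rfl rfl
    rintro ⟨b, hb, hbl⟩
    rwa [point_unique (l := l) (l' := k) (fun h => hu (h ▸ hul)) hpl hbl hpk (hB b hb)]

open scoped Classical in
theorem card_filter_linePts_meets {p : P} {l : L} (hp : p ∉ l) {B : Finset L}
    (hB : ∀ b ∈ B, p ∈ b) :
    ((linePts l).filter fun x => ∃ b ∈ B, x ∈ b).card = B.card := by
  rw [Finset.card_filter, ← sum_pencil_eq (u := p) (k := l) (f := fun b => if b ∈ B then 1 else 0)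
    hp]
  · rw [Finset.sum_ite_mem, Finset.inter_eq_right.2 fun b hb => mem_pencil.2 (hB b hb)]
    simp
  · intro b x hpb hxb hxl
    refine if_congr ⟨fun h => ⟨b, h, hxb⟩, ?_⟩ rfl rfl
    rintro ⟨b', hb', hxb'⟩
    rwa [line_unique (x := p) (y := x) (fun h => hp (h ▸ hxl)) hpb hxb (hB b' hb') hxb']

open scoped Classical in
theorem card_filter_linePts_avoids {p : P} {l : L} (hp : p ∉ l) {B : Finset L}
    (hB : ∀ b ∈ B, p ∈ b) :
    ((linePts l).filter fun x => ∀ b ∈ B, x ∉ b).card + B.card =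
      ProjectivePlane.order P L + 1 := by
  have h := Finset.card_filter_add_card_filter_not (s := (linePts l : Finset P))
    (fun x => ∃ b ∈ B, x ∈ b)
  rw [card_filter_linePts_meets hp hB, card_linePts] at h
  push Not at h
  omega

end

/-- `a + 1` reserved points `S` on the line `base`, among them `origin`, and a reserved point `apex`
off it, with `a - 1` marked points on the line `axis` through `origin` and `apex`, and `a - 1`
marked lines through `origin`. -/
structure ReservedFrame (P L : Type*) [Membership P L] (a : ℕ) where
  base : L
  axis : L
  apex : P
  origin : P
  S : Finset P
  O : Finset P
  D : Finset L
  apex_notMem : apex ∉ base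
  S_mem : ∀ x ∈ S, x ∈ base
  card_S : S.card = a + 1
  origin_mem_S : origin ∈ S
  apex_mem : apex ∈ axis
  origin_mem : origin ∈ axis
  O_mem : ∀ o ∈ O, o ∈ axis ∧ o ≠ apex ∧ o ≠ origin
  card_O : O.card = a - 1
  D_mem : ∀ d ∈ D, origin ∈ d ∧ d ≠ base ∧ d ≠ axis
  card_D : D.card = a - 1

open Configuration in
-- The number a - 1 of marked points and of marked lines is what a reserved point of the base line
-- may lack there in completing edges: the origin makes this up on the lines in D, the others on
-- their lines to O.
theorem exists_reservedFrame (P L : Type*) [Membership P L] [ProjectivePlane P L] [Fintype P]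
    [Fintype L] {a : ℕ} (ha : a ≤ ProjectivePlane.order P L) :
    Nonempty (ReservedFrame P L a) := by
  classical
  obtain ⟨A, -, l, -, hA, -⟩ := exists_two_points P L
  obtain ⟨Z, hZ⟩ := Nondegenerate.exists_point (P := P) l
  obtain ⟨k, hAk, hZk⟩ := exists_joining_line (L := L) A Z
  have hAZ : A ≠ Z := fun h => hZ (h ▸ hA)
  have hlk : l ≠ k := fun h => hZ (h ▸ hZk)
  obtain ⟨S, hAS, hSl, hS⟩ := Finset.exists_subsuperset_card_eq (s := {A}) (t := linePts l)
    (n := a + 1) (by simpa using hA) (by simp) (by rw [card_linePts]; omega)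
  obtain ⟨O, hO, hOc⟩ := Finset.exists_subset_card_eq (s := (linePts k : Finset P) \ {A, Z})
    (n := a - 1) (by
      rw [Finset.card_sdiff_of_subset (by intro x; simp; rintro (rfl | rfl) <;> assumption),
        card_linePts, Finset.card_pair hAZ]
      omega)
  obtain ⟨D, hD, hDc⟩ := Finset.exists_subset_card_eq (s := pencil L A \ {l, k})
    (n := a - 1) (by
      rw [Finset.card_sdiff_of_subset (by intro x; simp; rintro (rfl | rfl) <;> assumption),
        card_pencil, Finset.card_pair hlk]
      omega)
  refine ⟨⟨l, k, Z, A, S, O, D, hZ, fun x hx => mem_linePts.1 (hSl hx), hS, hAS (by simp), hZk,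
    hAk, fun o ho => ?_, hOc, fun d hd => ?_, hDc⟩⟩
  · have := hO ho
    simp only [Finset.mem_sdiff, mem_linePts, Finset.mem_insert, Finset.mem_singleton,
      not_or] at this
    exact ⟨this.1, this.2.2, this.2.1⟩
  · have := hD hd
    simp only [Finset.mem_sdiff, mem_pencil, Finset.mem_insert, Finset.mem_singleton,
      not_or] at this
    exact this

namespace ReservedFrame

open Configuration

section

variable {P L : Type*} [Membership P L] {a : ℕ} (F : ReservedFrame P L a)

/-- The line `l` contains a reserved point other than the apex. -/
def MeetsS (l : L) : Prop := ∃ x ∈ F.S, x ∈ l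

/-- The line `l` contains a reserved point other than the apex and the origin. -/
def MeetsS' (l : L) : Prop := ∃ x ∈ F.S, x ≠ F.origin ∧ x ∈ l

/-- The line `l` contains a marked point. -/
def MeetsO (l : L) : Prop := ∃ x ∈ F.O, x ∈ l

/-- Lines that miss the apex, on which two near-1-factors will be released. -/
def IsDouble (l : L) : Prop := l ∈ F.D ∨ F.MeetsS' l ∧ F.MeetsO l

/-- The other lines through a reserved point of the base line different from the origin. -/
def IsSide (l : L) : Prop := l ≠ F.base ∧ F.apex ∉ l ∧ F.MeetsS' l ∧ ¬ F.MeetsO l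

/-- The other lines through the origin. -/
def IsCentral (l : L) : Prop := l ≠ F.base ∧ F.apex ∉ l ∧ F.origin ∈ l ∧ l ∉ F.D

/-- The lines through a marked point that contain no reserved point. -/
def IsMarked (l : L) : Prop := ¬ F.MeetsS l ∧ F.MeetsO l

/-- Points on none of the `a + 1` distinguished lines through the origin. -/
def Free (u : P) : Prop := u ∉ F.base ∧ u ∉ F.axis ∧ ∀ d ∈ F.D, u ∉ d

/-- Points seen from the apex in the direction of a reserved point. -/
def Shaded (u : P) : Prop := ∃ l : L, F.apex ∈ l ∧ F.MeetsS l ∧ u ∈ l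

/-- The line `l` certainly helps the point `u`. -/
def Helps (l : L) (u : P) : Prop :=
  l = F.base ∨ F.apex ∈ l ∨ F.IsDouble l ∨ F.IsSide l ∧ u ∈ F.axis ∨
    F.IsCentral l ∧ F.Shaded u ∨ F.IsMarked l ∧ (u ∈ F.base ∨ ∃ d ∈ F.D, u ∈ d)

open scoped Classical in
/-- An upper bound for the number of near-1-factors released on `l`. -/
noncomputable def killBound (l : L) : ℕ :=
  (if l = F.base then 2 else 0) + (if F.apex ∈ l then 2 else 0) +
    (if F.apex ∉ l ∧ l ≠ F.base ∧ F.MeetsS l then 1 else 0) + (if l ∈ F.D then 1 else 0) +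
    if F.MeetsO l ∧ F.origin ∉ l then 1 else 0

open scoped Classical in
/-- The number of free points on `l` that can be helped on request. -/
noncomputable def quota (h : ℕ) (l : L) : ℕ :=
  -- A single kill serves h points, some of which are bound: on a side line the point of the axis,
  -- on a marked line the a - 1 points on lines of D, on a central line the a shaded points other
  -- than the origin. A line through the apex missing S kills two and can help one point a second
  -- time.
  if F.IsSide l then h - 1 else if F.IsMarked l then h + 1 - a else if F.IsCentral l then h - a
  else if F.apex ∈ l ∧ ¬ F.MeetsS l then 1 else 0

theorem origin_base : F.origin ∈ F.base := F.S_mem _ F.origin_mem_S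

theorem axis_ne : F.axis ≠ F.base := fun h => F.apex_notMem (h ▸ F.apex_mem)

theorem apex_ne_origin : F.apex ≠ F.origin := fun h => F.apex_notMem (h ▸ F.origin_base)

theorem apex_notMem_S : F.apex ∉ F.S := fun h => F.apex_notMem (F.S_mem _ h)

variable {F}

theorem MeetsS'.meetsS {l : L} (h : F.MeetsS' l) : F.MeetsS l :=
  let ⟨x, hx, _, hxl⟩ := h
  ⟨x, hx, hxl⟩

theorem meetsS_of_origin {l : L} (h : F.origin ∈ l) : F.MeetsS l := ⟨_, F.origin_mem_S, h⟩

theorem MeetsS.resolve {l : L} (h : F.MeetsS l) (ho : F.origin ∉ l) : F.MeetsS' l :=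
  let ⟨x, hx, hxl⟩ := h
  ⟨x, hx, fun h => ho (h ▸ hxl), hxl⟩

theorem Free.ne_apex {u : P} (h : F.Free u) : u ≠ F.apex := fun he => h.2.1 (he ▸ F.apex_mem)

theorem Free.helps {u : P} {l : L} (hul : u ∈ l) (h : F.Free u) (hs : F.origin ∈ l → ¬ F.Shaded u)
    (hh : F.Helps l u) : F.apex ∈ l ∨ F.IsDouble l := by
  rcases hh with rfl | h1 | h1 | ⟨-, h1⟩ | ⟨h1, h2⟩ | ⟨-, h1 | ⟨d, hd, h1⟩⟩
  · exact absurd hul h.1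
  · exact Or.inl h1
  · exact Or.inr h1
  · exact absurd h1 h.2.1
  · exact absurd h2 (hs h1.2.2.1)
  · exact absurd h1 h.1
  · exact absurd h1 (h.2.2 d hd)

theorem IsDouble.meetsS {l : L} (h : F.IsDouble l) : F.MeetsS l :=
  h.elim (fun h => meetsS_of_origin (F.D_mem _ h).1) fun h => h.1.meetsS

theorem IsMarked.not_isSide {l : L} (h : F.IsMarked l) : ¬ F.IsSide l :=
  fun h' => h.1 h'.2.2.1.meetsS

theorem IsMarked.not_isCentral {l : L} (h : F.IsMarked l) : ¬ F.IsCentral l :=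
  fun h' => h.1 (meetsS_of_origin h'.2.2.1)

theorem IsMarked.origin_notMem {l : L} (h : F.IsMarked l) : F.origin ∉ l :=
  fun h' => h.1 (meetsS_of_origin h')

/-- The lines that do not pass through the apex, and are not the base line. -/
theorem line_cases {l : L} (h1 : l ≠ F.base) (h2 : F.apex ∉ l) :
    F.IsDouble l ∨ F.IsSide l ∨ F.IsCentral l ∨ F.IsMarked l ∨ ¬ F.MeetsS l ∧ ¬ F.MeetsO l := by
  by_cases hS : F.MeetsS l
  · by_cases ho : F.origin ∈ l
    · by_cases hD : l ∈ F.D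
      · exact Or.inl (Or.inl hD)
      · exact Or.inr (Or.inr (Or.inl ⟨h1, h2, ho, hD⟩))
    · by_cases hO : F.MeetsO l
      · exact Or.inl (Or.inr ⟨hS.resolve ho, hO⟩)
      · exact Or.inr (Or.inl ⟨h1, h2, hS.resolve ho, hO⟩)
  · by_cases hO : F.MeetsO l
    · exact Or.inr (Or.inr (Or.inr (Or.inl ⟨hS, hO⟩)))
    · exact Or.inr (Or.inr (Or.inr (Or.inr ⟨hS, hO⟩)))

theorem IsDouble.not_isMarked {l : L} (h : F.IsDouble l) : ¬ F.IsMarked l := fun h' => h'.1 h.meetsS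

end

section

variable {P L : Type*} [Membership P L] [ProjectivePlane P L] {a : ℕ} {F : ReservedFrame P L a}

theorem eq_axis {l : L} (h1 : F.apex ∈ l) (h2 : F.origin ∈ l) : l = F.axis :=
  line_unique F.apex_ne_origin h1 h2 F.apex_mem F.origin_mem

theorem eq_origin {x : P} (h1 : x ∈ F.base) (h2 : x ∈ F.axis) : x = F.origin :=
  point_unique F.axis_ne h2 F.origin_mem h1 F.origin_base

theorem notMem_axis {x : P} (hx : x ∈ F.S) (hx' : x ≠ F.origin) : x ∉ F.axis :=
  fun h => hx' (eq_origin (F.S_mem _ hx) h)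

theorem eq_of_mem_base {l : L} (hl : l ≠ F.base) {x y : P} (hx : x ∈ F.base) (hy : y ∈ F.base)
    (hxl : x ∈ l) (hyl : y ∈ l) : x = y :=
  point_unique hl hxl hyl hx hy

theorem MeetsS'.origin_notMem {l : L} (hl : l ≠ F.base) (h : F.MeetsS' l) : F.origin ∉ l := by
  obtain ⟨x, hx, hne, hxl⟩ := h
  exact fun ho => hne (eq_of_mem_base hl (F.S_mem _ hx) F.origin_base hxl ho)

theorem MeetsO.ne_base {l : L} (h : F.MeetsO l) : l ≠ F.base := by
  rintro rfl
  obtain ⟨o, ho, hol⟩ := h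
  exact (F.O_mem o ho).2.2 (eq_origin hol (F.O_mem o ho).1)

theorem MeetsO.eq_axis_of_origin {l : L} (h : F.MeetsO l) (ho : F.origin ∈ l) : l = F.axis := by
  obtain ⟨o, ho', hol⟩ := h
  exact line_unique (F.O_mem o ho').2.2 hol ho (F.O_mem o ho').1 F.origin_mem

theorem MeetsO.eq_axis_of_apex {l : L} (h : F.MeetsO l) (ho : F.apex ∈ l) : l = F.axis := by
  obtain ⟨o, ho', hol⟩ := h
  exact line_unique (F.O_mem o ho').2.1 hol ho (F.O_mem o ho').1 F.apex_mem

theorem IsDouble.ne_base {l : L} (h : F.IsDouble l) : l ≠ F.base :=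
  h.elim (fun h => (F.D_mem _ h).2.1) fun h => h.2.ne_base

theorem IsDouble.apex_notMem {l : L} (h : F.IsDouble l) : F.apex ∉ l := by
  intro hl
  rcases h with h | ⟨h1, h2⟩
  · exact (F.D_mem _ h).2.2 (eq_axis hl (F.D_mem _ h).1)
  · have := h2.eq_axis_of_apex hl
    subst this
    exact h1.origin_notMem F.axis_ne F.origin_mem

theorem IsDouble.not_isSide {l : L} (h : F.IsDouble l) : ¬ F.IsSide l := by
  rintro ⟨h1, -, h2, h3⟩
  exact h.elim (fun h => h2.origin_notMem h1 (F.D_mem _ h).1) fun h => h3 h.2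

theorem IsDouble.not_isCentral {l : L} (h : F.IsDouble l) : ¬ F.IsCentral l := by
  rintro ⟨h1, -, h2, h3⟩
  exact h.elim h3 fun h => h.1.origin_notMem h1 h2

theorem IsSide.not_isCentral {l : L} (h : F.IsSide l) : ¬ F.IsCentral l :=
  fun h' => h.2.2.1.origin_notMem h.1 h'.2.2.1

theorem IsMarked.ne_base {l : L} (h : F.IsMarked l) : l ≠ F.base := h.2.ne_base

theorem IsMarked.apex_notMem {l : L} (h : F.IsMarked l) : F.apex ∉ l := by
  intro hl
  have := h.2.eq_axis_of_apex hl
  subst this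
  exact h.origin_notMem F.origin_mem

end

end ReservedFrame

/-! ### Patterns suited to the frame -/

namespace ReservedFrame

open Configuration

section

variable {P L : Type*} [Membership P L] [ProjectivePlane P L] [Fintype P] [Fintype L]
  {a : ℕ} {F : ReservedFrame P L a}

open scoped Classical in
theorem card_meetsS {u : P} (hu : u ∉ F.base) :
    ((pencil L u).filter F.MeetsS).card = a + 1 := by
  rw [← F.card_S, ← card_filter_pencil_meets hu F.S_mem]
  congr 1
  ext
  simp [MeetsS]

open scoped Classical in
theorem card_meetsS' {u : P} (hu : u ∉ F.base) :
    ((pencil L u).filter F.MeetsS').card = a := by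
  have h : (F.S.erase F.origin).card = a := by
    rw [Finset.card_erase_of_mem F.origin_mem_S, F.card_S, Nat.add_sub_cancel]
  rw [← card_filter_pencil_meets hu fun x hx => F.S_mem x (Finset.mem_of_mem_erase hx)] at h
  refine Eq.trans ?_ h
  congr 1
  ext
  simp [MeetsS', and_assoc, and_left_comm]

open scoped Classical in
theorem card_meetsO {u : P} (hu : u ∉ F.axis) :
    ((pencil L u).filter F.MeetsO).card = a - 1 := by
  rw [← F.card_O, ← card_filter_pencil_meets hu fun x hx => (F.O_mem x hx).1]
  congr 1
  ext
  simp [MeetsO]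

open scoped Classical in
theorem card_shaded {l : L} (hl : F.apex ∉ l) :
    ((linePts l).filter F.Shaded).card = a + 1 := by
  rw [← card_meetsS F.apex_notMem, ← card_filter_linePts_meets hl fun b hb =>
    mem_pencil.1 (Finset.mem_filter.1 hb).1]
  congr 1
  ext
  simp [Shaded, and_assoc]

open scoped Classical in
theorem card_not_shaded {l : L} (hl : F.apex ∉ l) :
    ((linePts l).filter fun u => ¬ F.Shaded u).card + (a + 1) = ProjectivePlane.order P L + 1 := by
  rw [← card_shaded hl, add_comm, Finset.card_filter_add_card_filter_not, card_linePts]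

open scoped Classical in
-- The base line, the axis and the lines in D are a + 1 lines through the origin, and each takes
-- away a different point of l.
theorem card_free (ha : 1 ≤ a) {l : L} (hl : F.origin ∉ l) :
    ((linePts l).filter F.Free).card + (a + 1) = ProjectivePlane.order P L + 1 := by
  have hc : (insert F.base (insert F.axis F.D)).card = a + 1 := by
    rw [Finset.card_insert_of_notMem, Finset.card_insert_of_notMem, F.card_D]
    · omega
    · exact fun h => (F.D_mem _ h).2.2 rfl
    · rw [Finset.mem_insert, not_or]
      exact ⟨Ne.symm F.axis_ne, fun h => (F.D_mem _ h).2.1 rfl⟩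
  rw [← card_filter_linePts_avoids hl (B := insert F.base (insert F.axis F.D)), hc]
  · congr 2
    ext
    simp [Free]
  · intro b hb
    rcases Finset.mem_insert.1 hb with rfl | hb
    · exact F.origin_base
    rcases Finset.mem_insert.1 hb with rfl | hb
    · exact F.origin_mem
    · exact (F.D_mem b hb).1

end

variable {P L : Type*} [Membership P L] [ProjectivePlane P L] [Fintype P] [DecidableEq P]
  {a : ℕ} {F : ReservedFrame P L a}

open scoped Classical in
/-- The pattern `p` on `l` is suited to the frame and helps the points of `T`. -/
structure Suits (F : ReservedFrame P L a) (l : L) (T : Finset P)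
    (p : LinePattern (linePts l : Finset P)) : Prop where
  kill_le : p.kill.card ≤ F.killBound l
  next_notMem : ∀ u ∈ p.served, ¬ (u ∈ insert F.apex F.S ∧ p.next u ∈ insert F.apex F.S)
  helps : ∀ u ∈ l, u ∉ insert F.apex F.S → (if u ∈ T then 1 else 0) +
    (if F.Helps l u then 1 else 0) ≤ (if u ∈ p.kill then 1 else 0) + if u ∈ p.served then 1 else 0
  marked : F.IsMarked l → ∀ u ∈ l, u ∈ F.base → u ∈ p.kill
  apex : F.apex ∈ l → F.apex ∈ p.kill ∧ ∀ x ∈ F.S, x ∈ l →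
    p.mid F.apex x ∈ p.kill ∧ p.mid x F.apex ∈ p.kill ∧ x ∈ p.served
  kill_S : ∀ x ∈ F.S, x ∈ l → l ≠ F.base → F.apex ∉ l → x ∈ p.kill
  served_S : F.IsDouble l → ∀ x ∈ F.S, x ∈ l → x ∈ p.served
  base : l = F.base → ∀ u ∈ F.S,
    (F.S.filter fun y => y ≠ u ∧ p.mid u y ∉ p.kill).card + (if u ∈ p.kill then 0 else 1) ≤
      a - 1 + if u ∈ p.served then 1 else 0

theorem exists_suits_base {h : ℕ} (hh : 0 < h) (hc : (linePts F.base : Finset P).card = 2 * h + 1)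
    (ha : 1 ≤ a) (hah : a < 2 * h) : ∃ p, F.Suits F.base ∅ p := by
  obtain ⟨p, h1, h2, h3, h4⟩ := exists_pattern_base hh hc (S := F.S)
    (fun x hx => mem_linePts.2 (F.S_mem x hx)) ha F.card_S hah
  have hin : ∀ x, x ∈ F.base → x ∈ insert F.apex F.S → x ∈ F.S := fun x hx hx' =>
    (Finset.mem_insert.1 hx').resolve_left fun h => F.apex_notMem (h ▸ hx)
  refine ⟨p, ?_, ?_, ?_, fun h => absurd rfl h.ne_base, fun h => absurd h F.apex_notMem,
    fun x _ _ h => absurd rfl h, fun h => absurd rfl h.ne_base, fun _ => h2⟩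
  · simp only [killBound, h1, if_true]
    omega
  · rintro u hu ⟨h5, h6⟩
    exact h4 u hu ⟨hin _ (mem_linePts.1 (p.served_subset hu)) h5,
      hin _ (mem_linePts.1 (p.next_mem hu)) h6⟩
  · intro u hu huS
    have : F.Helps F.base u := Or.inl rfl
    rcases h3 u (mem_linePts.2 hu) fun h => huS (Finset.mem_insert_of_mem h) with h | h <;>
      simp [this, h]

/-- The line joins the apex to one reserved point x. `exists_pattern_reserved` releases their pair
without allotting it, kills the apex and serves x, so neither is left with a demand here. -/
theorem exists_suits_apex_meetsS {h : ℕ} (hh : 1 < h) {l : L}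
    (hc : (linePts l : Finset P).card = 2 * h + 1)
    (hl : F.apex ∈ l) (hS : F.MeetsS l) : ∃ p, F.Suits l ∅ p := by
  obtain ⟨x, hxS, hxl⟩ := hS
  have hne : F.apex ≠ x := fun h => F.apex_notMem_S (h ▸ hxS)
  have hlb : l ≠ F.base := fun h => F.apex_notMem (h ▸ hl)
  have hx : ∀ y ∈ F.S, y ∈ l → y = x := fun y hy hyl =>
    eq_of_mem_base hlb (F.S_mem _ hy) (F.S_mem _ hxS) hyl hxl
  obtain ⟨d, hd, hd'⟩ : ∃ d ∈ linePts l, d ∉ ({F.apex, x} : Finset P) :=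
    Finset.exists_mem_notMem_of_card_lt_card (by rw [hc, Finset.card_pair hne]; omega)
  simp only [Finset.mem_insert, Finset.mem_singleton, not_or] at hd'
  obtain ⟨p, h1, h2, h3, h4⟩ := exists_pattern_reserved (by omega) hc (mem_linePts.2 hl)
    (mem_linePts.2 hxl) hd hne (Ne.symm hd'.1) (Ne.symm hd'.2)
  refine ⟨p, ?_, ?_, ?_, fun h => absurd hl h.apex_notMem, fun _ => ⟨by simp [h1], ?_⟩,
    fun x _ _ _ h => absurd hl h, fun h => absurd hl h.apex_notMem, fun h => absurd h hlb⟩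
  · rw [h1, Finset.card_pair (Ne.symm hd'.1)]
    simp only [killBound, hl, if_true]
    omega
  · rintro u hu ⟨h5, h6⟩
    have hul := mem_linePts.1 (p.served_subset hu)
    have hne := p.next_ne hu
    have hua : u ≠ F.apex := by
      rintro rfl
      rw [h2] at hu
      simp at hu
    have hux : u = x := hx _ ((Finset.mem_insert.1 h5).resolve_left hua) hul
    rcases Finset.mem_insert.1 h6 with h | h
    · exact h4 u hu ⟨hux, h⟩
    · exact hne ((hx _ h (mem_linePts.1 (p.next_mem hu))).trans hux.symm)
  · intro u hu huS
    have : F.Helps l u := Or.inr (Or.inl hl)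
    have hua : u ≠ F.apex := fun h => huS (by simp [h])
    rw [h1, h2, if_pos this]
    by_cases hud : u = d
    · simp [hud]
    · simp [hud, hua, hu]
  · intro y hyS hyl
    obtain rfl := hx y hyS hyl
    refine ⟨h3, ?_, ?_⟩
    · rwa [p.mid_comm (mem_linePts.2 hyl) (mem_linePts.2 hl)]
    · rw [h2]
      simp [Ne.symm hd'.2, Ne.symm hne, hyl]

theorem exists_suits_apex_not_meetsS {h : ℕ} (hh : 0 < h) {l : L}
    (hc : (linePts l : Finset P).card = 2 * h + 1)
    (hl : F.apex ∈ l) (hS : ¬ F.MeetsS l) {T : Finset P} (hT : ∀ u ∈ T, u ∈ l ∧ F.Free u)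
    (hTc : T.card ≤ 1) : ∃ p, F.Suits l T p := by
  have hlb : l ≠ F.base := fun h => F.apex_notMem (h ▸ hl)
  obtain ⟨p, h1, h2, h3, h4⟩ := exists_pattern_double_catch hh hc (mem_linePts.2 hl)
    (fun u hu => mem_linePts.2 (hT u hu).1) (fun h => (hT _ h).2.ne_apex rfl) hTc
  refine ⟨p, ?_, ?_, ?_, fun h => absurd hl h.apex_notMem, fun _ => ⟨h2, ?_⟩,
    fun x _ _ _ h => absurd hl h, fun h => absurd hl h.apex_notMem, fun h => absurd h hlb⟩
  · rw [h1]
    simp only [killBound, hl, if_true]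
    omega
  · rintro u hu ⟨h5, -⟩
    have hul := mem_linePts.1 (p.served_subset hu)
    rcases Finset.mem_insert.1 h5 with rfl | h
    · rw [h4] at hu
      simp at hu
    · exact hS ⟨u, h, hul⟩
  · intro u hu huS
    have : F.Helps l u := Or.inr (Or.inl hl)
    have hua : u ≠ F.apex := fun h => huS (by simp [h])
    rw [h4, if_pos this, if_pos (show u ∈ (linePts l).erase F.apex by simp [hua, hu])]
    by_cases huT : u ∈ T
    · rw [if_pos huT, if_pos (h3 huT)]
    · simp [huT]
  · exact fun x hx hxl => absurd ⟨x, hx, hxl⟩ hS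

theorem next_notMem_of_notMem_apex {l : L} (hlb : l ≠ F.base) (hl : F.apex ∉ l)
    (p : LinePattern (linePts l : Finset P)) :
    ∀ u ∈ p.served, ¬ (u ∈ insert F.apex F.S ∧ p.next u ∈ insert F.apex F.S) := by
  rintro u hu ⟨h5, h6⟩
  have hul := mem_linePts.1 (p.served_subset hu)
  have hnl := mem_linePts.1 (p.next_mem hu)
  have hin : ∀ x, x ∈ l → x ∈ insert F.apex F.S → x ∈ F.base := fun x hx hx' =>
    F.S_mem _ ((Finset.mem_insert.1 hx').resolve_left fun h => hl (h ▸ hx))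
  exact p.next_ne hu (eq_of_mem_base hlb (hin _ hnl h6) (hin _ hul h5) hnl hul)

/-- The path starts at the reserved point x, which is thus killed and served: the surplus edge makes
up for one missing on the base line. -/
theorem exists_suits_double {h : ℕ} (hh : 0 < h) {l : L}
    (hc : (linePts l : Finset P).card = 2 * h + 1) (hD : F.IsDouble l) : ∃ p, F.Suits l ∅ p := by
  have hlb := hD.ne_base
  have hl := hD.apex_notMem
  obtain ⟨x, hxS, hxl⟩ := hD.meetsS
  have hx : ∀ y ∈ F.S, y ∈ l → y = x := fun y hy hyl =>
    eq_of_mem_base hlb (F.S_mem _ hy) (F.S_mem _ hxS) hyl hxl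
  obtain ⟨d, hd, hdx⟩ : ∃ d ∈ linePts l, d ≠ x :=
    Finset.exists_mem_ne (by omega) x
  obtain ⟨p, h1, h2⟩ := exists_pattern_double hh hc (mem_linePts.2 hxl) hd hdx.symm
  refine ⟨p, ?_, next_notMem_of_notMem_apex hlb hl p, ?_, fun h => absurd h hD.not_isMarked,
    fun h => absurd h hl, ?_, ?_, fun h => absurd h hlb⟩
  · rw [h1, Finset.card_pair hdx.symm]
    have hk : F.apex ∉ l ∧ l ≠ F.base ∧ F.MeetsS l := ⟨hl, hlb, hD.meetsS⟩
    rw [killBound, if_pos hk]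
    rcases hD with h | ⟨h, h'⟩
    · rw [if_pos h]
      omega
    · rw [if_pos (show F.MeetsO l ∧ F.origin ∉ l from ⟨h', h.origin_notMem hlb⟩)]
      omega
  · intro u hu _
    rw [h1, h2]
    have : F.Helps l u := Or.inr (Or.inr (Or.inl hD))
    rw [if_pos this]
    by_cases hud : u = d
    · simp [hud]
    · simp [hud, hu]
  · intro y hy hyl _ _
    simp [h1, hx y hy hyl]
  · intro _ y hy hyl
    rw [h2, hx y hy hyl]
    simp [hdx.symm, hxl]

/-- The common pattern of side, central and marked lines: the near-1-factor missing the point x on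
the base line is killed, and its h edges serve both the points U that are always helped and the
requested points T. -/
theorem exists_suits_single {h : ℕ} (hh : 0 < h) {l : L}
    (hc : (linePts l : Finset P).card = 2 * h + 1) (hlb : l ≠ F.base) (hl : F.apex ∉ l)
    (hD : ¬ F.IsDouble l) {x : P} (hxl : x ∈ l) (hxb : x ∈ F.base)
    (hk : F.MeetsS l ∨ F.IsMarked l) {T U : Finset P}
    (hT : ∀ u ∈ T, u ∈ l ∧ F.Free u ∧ (F.origin ∈ l → ¬ F.Shaded u)) (hU : ∀ u ∈ U, u ∈ l)
    (hxU : x ∉ U) (hTU : T.card + U.card ≤ h) (hHU : ∀ u ∈ l, F.Helps l u → u = x ∨ u ∈ U) :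
    ∃ p, F.Suits l T p := by
  obtain ⟨p, h1, h2⟩ := exists_pattern_single hh hc (mem_linePts.2 hxl) (T := T ∪ U)
    (fun u hu => mem_linePts.2 ((Finset.mem_union.1 hu).elim (fun h => (hT u h).1) (hU u)))
    (fun h => (Finset.mem_union.1 h).elim (fun h => (hT _ h).2.1.1 hxb) hxU)
    ((Finset.card_union_le _ _).trans hTU)
  have hx : ∀ y ∈ F.base, y ∈ l → y = x := fun y hy hyl =>
    eq_of_mem_base hlb hy hxb hyl hxl
  refine ⟨p, ?_, next_notMem_of_notMem_apex hlb hl p, ?_, ?_,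
    fun h => absurd h hl, ?_, fun h => absurd h hD, fun h => absurd h hlb⟩
  · rw [h1, Finset.card_singleton]
    rcases hk with h | h
    · rw [killBound, if_pos (show F.apex ∉ l ∧ l ≠ F.base ∧ F.MeetsS l from ⟨hl, hlb, h⟩)]
      omega
    · rw [killBound, if_pos (show F.MeetsO l ∧ F.origin ∉ l from ⟨h.2, h.origin_notMem⟩)]
      omega
  · intro u hu _
    by_cases huT : u ∈ T
    · have hh : ¬ F.Helps l u := fun hh =>
        ((hT u huT).2.1.helps hu (hT u huT).2.2 hh).elim hl hD
      simp [huT, hh, h2 (Finset.mem_union_left U huT)]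
    · by_cases hh : F.Helps l u
      · rcases hHU u hu hh with rfl | h
        · simp [huT, hh, h1]
        · simp [huT, hh, h2 (Finset.mem_union_right T h)]
      · simp [huT, hh]
  · intro _ u hu hub
    simp [h1, hx u hub hu]
  · intro y hy hyl _ _
    simp [h1, hx y (F.S_mem _ hy) hyl]

theorem exists_suits [Fintype L] {h : ℕ} (hh : 1 < h) (hord : ProjectivePlane.order P L = 2 * h) (ha : 1 ≤ a)
    (hah : a ≤ h) (l : L) {T : Finset P}
    (hT : ∀ u ∈ T, u ∈ l ∧ F.Free u ∧ (F.origin ∈ l → ¬ F.Shaded u))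
    (hTc : T.card ≤ F.quota h l) : ∃ p, F.Suits l T p := by
  classical
  have hc : (linePts l : Finset P).card = 2 * h + 1 := by rw [card_linePts, hord]
  have hT0 : F.quota h l = 0 → T = ∅ := fun h0 => by
    rw [h0] at hTc
    exact Finset.card_eq_zero.1 (Nat.le_zero.1 hTc)
  by_cases hlb : l = F.base
  · subst hlb
    rw [hT0]
    · exact exists_suits_base (by omega) hc ha (by omega)
    · have hm : ¬ F.IsMarked F.base := fun h => h.ne_base rfl
      simp [quota, IsSide, IsCentral, F.apex_notMem, hm]
  by_cases hl : F.apex ∈ l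
  · have h1 : ¬ F.IsSide l := fun h => h.2.1 hl
    have h2 : ¬ F.IsCentral l := fun h => h.2.1 hl
    have h3 : ¬ F.IsMarked l := fun h => h.apex_notMem hl
    by_cases hS : F.MeetsS l
    · rw [hT0]
      · exact exists_suits_apex_meetsS hh hc hl hS
      · simp [quota, h1, h2, h3, hS]
    · simp only [quota, h1, h2, h3, hl, hS, if_false, not_false_eq_true, and_self, if_true] at hTc
      exact exists_suits_apex_not_meetsS (by omega) hc hl hS (fun u hu => ⟨(hT u hu).1, (hT u hu).2.1⟩)
        hTc
  rcases line_cases hlb hl with h1 | h1 | h1 | h1 | h1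
  · rw [hT0]
    · exact exists_suits_double (by omega) hc h1
    · simp [quota, h1.not_isSide, h1.not_isCentral, h1.not_isMarked, hl]
  · obtain ⟨x, hxS, hx0, hxl⟩ := h1.2.2.1
    obtain ⟨y, hyl, hya⟩ := exists_common_point (P := P) l F.axis
    have hD : ¬ F.IsDouble l := fun h => h.not_isSide h1
    refine exists_suits_single (by omega) hc hlb hl hD hxl (F.S_mem _ hxS) (Or.inl h1.2.2.1.meetsS)
      (U := {y}) hT (by simpa using hyl) ?_ ?_ ?_
    · rw [Finset.mem_singleton]
      rintro rfl
      exact notMem_axis hxS hx0 hya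
    · rw [quota, if_pos h1] at hTc
      rw [Finset.card_singleton]
      omega
    · intro u hul hu
      right
      rw [Finset.mem_singleton]
      rcases hu with h | h | h | h | h | h
      · exact absurd h hlb
      · exact absurd h hl
      · exact absurd h hD
      · exact point_unique (l := l) (l' := F.axis) (fun h => hl (h ▸ F.apex_mem)) hul hyl h.2 hya
      · exact absurd h.1 h1.not_isCentral
      · exact absurd h1 h.1.not_isSide
  · have hD : ¬ F.IsDouble l := fun h => h.not_isCentral h1
    have ho : F.origin ∈ (linePts l).filter F.Shaded := Finset.mem_filter.2
      ⟨mem_linePts.2 h1.2.2.1, F.axis, F.apex_mem, meetsS_of_origin F.origin_mem, F.origin_mem⟩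
    refine exists_suits_single (by omega) hc hlb hl hD h1.2.2.1 F.origin_base
      (Or.inl (meetsS_of_origin h1.2.2.1)) (U := ((linePts l).filter F.Shaded).erase F.origin) hT ?_
        (by simp) ?_ ?_
    · intro u hu
      exact mem_linePts.1 (Finset.mem_filter.1 (Finset.mem_of_mem_erase hu)).1
    · rw [quota, if_neg fun h => h.not_isCentral h1, if_neg fun h => h.not_isCentral h1,
        if_pos h1] at hTc
      rw [Finset.card_erase_of_mem ho, card_shaded hl]
      omega
    · intro u hul hu
      rcases hu with h | h | h | h | h | h
      · exact absurd h hlb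
      · exact absurd h hl
      · exact absurd h hD
      · exact absurd h1 h.1.not_isCentral
      · by_cases huo : u = F.origin
        · exact Or.inl huo
        · exact Or.inr (Finset.mem_erase.2 ⟨huo, Finset.mem_filter.2 ⟨mem_linePts.2 hul, h.2⟩⟩)
      · exact absurd h1 h.1.not_isCentral
  · have hD : ¬ F.IsDouble l := fun h => h.not_isMarked h1
    have hB := card_filter_linePts_meets (B := F.D) h1.origin_notMem (fun d hd => (F.D_mem d hd).1)
    obtain ⟨x, hxl, hxb⟩ := exists_common_point (P := P) l F.base
    refine exists_suits_single (by omega) hc hlb hl hD hxl hxb (Or.inr h1)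
      (U := (linePts l).filter fun x => ∃ d ∈ F.D, x ∈ d) hT ?_ ?_ ?_ ?_
    · intro u hu
      exact mem_linePts.1 (Finset.mem_filter.1 hu).1
    · intro hx
      obtain ⟨d, hd, hxd⟩ := (Finset.mem_filter.1 hx).2
      have hd' := F.D_mem d hd
      have : x = F.origin := eq_of_mem_base hd'.2.1 hxb F.origin_base hxd hd'.1
      exact h1.origin_notMem (this ▸ hxl)
    · rw [quota, if_neg h1.not_isSide, if_pos h1] at hTc
      rw [hB, F.card_D]
      omega
    · intro u hul hu
      rcases hu with h | h | h | h | h | h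
      · exact absurd h hlb
      · exact absurd h hl
      · exact absurd h hD
      · exact absurd h.1 h1.not_isSide
      · exact absurd h.1 h1.not_isCentral
      · rcases h.2 with h | h
        · exact Or.inl (eq_of_mem_base hlb h hxb hul hxl)
        · exact Or.inr (Finset.mem_filter.2 ⟨mem_linePts.2 hul, h⟩)
  · rw [hT0]
    · obtain ⟨p, hp1, hp2⟩ := exists_pattern_trivial (by omega) hc
      refine ⟨p, by simp [hp1], by simp [hp2], ?_, fun h => absurd h.2 h1.2, fun h => absurd h hl,
        fun x hx hxl => absurd ⟨x, hx, hxl⟩ h1.1, fun h => absurd h.meetsS h1.1,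
        fun h => absurd h hlb⟩
      intro u hu huS
      have hh : ¬ F.Helps l u := by
        rintro (h | h | h | h | h | h)
        exacts [hlb h, hl h, h1.1 h.meetsS, h1.1 h.1.2.2.1.meetsS,
          h1.1 (meetsS_of_origin h.1.2.2.1), h1.2 h.1.2]
      simp [hh]
    · have h2 : ¬ F.IsSide l := fun h => h1.1 h.2.2.1.meetsS
      have h3 : ¬ F.IsCentral l := fun h => h1.1 (meetsS_of_origin h.2.2.1)
      have h4 : ¬ F.IsMarked l := fun h => h1.2 h.2
      simp [quota, h2, h3, h4, hl]

end ReservedFrame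

/-! ### Counting the help each point receives -/

namespace ReservedFrame

open Configuration

section

variable {P L : Type*} [Membership P L] {a : ℕ} {F : ReservedFrame P L a}

theorem ne_base_of_mem {u : P} {l : L} (hu : u ∉ F.base) (hul : u ∈ l) : l ≠ F.base :=
  fun h => hu (h ▸ hul)

theorem ne_axis_of_mem {u : P} {l : L} (hu : u ∉ F.axis) (hul : u ∈ l) : l ≠ F.axis :=
  fun h => hu (h ▸ hul)

end

section

variable {P L : Type*} [Membership P L] [ProjectivePlane P L] {a : ℕ} {F : ReservedFrame P L a}

theorem MeetsO.apex_notMem {u : P} {l : L} (h : F.MeetsO l) (hu : u ∉ F.axis) (hul : u ∈ l) :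
    F.apex ∉ l := fun h' => ne_axis_of_mem hu hul (h.eq_axis_of_apex h')

theorem MeetsO.origin_notMem {u : P} {l : L} (h : F.MeetsO l) (hu : u ∉ F.axis) (hul : u ∈ l) :
    F.origin ∉ l := fun h' => ne_axis_of_mem hu hul (h.eq_axis_of_origin h')

theorem MeetsO.isDouble_or_isMarked {u : P} {l : L} (h : F.MeetsO l) (hu : u ∉ F.axis)
    (hul : u ∈ l) : F.IsDouble l ∨ F.IsMarked l := by
  by_cases hS : F.MeetsS l
  · exact Or.inl (Or.inr ⟨hS.resolve (h.origin_notMem hu hul), h⟩)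
  · exact Or.inr ⟨hS, h⟩

theorem Free.exists_isCentral {u : P} (hu : F.Free u) : ∃ l : L, u ∈ l ∧ F.IsCentral l := by
  obtain ⟨l, h1, h2⟩ := exists_joining_line (L := L) u F.origin
  exact ⟨l, h1, ne_base_of_mem hu.1 h1, fun h => ne_axis_of_mem hu.2.1 h1 (eq_axis h h2), h2,
    fun h => hu.2.2 l h h1⟩

theorem exists_apex_of_not_shaded {u : P} (hs : ¬ F.Shaded u) :
    ∃ l : L, u ∈ l ∧ F.apex ∈ l ∧ ¬ F.MeetsS l := by
  obtain ⟨l, h1, h2⟩ := exists_joining_line (L := L) u F.apex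
  exact ⟨l, h1, h2, fun h => hs ⟨l, h2, h, h1⟩⟩

open scoped Classical in
theorem card_pencil_filter_mem [Fintype L] {x y : P} (hxy : x ≠ y) :
    ((pencil L x).filter fun l => y ∈ l).card = 1 := by
  obtain ⟨l, hx, hy⟩ := exists_joining_line (L := L) x y
  rw [Finset.card_eq_one]
  refine ⟨l, ?_⟩
  ext l'
  simp only [Finset.mem_filter, mem_pencil, Finset.mem_singleton]
  exact ⟨fun h => line_unique hxy h.1 h.2 hx hy, fun h => h ▸ ⟨hx, hy⟩⟩

open scoped Classical in
theorem Free.card_shaded [Fintype L] {u : P} (hu : F.Free u) :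
    ((pencil L u).filter fun l => F.apex ∈ l ∧ F.MeetsS' l).card = if F.Shaded u then 1 else 0 := by
  split_ifs with hs
  · obtain ⟨l, h1, h2, h3⟩ := hs
    rw [Finset.card_eq_one]
    refine ⟨l, ?_⟩
    ext l'
    simp only [Finset.mem_filter, mem_pencil, Finset.mem_singleton]
    constructor
    · rintro ⟨h4, h5, -⟩
      exact line_unique hu.ne_apex h4 h5 h3 h1
    · rintro rfl
      exact ⟨h3, h1, h2.resolve fun h => ne_axis_of_mem hu.2.1 h3 (eq_axis h1 h)⟩
  · rw [Finset.card_eq_zero, Finset.filter_eq_empty_iff]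
    rintro l hl ⟨h1, h2⟩
    exact hs ⟨l, h1, h2.meetsS, mem_pencil.1 hl⟩

end

variable {P L : Type*} [Membership P L] [ProjectivePlane P L] [Fintype P] [Fintype L]
  {a : ℕ} {F : ReservedFrame P L a}

open scoped Classical in
/-- The number of lines through a free point, by type. -/
theorem Free.card_marked {u : P} (hu : F.Free u) :
    ((pencil L u).filter F.IsMarked).card + ((pencil L u).filter F.IsDouble).card = a - 1 := by
  rw [← card_meetsO hu.2.1, Finset.card_filter, Finset.card_filter, Finset.card_filter,
    ← Finset.sum_add_distrib]
  refine Finset.sum_congr rfl fun l hl => ?_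
  rw [mem_pencil] at hl
  by_cases hO : F.MeetsO l
  · rcases hO.isDouble_or_isMarked hu.2.1 hl with h | h
    · simp [hO, h, h.not_isMarked]
    · have h' : ¬ F.IsDouble l := fun h' => h'.not_isMarked h
      simp [hO, h, h']
  · have h1 : ¬ F.IsMarked l := fun h => hO h.2
    have h2 : ¬ F.IsDouble l := fun h => h.elim (fun h => hu.2.2 l h hl) fun h => hO h.2
    simp [hO, h1, h2]

open scoped Classical in
-- Of the a lines from u to the reserved base points other than the origin, one passes through the
-- apex exactly when u is shaded; the others are double or side lines according to whether they meet
-- O.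
theorem Free.card_side {u : P} (hu : F.Free u) :
    ((pencil L u).filter F.IsSide).card + ((pencil L u).filter F.IsDouble).card +
      (if F.Shaded u then 1 else 0) = a := by
  have h := card_meetsS' (F := F) hu.1
  refine Eq.trans ?_ h
  rw [← hu.card_shaded, Finset.card_filter, Finset.card_filter, Finset.card_filter,
    Finset.card_filter, ← Finset.sum_add_distrib, ← Finset.sum_add_distrib]
  refine Finset.sum_congr rfl fun l hl => ?_
  rw [mem_pencil] at hl
  by_cases hS : F.MeetsS' l
  · by_cases ha : F.apex ∈ l
    · have h1 : ¬ F.IsSide l := fun h => h.2.1 ha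
      have h2 : ¬ F.IsDouble l := fun h => h.apex_notMem ha
      simp [hS, ha, h1, h2]
    · by_cases hO : F.MeetsO l
      · have h1 : F.IsDouble l := Or.inr ⟨hS, hO⟩
        simp [hS, ha, h1, h1.not_isSide]
      · have h1 : F.IsSide l := ⟨ne_base_of_mem hu.1 hl, ha, hS, hO⟩
        have h2 : ¬ F.IsDouble l := fun h => h.not_isSide h1
        simp [hS, ha, h1, h2]
  · have h1 : ¬ F.IsSide l := fun h => hS h.2.2.1
    have h2 : ¬ F.IsDouble l := fun h => h.elim (fun h => hu.2.2 l h hl) fun h => hS h.1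
    simp [hS, h1, h2]

open scoped Classical in
-- Every line spreads its quota evenly, in units of 2h - a, over its eligible points, of which there
-- are at most 2h - a. Let u be on s side lines. If u is shaded, it is on s marked lines and
-- receives s(h - 1) + s(h + 1 - a) = s(2h - a). If not, it is on s - 1 marked lines, and its lines
-- to the origin and to the apex make up for this with h - a and 1.
theorem exists_selection (F : ReservedFrame P L a) {h : ℕ} (hh : 1 < h)
    (hord : ProjectivePlane.order P L = 2 * h) (ha : 1 ≤ a) (hah : a ≤ h) :
    ∃ T : L → Finset P,
      (∀ l, ∀ u ∈ T l, u ∈ l ∧ F.Free u ∧ (F.origin ∈ l → ¬ F.Shaded u)) ∧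
      (∀ l, (T l).card ≤ F.quota h l) ∧
      ∀ u, F.Free u → ((pencil L u).filter F.IsSide).card ≤
        (Finset.univ.filter fun l => u ∈ T l).card := by
  let W : L → P → ℕ := fun l u =>
    if u ∈ l ∧ F.Free u ∧ (F.origin ∈ l → ¬ F.Shaded u) then F.quota h l else 0
  obtain ⟨T, hT0, hTt, hTN⟩ := exists_choice_of_weights (2 * h - a) (by omega) W (F.quota h)
    (fun u => if F.Free u then ((pencil L u).filter F.IsSide).card else 0)
    (by
      intro l u
      simp only [W, quota]
      split_ifs <;> omega)
    (by
      intro l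
      simp only [W]
      rw [← Finset.sum_filter, Finset.sum_const, smul_eq_mul, mul_comm]
      rcases Nat.eq_zero_or_pos (F.quota h l) with h0 | h0
      · simp [h0]
      refine Nat.mul_le_mul_left _ ?_
      by_cases ho : F.origin ∈ l
      · have hz : F.apex ∉ l := by
          intro hz
          have h1 : ¬ F.IsSide l := fun h => h.2.1 hz
          have h2 : ¬ F.IsMarked l := fun h => h.apex_notMem hz
          have h3 : ¬ F.IsCentral l := fun h => h.2.1 hz
          simp [quota, h1, h2, h3, meetsS_of_origin ho] at h0
        have h1 := card_not_shaded hz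
        have h2 : (Finset.univ.filter fun u => u ∈ l ∧ F.Free u ∧ (F.origin ∈ l → ¬ F.Shaded u)) ⊆
            (linePts l).filter fun u => ¬ F.Shaded u := by
          intro u hu
          have hu' := (Finset.mem_filter.1 hu).2
          exact Finset.mem_filter.2 ⟨mem_linePts.2 hu'.1, hu'.2.2 ho⟩
        have h3 := Finset.card_le_card h2
        omega
      · have h1 := card_free ha ho
        have h2 : (Finset.univ.filter fun u => u ∈ l ∧ F.Free u ∧ (F.origin ∈ l → ¬ F.Shaded u)) ⊆
            (linePts l).filter F.Free := by
          intro u hu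
          have hu' := (Finset.mem_filter.1 hu).2
          exact Finset.mem_filter.2 ⟨mem_linePts.2 hu'.1, hu'.2.1⟩
        have h3 := Finset.card_le_card h2
        omega)
    (by
      intro u
      by_cases hu : F.Free u
      swap
      · simp [hu]
      rw [if_pos hu]
      refine le_trans ?_ (Finset.sum_le_sum_of_subset (Finset.subset_univ (pencil L u)))
      have hpt : ∀ l ∈ pencil L u, (h - 1) * (if F.IsSide l then 1 else 0) +
          (h + 1 - a) * (if F.IsMarked l then 1 else 0) +
          (h - a) * (if F.IsCentral l ∧ ¬ F.Shaded u then 1 else 0) +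
          (if F.apex ∈ l ∧ ¬ F.MeetsS l then 1 else 0) ≤ W l u := by
        intro l hl
        rw [mem_pencil] at hl
        by_cases h1 : F.IsSide l
        · have h2 : ¬ F.IsMarked l := fun h => h.not_isSide h1
          have h3 := h1.not_isCentral
          have h4 := h1.2.1
          have h5 := h1.2.2.1.origin_notMem h1.1
          simp [W, quota, h1, h2, h3, h4, h5, hl, hu]
        by_cases h2 : F.IsMarked l
        · have h3 := h2.not_isCentral
          have h4 := h2.apex_notMem
          have h5 := h2.origin_notMem
          simp [W, quota, h1, h2, h3, h4, h5, hl, hu]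
        by_cases h3 : F.IsCentral l
        · have h4 := h3.2.1
          have h5 := h3.2.2.1
          by_cases hs : F.Shaded u <;> simp [W, quota, h1, h2, h3, h4, h5, hl, hu, hs]
        by_cases h4 : F.apex ∈ l ∧ ¬ F.MeetsS l
        · have h5 : F.origin ∉ l := fun h => h4.2 (meetsS_of_origin h)
          simp [W, quota, h1, h2, h3, h4, h5, hl, hu]
        · simp [h1, h2, h3, h4]
      refine le_trans ?_ (Finset.sum_le_sum hpt)
      simp only [Finset.sum_add_distrib, ← Finset.mul_sum, ← Finset.card_filter]
      have h1 := hu.card_side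
      have h2 := hu.card_marked
      obtain ⟨x, hx⟩ : ∃ x, h - 1 = x := ⟨_, rfl⟩
      obtain ⟨y, hy⟩ : ∃ y, h - a = y := ⟨_, rfl⟩
      rw [hx, show h + 1 - a = y + 1 by omega, hy, show 2 * h - a = x + (y + 1) by omega]
      by_cases hs : F.Shaded u
      · rw [if_pos hs] at h1
        have h3 : ((pencil L u).filter F.IsSide).card = ((pencil L u).filter F.IsMarked).card := by
          omega
        rw [← h3]
        nlinarith
      · rw [if_neg hs] at h1
        have h3 : ((pencil L u).filter F.IsSide).card =
            ((pencil L u).filter F.IsMarked).card + 1 := by omega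
        have h4 : 1 ≤ ((pencil L u).filter fun l => F.IsCentral l ∧ ¬ F.Shaded u).card := by
          obtain ⟨l, hl, hl'⟩ := hu.exists_isCentral
          exact Finset.card_pos.2 ⟨l, Finset.mem_filter.2 ⟨mem_pencil.2 hl, hl', hs⟩⟩
        have h5 : 1 ≤ ((pencil L u).filter fun l => F.apex ∈ l ∧ ¬ F.MeetsS l).card := by
          obtain ⟨l, hl, hl'⟩ := exists_apex_of_not_shaded hs
          exact Finset.card_pos.2 ⟨l, Finset.mem_filter.2 ⟨mem_pencil.2 hl, hl'⟩⟩
        rw [h3]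
        nlinarith [Nat.mul_le_mul_left y h4])
  refine ⟨T, fun l u hu => ?_, hTt, fun u hu => ?_⟩
  · by_contra hul
    exact absurd (hT0 l u hu) (by simp [W, hul])
  · have := hTN u
    rwa [if_pos hu] at this

open scoped Classical in
/-- The number of lines that help a point that is not reserved. -/
theorem card_helps (ha : 1 ≤ a) {u : P} (huS : u ∉ F.S) (hua : u ≠ F.apex) :
    a + 1 ≤ ((pencil L u).filter fun l => F.Helps l u).card +
      if F.Free u then ((pencil L u).filter F.IsSide).card else 0 := by
  have hz := card_pencil_filter_mem (L := L) hua
  rw [Finset.card_filter] at hz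
  -- On the base line, u is helped by that line, by its line to the apex and by its a - 1 lines to
  -- O.
  by_cases hub : u ∈ F.base
  · have hua' : u ∉ F.axis := fun h => huS (eq_origin hub h ▸ F.origin_mem_S)
    have h1 := card_meetsO (F := F) hua'
    have h2 : ∑ l ∈ pencil L u, (if l = F.base then 1 else 0) = 1 := by
      rw [Finset.sum_ite_eq', if_pos (mem_pencil.2 hub)]
    refine le_trans ?_ (Nat.le_add_right _ _)
    rw [Finset.card_filter] at h1 ⊢
    have h3 : ∑ l ∈ pencil L u, ((if l = F.base then 1 else 0) + (if F.apex ∈ l then 1 else 0) +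
        if F.MeetsO l then 1 else 0) ≤ ∑ l ∈ pencil L u, if F.Helps l u then 1 else 0 := by
      refine Finset.sum_le_sum fun l hl => ?_
      rw [mem_pencil] at hl
      by_cases hO : F.MeetsO l
      · have hh : F.Helps l u := by
          rcases hO.isDouble_or_isMarked hua' hl with h | h
          · exact Or.inr (Or.inr (Or.inl h))
          · exact Or.inr (Or.inr (Or.inr (Or.inr (Or.inr ⟨h, Or.inl hub⟩))))
        simp [hO, hO.ne_base, hO.apex_notMem hua' hl, hh]
      · by_cases hlb : l = F.base
        · have hh : F.Helps l u := Or.inl hlb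
          have hla : F.apex ∉ l := fun h => F.apex_notMem (hlb ▸ h)
          rw [if_pos hlb, if_neg hla, if_neg hO, if_pos hh]
        · by_cases hla : F.apex ∈ l
          · have hh : F.Helps l u := Or.inr (Or.inl hla)
            simp [hO, hlb, hla, hh]
          · simp [hO, hlb, hla]
    rw [Finset.sum_add_distrib, Finset.sum_add_distrib] at h3
    omega
  -- On the axis, u is helped by the axis and by its a lines to the reserved base points other than
  -- the origin.
  by_cases hux : u ∈ F.axis
  · have h1 := card_meetsS' (F := F) hub
    refine le_trans ?_ (Nat.le_add_right _ _)
    rw [Finset.card_filter] at h1 ⊢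
    have h3 : ∑ l ∈ pencil L u, ((if F.apex ∈ l then 1 else 0) +
        if F.MeetsS' l then 1 else 0) ≤ ∑ l ∈ pencil L u, if F.Helps l u then 1 else 0 := by
      refine Finset.sum_le_sum fun l hl => ?_
      rw [mem_pencil] at hl
      have hlb := ne_base_of_mem hub hl
      by_cases hla : F.apex ∈ l
      · have hS : ¬ F.MeetsS' l := fun h => h.origin_notMem hlb
          (line_unique hua hl hla hux F.apex_mem ▸ F.origin_mem)
        have hh : F.Helps l u := Or.inr (Or.inl hla)
        simp [hla, hS, hh]
      · by_cases hS : F.MeetsS' l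
        · have hh : F.Helps l u := by
            by_cases hO : F.MeetsO l
            · exact Or.inr (Or.inr (Or.inl (Or.inr ⟨hS, hO⟩)))
            · exact Or.inr (Or.inr (Or.inr (Or.inl ⟨⟨hlb, hla, hS, hO⟩, hux⟩)))
          simp [hla, hS, hh]
        · simp [hla, hS]
    rw [Finset.sum_add_distrib] at h3
    omega
  -- On a marked line d, u is helped by d, by its line to the apex and by its a - 1 lines to O.
  by_cases huD : ∃ d ∈ F.D, u ∈ d
  · obtain ⟨d, hd, hud⟩ := huD
    have h1 := card_meetsO (F := F) hux
    have h2 : ∑ l ∈ pencil L u, (if l = d then 1 else 0) = 1 := by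
      rw [Finset.sum_ite_eq', if_pos (mem_pencil.2 hud)]
    refine le_trans ?_ (Nat.le_add_right _ _)
    rw [Finset.card_filter] at h1 ⊢
    have h3 : ∑ l ∈ pencil L u, ((if l = d then 1 else 0) + (if F.apex ∈ l then 1 else 0) +
        if F.MeetsO l then 1 else 0) ≤ ∑ l ∈ pencil L u, if F.Helps l u then 1 else 0 := by
      refine Finset.sum_le_sum fun l hl => ?_
      rw [mem_pencil] at hl
      by_cases hO : F.MeetsO l
      · have hh : F.Helps l u := by
          rcases hO.isDouble_or_isMarked hux hl with h | h
          · exact Or.inr (Or.inr (Or.inl h))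
          · exact Or.inr (Or.inr (Or.inr (Or.inr (Or.inr ⟨h, Or.inr ⟨d, hd, hud⟩⟩))))
        have hld : l ≠ d := fun h => hO.origin_notMem hux hl (h ▸ (F.D_mem d hd).1)
        simp [hO, hld, hO.apex_notMem hux hl, hh]
      · by_cases hld : l = d
        · have hD : F.IsDouble l := Or.inl (hld ▸ hd)
          have hh : F.Helps l u := Or.inr (Or.inr (Or.inl hD))
          rw [if_pos hld, if_neg hD.apex_notMem, if_neg hO, if_pos hh]
        · by_cases hla : F.apex ∈ l
          · have hh : F.Helps l u := Or.inr (Or.inl hla)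
            simp [hO, hld, hla, hh]
          · simp [hO, hld, hla]
    rw [Finset.sum_add_distrib, Finset.sum_add_distrib] at h3
    omega
  -- A free point is certainly helped by its line to the apex, by its double lines and, if shaded,
  -- by its central line; its side lines count what is left to be requested.
  have hu : F.Free u := ⟨hub, hux, fun d hd hud => huD ⟨d, hd, hud⟩⟩
  have h1 := hu.card_side
  have h2 : (if F.Shaded u then 1 else 0) ≤
      ∑ l ∈ pencil L u, if F.IsCentral l ∧ F.Shaded u then 1 else 0 := by
    split_ifs with hs
    · obtain ⟨l, hl, hl'⟩ := hu.exists_isCentral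
      rw [← Finset.card_filter]
      exact Finset.card_pos.2 ⟨l, Finset.mem_filter.2 ⟨mem_pencil.2 hl, hl', hs⟩⟩
    · exact Nat.zero_le _
  have h3 : ∑ l ∈ pencil L u, ((if F.apex ∈ l then 1 else 0) + (if F.IsDouble l then 1 else 0) +
      if F.IsCentral l ∧ F.Shaded u then 1 else 0) ≤
        ∑ l ∈ pencil L u, if F.Helps l u then 1 else 0 := by
    refine Finset.sum_le_sum fun l _ => ?_
    by_cases hla : F.apex ∈ l
    · have hc : ¬ F.IsCentral l := fun h => h.2.1 hla
      have hd : ¬ F.IsDouble l := fun h => h.apex_notMem hla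
      have hh : F.Helps l u := Or.inr (Or.inl hla)
      simp [hla, hc, hd, hh]
    · by_cases hd : F.IsDouble l
      · have hh : F.Helps l u := Or.inr (Or.inr (Or.inl hd))
        simp [hla, hd, hd.not_isCentral, hh]
      · by_cases hc : F.IsCentral l ∧ F.Shaded u
        · have hh : F.Helps l u := Or.inr (Or.inr (Or.inr (Or.inr (Or.inl hc))))
          simp [hla, hd, hc, hh]
        · simp [hla, hd, hc]
  rw [Finset.sum_add_distrib, Finset.sum_add_distrib, ← Finset.card_filter] at h3
  rw [if_pos hu]
  rw [Finset.card_filter F.IsDouble] at h1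
  rw [← Finset.card_filter] at hz
  rw [Finset.card_filter]
  have h4 := h3
  simp only [Finset.card_filter] at h1 h3 hz ⊢
  omega

/-- The five terms contribute at most 2, 2(q + 1), (a + 1)(q - 1), a - 1 and (a - 1)q. -/
theorem sum_killBound (F : ReservedFrame P L a) (ha : 1 ≤ a) :
    ∑ l, F.killBound l ≤ (2 * a + 2) * ProjectivePlane.order P L + 2 := by
  classical
  have hj := fun x : P => (exists_joining_line (L := L) x F.apex).choose_spec
  simp only [killBound]
  rw [Finset.sum_add_distrib, Finset.sum_add_distrib, Finset.sum_add_distrib,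
    Finset.sum_add_distrib]
  have h1 : ∑ l, (if l = F.base then 2 else 0) = 2 := by simp
  have h2 : ∑ l : L, (if F.apex ∈ l then 2 else 0) = 2 * (ProjectivePlane.order P L + 1) := by
    rw [← card_pencil (L := L) F.apex, ← Finset.sum_filter, Finset.sum_const, smul_eq_mul, mul_comm]
    rfl
  have h3 : ∑ l : L, (if F.apex ∉ l ∧ l ≠ F.base ∧ F.MeetsS l then 1 else 0) ≤
      (a + 1) * (ProjectivePlane.order P L - 1) := by
    rw [← Finset.card_filter, ← F.card_S]
    refine (Finset.card_le_card (t := F.S.biUnion fun x => pencil L x \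
      {F.base, (exists_joining_line (L := L) x F.apex).choose}) ?_).trans
      (Finset.card_biUnion_le_card_mul _ _ _ fun x hx => ?_)
    · intro l hl
      obtain ⟨h1, h2, x, hx, hxl⟩ := (Finset.mem_filter.1 hl).2
      refine Finset.mem_biUnion.2 ⟨x, hx, Finset.mem_sdiff.2 ⟨mem_pencil.2 hxl, ?_⟩⟩
      rw [Finset.mem_insert, Finset.mem_singleton, not_or]
      exact ⟨h2, fun h => h1 (h ▸ (hj x).2)⟩
    · rw [Finset.card_sdiff_of_subset, card_pencil, Finset.card_pair]
      · omega
      · exact fun h => F.apex_notMem (h ▸ (hj x).2)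
      · intro l hl
        rcases Finset.mem_insert.1 hl with rfl | hl
        · exact mem_pencil.2 (F.S_mem x hx)
        · rw [Finset.mem_singleton.1 hl]
          exact mem_pencil.2 (hj x).1
  have h4 : ∑ l : L, (if l ∈ F.D then 1 else 0) = a - 1 := by
    rw [← Finset.card_filter, Finset.filter_mem_eq_inter, Finset.univ_inter, F.card_D]
  have h5 : ∑ l : L, (if F.MeetsO l ∧ F.origin ∉ l then 1 else 0) ≤
      (a - 1) * ProjectivePlane.order P L := by
    rw [← Finset.card_filter, ← F.card_O]
    refine (Finset.card_le_card (t := F.O.biUnion fun x => (pencil L x).erase F.axis) ?_).trans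
      (Finset.card_biUnion_le_card_mul _ _ _ fun x hx => ?_)
    · intro l hl
      obtain ⟨⟨x, hx, hxl⟩, h2⟩ := (Finset.mem_filter.1 hl).2
      exact Finset.mem_biUnion.2 ⟨x, hx, Finset.mem_erase.2 ⟨fun h => h2 (h ▸ F.origin_mem),
        mem_pencil.2 hxl⟩⟩
    · rw [Finset.card_erase_of_mem (mem_pencil.2 (F.O_mem x hx).1), card_pencil,
        Nat.add_sub_cancel]
  obtain ⟨b, rfl⟩ : ∃ b, a = b + 1 := ⟨a - 1, by omega⟩
  obtain ⟨q, hq⟩ : ∃ q, ProjectivePlane.order P L = q + 1 :=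
    ⟨ProjectivePlane.order P L - 1, by have := ProjectivePlane.one_lt_order P L; omega⟩
  rw [hq] at h2 h3 h5 ⊢
  rw [Nat.add_sub_cancel] at h3 h4 h5
  nlinarith

end ReservedFrame

/-! ### Conclusion for 1 ≤ a ≤ q/2 -/

section

open Configuration ReservedFrame

variable {P L : Type*} [Membership P L] [ProjectivePlane P L] [Fintype P] [Fintype L]

theorem le_psi_of_deficiency {h a : ℕ} (hh : 1 < h) (hord : ProjectivePlane.order P L = 2 * h)
    (ha : 1 ≤ a) (hah : a ≤ h) :
    (Fintype.card P + 2 * h - 2 * a) * (2 * h) ≤ psi (Fintype.card P + (2 * h - a)) := by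
  classical
  obtain ⟨F⟩ := exists_reservedFrame P L (a := a) (by omega)
  obtain ⟨T, hT, hTq, hTs⟩ := F.exists_selection hh hord ha hah
  choose pat hpat using fun l => exists_suits hh hord ha hah l (hT l) (hTq l)
  have hne : Nonempty (Fin (2 * h - a)) := ⟨⟨0, by omega⟩⟩
  obtain ⟨K, hK, ⟨N⟩⟩ := exists_spanningColouring_even (V := P ⊕ Fin (2 * h - a))
    (Y := (insert F.apex F.S).disjSum Finset.univ) (show 0 < h by omega) (by
      rw [Finset.card_disjSum, Finset.card_insert_of_notMem F.apex_notMem_S, F.card_S,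
        Finset.card_univ, Fintype.card_fin]
      omega)
  have hnot : ∀ {u}, u ∉ insert F.apex F.S → u ≠ F.apex ∧ u ∉ F.S := fun hu =>
    not_or.1 (Finset.mem_insert.not.1 hu)
  have hbS : ∀ {u}, u ∉ F.S → u ∈ F.base → u ∉ F.axis := fun hu hub hux =>
    hu (eq_origin hub hux ▸ F.origin_mem_S)
  have key := le_psi_of_patterns_of_spanningColouring (X := Fin (2 * h - a)) pat
    (insert F.apex F.S) (Finset.univ.filter fun l => F.apex ∈ l ∨ F.MeetsS l) K N
    (by
      intro s hs l hsl
      rw [Finset.mem_filter]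
      refine ⟨Finset.mem_univ _, ?_⟩
      rcases Finset.mem_insert.1 hs with rfl | hs
      exacts [Or.inl hsl, Or.inr ⟨s, hs, hsl⟩])
    (by
      intro _ l hl
      rcases (Finset.mem_filter.1 hl).2 with h | ⟨s, hs, hsl⟩
      exacts [⟨_, Finset.mem_insert_self _ _, h⟩, ⟨s, Finset.mem_insert_of_mem hs, hsl⟩])
    (fun l => (hpat l).next_notMem)
    (by
      intro u hu
      obtain ⟨hua, huS⟩ := hnot hu
      rw [Fintype.card_fin]
      have hc := card_pencil (L := L) u
      rw [hord] at hc
      -- All but q - a of the q + 1 lines through u must be weak or kill u. For u on the base line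
      -- the exceptions are that line, the line to the apex and the a - 1 lines to O, each of which
      -- is double, hence weak, or marked, hence kills u. Off the base line they are the a + 1 lines
      -- to S.
      by_cases hub : u ∈ F.base
      · have h1 := card_meetsO (F := F) (hbS huS hub)
        have h2 : ∑ l ∈ pencil L u, (if l = F.base then 1 else 0) = 1 := by
          rw [Finset.sum_ite_eq', if_pos (mem_pencil.2 hub)]
        have h3 := card_pencil_filter_mem (L := L) hua
        rw [Finset.card_filter] at h1 h3 ⊢
        have h4 : ∑ l ∈ pencil L u, ((if l ∉ Finset.univ.filter (fun l => F.apex ∈ l ∨ F.MeetsS l) ∧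
            u ∉ (pat l).kill then 1 else 0) + (if F.MeetsO l then 1 else 0) +
            (if l = F.base then 1 else 0) + (if F.apex ∈ l then 1 else 0)) ≤
              ∑ l ∈ pencil L u, 1 := by
          refine Finset.sum_le_sum fun l hl => ?_
          rw [mem_pencil] at hl
          simp only [Finset.mem_filter, Finset.mem_univ, true_and]
          by_cases hO : F.MeetsO l
          · have hw : ¬ (¬ (F.apex ∈ l ∨ F.MeetsS l) ∧ u ∉ (pat l).kill) := by
              rintro ⟨hw, hk⟩
              exact hk ((hpat l).marked ⟨fun h => hw (Or.inr h), hO⟩ u hl hub)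
            rw [if_neg hw, if_pos hO, if_neg hO.ne_base, if_neg (hO.apex_notMem (hbS huS hub) hl)]
          · by_cases hlb : l = F.base
            · have hw : F.MeetsS l := hlb ▸ meetsS_of_origin F.origin_base
              have hla : F.apex ∉ l := fun h => F.apex_notMem (hlb ▸ h)
              simp only [hw, hO, hla, or_true, not_true_eq_false, false_and, if_false]
              split_ifs
              omega
            · by_cases hla : F.apex ∈ l
              · simp [hla, hO, hlb]
              · simp only [hla, hO, hlb, if_false]
                split_ifs
                all_goals omega
        rw [Finset.sum_add_distrib, Finset.sum_add_distrib, Finset.sum_add_distrib, h1, h2, h3,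
          ← Finset.card_eq_sum_ones, hc] at h4
        omega
      · have h1 := card_meetsS (F := F) hub
        have h2 : (pencil L u).filter (fun l => l ∉ Finset.univ.filter
            (fun l => F.apex ∈ l ∨ F.MeetsS l) ∧ u ∉ (pat l).kill) ⊆
              (pencil L u).filter fun l => ¬ F.MeetsS l := by
          intro l hl
          simp only [Finset.mem_filter, Finset.mem_univ, true_and] at hl ⊢
          exact ⟨hl.1, fun h => hl.2.1 (Or.inr h)⟩
        have h3 := Finset.card_le_card h2
        have h4 := Finset.card_filter_add_card_filter_not (s := pencil L u) F.MeetsS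
        omega)
    (by
      intro u hu
      obtain ⟨hua, huS⟩ := hnot hu
      rw [hord, Fintype.card_fin]
      have h1 := card_helps (F := F) ha huS hua
      have h2 : ∑ l ∈ pencil L u, ((if u ∈ T l then 1 else 0) + if F.Helps l u then 1 else 0) ≤ _ :=
        Finset.sum_le_sum fun l hl => (hpat l).helps u (mem_pencil.1 hl) hu
      refine le_trans ?_ (add_le_add_right h2 _)
      rw [Finset.sum_add_distrib, ← Finset.card_filter, ← Finset.card_filter]
      have h3 : (if F.Free u then ((pencil L u).filter F.IsSide).card else 0) ≤
          ((pencil L u).filter fun l => u ∈ T l).card := by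
        split_ifs with hf
        · refine (hTs u hf).trans (Finset.card_le_card fun l hl => ?_)
          rw [Finset.mem_filter] at hl ⊢
          exact ⟨mem_pencil.2 (hT l u hl.2).1, hl.2⟩
        · exact Nat.zero_le _
      omega)
    (by
      intro u hu
      rcases Finset.mem_insert.1 hu with rfl | huS
      · rw [Finset.filter_eq_empty_iff.2, Finset.filter_eq_empty_iff.2]
        · simp
        · rintro y hy ⟨hya, l, hl, hyl, hm⟩
          exact hm (((hpat l).apex (mem_pencil.1 hl)).2 y ((Finset.mem_insert.1 hy).resolve_left hya)
            (mem_linePts.1 hyl)).1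
        · intro l hl
          exact not_not.2 ((hpat l).apex (mem_pencil.1 hl)).1
      · have hub := F.S_mem u huS
        have hua : u ≠ F.apex := fun h => F.apex_notMem (h ▸ hub)
        have hz := card_pencil_filter_mem (L := L) hua
        have hb := (hpat F.base).base rfl u huS
        have h1 : ((pencil L u).filter fun l => u ∉ (pat l).kill).card ≤
            (if u ∈ (pat F.base).kill then 0 else 1) +
              ((pencil L u).filter fun l => F.apex ∈ l).card := by
          rw [Finset.card_filter, Finset.card_filter]
          have h2 : (if u ∈ (pat F.base).kill then 0 else 1) = ∑ l ∈ pencil L u,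
              if l = F.base then (if u ∈ (pat F.base).kill then 0 else 1) else 0 := by
            rw [Finset.sum_ite_eq', if_pos (mem_pencil.2 hub)]
          rw [h2, ← Finset.sum_add_distrib]
          refine Finset.sum_le_sum fun l hl => ?_
          rw [mem_pencil] at hl
          by_cases hlb : l = F.base
          · subst hlb
            rw [if_pos rfl]
            split_ifs <;> omega
          · by_cases hla : F.apex ∈ l
            · simp only [hla, if_true]
              split_ifs <;> omega
            · have := (hpat l).kill_S u huS hl hlb hla
              simp [this]
        have h3 : (insert F.apex F.S).filter (fun y => y ≠ u ∧ ∃ l ∈ pencil L u,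
            y ∈ (linePts l : Finset P) ∧ (pat l).mid u y ∉ (pat l).kill) ⊆
              F.S.filter fun y => y ≠ u ∧ (pat F.base).mid u y ∉ (pat F.base).kill := by
          intro y hy
          rw [Finset.mem_filter] at hy ⊢
          obtain ⟨hy, hyu, l, hl, hyl, hm⟩ := hy
          rw [mem_pencil] at hl
          rw [mem_linePts] at hyl
          rcases Finset.mem_insert.1 hy with rfl | hyS
          · exact absurd (((hpat l).apex hyl).2 u huS hl).2.1 hm
          · have := line_unique hyu hyl hl (F.S_mem y hyS) hub
            subst this
            exact ⟨hyS, hyu, hm⟩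
        have h4 : a - 1 ≤ ((pencil L u).filter F.IsDouble).card := by
          by_cases huo : u = F.origin
          · rw [← F.card_D]
            refine Finset.card_le_card fun d hd => ?_
            rw [Finset.mem_filter, mem_pencil, huo]
            exact ⟨(F.D_mem d hd).1, Or.inl hd⟩
          · have hux := notMem_axis huS huo
            rw [← card_meetsO (F := F) hux]
            refine Finset.card_le_card fun l hl => ?_
            rw [Finset.mem_filter] at hl ⊢
            refine ⟨hl.1, (hl.2.isDouble_or_isMarked hux (mem_pencil.1 hl.1)).resolve_right ?_⟩
            exact fun h => h.1 ⟨u, huS, mem_pencil.1 hl.1⟩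
        have h5 : (if u ∈ (pat F.base).served then 1 else 0) +
            ((pencil L u).filter fun l => F.apex ∈ l).card +
            ((pencil L u).filter F.IsDouble).card ≤
              ((pencil L u).filter fun l => u ∈ (pat l).served).card := by
          have h6 : (if u ∈ (pat F.base).served then 1 else 0) = ∑ l ∈ pencil L u,
              if l = F.base then (if u ∈ (pat F.base).served then 1 else 0) else 0 := by
            rw [Finset.sum_ite_eq', if_pos (mem_pencil.2 hub)]
          rw [h6, Finset.card_filter, Finset.card_filter, Finset.card_filter,
            ← Finset.sum_add_distrib, ← Finset.sum_add_distrib]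
          refine Finset.sum_le_sum fun l hl => ?_
          rw [mem_pencil] at hl
          by_cases hD : F.IsDouble l
          · have := (hpat l).served_S hD u huS hl
            simp [this, hD, hD.ne_base, hD.apex_notMem]
          · by_cases hlb : l = F.base
            · subst hlb
              simp [hD, F.apex_notMem]
            · by_cases hla : F.apex ∈ l
              · have := (((hpat l).apex hla).2 u huS hl).2.2
                simp [this, hD, hlb, hla]
              · simp [hD, hlb, hla]
        have h7 := Finset.card_le_card h3
        omega)
    (m := Fintype.card P + (2 * h - a)) (by simp)
  refine le_trans ?_ key
  have hL := ProjectivePlane.card_lines P L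
  have hP := ProjectivePlane.card_points P L
  have hkle : ∀ l, (pat l).kill.card ≤ 2 * h + 1 := fun l => by
    rw [← hord, ← card_linePts (P := P) l]
    exact Finset.card_le_card (pat l).kill_subset
  have htot : ∑ l, (2 * h + 1 - (pat l).kill.card) + ∑ l, (pat l).kill.card =
      Fintype.card L * (2 * h + 1) := by
    rw [← Finset.sum_add_distrib, Finset.sum_congr rfl (g := fun _ => 2 * h + 1)
      (fun l _ => by have := hkle l; omega)]
    simp
  have hkt : ∑ l, (pat l).kill.card ≤ (2 * a + 2) * (2 * h) + 2 := by
    rw [← hord]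
    exact (Finset.sum_le_sum fun l _ => (hpat l).kill_le).trans (F.sum_killBound ha)
  rw [hord, hK]
  rw [hL, hord] at htot
  rw [hP, hord]
  obtain ⟨c, hc⟩ : ∃ c, (2 * h) ^ 2 + 2 * h + 1 + 2 * h = c + 2 * a :=
    ⟨(2 * h) ^ 2 + 2 * h + 1 + 2 * h - 2 * a, by omega⟩
  rw [hc, Nat.add_sub_cancel]
  nlinarith

end

/-! ### The four ranges of a -/

theorem theorem2 {P : Type*} {L : Type*} [Membership P L] [Finite P] [Finite L]
    [Configuration.ProjectivePlane P L]
    (q : ℕ) (hq : 4 ≤ q) (hq_even : Even q)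
    (horder : Configuration.ProjectivePlane.order P L = q)
    (n : ℕ) (hn : n = q ^ 2 + q + 1)
    (a : ℤ) (ha : -1 ≤ a) (ha' : a ≤ (q : ℤ) / 2 + 1)
    (m : ℕ) (hm : (m : ℤ) = n + q - a) :
    ((m : ℤ) - a) * q ≤ (psi m : ℤ) := by
  have := Fintype.ofFinite P
  have := Fintype.ofFinite L
  obtain ⟨h, hh⟩ := hq_even
  obtain rfl : q = 2 * h := by omega
  have hP := Configuration.ProjectivePlane.card_points P L
  rw [horder, ← hn] at hP
  have ha2 : a ≤ h + 1 := by
    push_cast at ha'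
    omega
  rcases (by omega : a = -1 ∨ a = 0 ∨ (1 ≤ a ∧ a ≤ h) ∨ a = h + 1) with rfl | rfl | ⟨h1, h2⟩ | rfl
  · have key := le_psi_of_excess_one (by omega) horder
    rw [hP] at key
    obtain rfl : m = n + (2 * h + 1) := by omega
    zify at key
    push_cast
    linarith
  · have key := le_psi_of_excess_zero (by omega) horder
    rw [hP] at key
    obtain rfl : m = n + 2 * h := by omega
    zify at key
    push_cast
    linarith
  · lift a to ℕ using by omega
    have key := le_psi_of_deficiency (a := a) (by omega) horder (by omega) (by omega)
    rw [hP] at key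
    obtain rfl : m = n + (2 * h - a) := by omega
    have h3 : ((n + (2 * h - a) : ℕ) : ℤ) - a = (n + 2 * h - 2 * a : ℕ) := by omega
    rw [h3]
    exact_mod_cast key
  · have key := le_psi_of_deficiency_max (by omega) horder
    rw [hP] at key
    obtain rfl : m = n + (h - 1) := by omega
    have hn2 : 2 ≤ n := by
      rw [hn]
      nlinarith
    have h3 : ((n + (h - 1) : ℕ) : ℤ) - (h + 1) = (n - 2 : ℕ) := by omega
    rw [h3]
    exact_mod_cast key
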